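/- Let $M$ be a smooth 7-manifold with a $G_2$-structure $(\varphi,g)$, i.e. a Riemannian metric $g$ and a smooth 3-form $\varphi$ such that every tangent space $T_xM$ is identified by some linear isometry with $\mathbb R^7$ in such a way that $\varphi_x$ corresponds to $$\varphi_0=dx_{123}+dx_{145}+dx_{167}+dx_{246}-dx_{257}-dx_{347}-dx_{356}.$$ Let $\times$ be the vector product defined by $\langle u\times v,w\rangle=\varphi(u,v,w)$, let $\nabla$ be the Levi-Civita connection of $g$, and let $R(X,Y)=\nabla_X\nabla_Y-\nabla_Y\nabla_X-\nabla_{[X,Y]}$. Suppose that the structure is torsion-free, i.e. $d\varphi=0$ and $d{*}\varphi=0$, where $*$ is the Hodge star of $g$ and of the orientation defined by $\varphi$. Let $Y$ be an immersed (in particular, an embedded) smooth 3-dimensional submanifold of $M$, possibly with boundary, which is associative, i.e. its tangent spaces are stable under $\times$. Let $\nu$ be its normal bundle, let $\pi_\nu$ be the orthogonal projection to $\nu$, and write $\nabla=\nabla^\top+\nabla^\perp$ for the decomposition of $\nabla$ along $Y$ into its parts tangent and normal to $Y$. In the formulas below, $(e_1,e_2,e_3)$ is an orthonormal frame of $TY$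 with $e_3=e_1\times e_2$ and $(\eta_1,\dots,\eta_4)$ is an orthonormal frame of $\nu$. For smooth sections $s$ of $\nu$ put: * $Ds=\sum_{i=1}^3 e_i\times\nabla^\perp_{e_i}s+\sum_{k=1}^4(\nabla_s{*}\varphi)(\eta_k,e_1,e_2,e_3)\,\eta_k$ (the deformation operator); * $\nabla^{\perp*}\nabla^\perp s=-\sum_{i=1}^3\nabla^{\perp2}_{e_i,e_i}s$, where $\nabla^{\perp2}_{v,w}=\nabla^\perp_v\nabla^\perp_w-\nabla^\perp_{\nabla^\top_vw}$ for local vector fields $v,w$ on $Y$; * $\mathcal R s=\pi_\nu\sum_{i=1}^3R(e_i,s)e_i$ (Simons' partial Ricci operator); * $\mathcal A s=A^t(A(s))$, where $A(s)(u)=-\nabla^\top_us$ is the second fundamental form, viewed as a bundle map from $\nu$ to the symmetric endomorphisms of $TY$, and $A^t$ is its transpose, that is, $A^t(B)=\sum_{k=1}^4\operatorname{tr}(B\,A(\eta_k))\,\eta_k$. Then $D$ maps smooth sections of $\nu$ to smooth sections of $\nu$, and for every smooth section $s$ of $\nu$ $$D^2s=\nabla^{\perp*}\nabla^\perp s+\mathcal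 R s-\mathcal A s .$$ -/

import Mathlib

open Bundle
open scoped Manifold ContDiff

noncomputable section

namespace AssocGeom

/-! ## Riemannian geometry in coordinates

Here `g` is a Riemannian metric on an open subset of a finite-dimensional vector space `E`, given
as a function with values in bilinear forms. -/

section Coordinates

variable {E : Type*} [NormedAddCommGroup E] [NormedSpace ℝ E]

/-- The Christoffel symbol `Γ(z)(u, v) ∈ E` of the Levi-Civita connection of `g`:
`g (Γ(u, v), w) = (1/2) (∂_u g (v, w) + ∂_v g (u, w) - ∂_w g (u, v))` for all `w`. -/
def christoffel (g : E → E →L[ℝ] E →L[ℝ] ℝ) (z u v : E) : E :=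
  (g z).inverse ((1 / 2 : ℝ) •
    (fderiv ℝ g z u v + fderiv ℝ g z v u - ((fderiv ℝ g z).flip u).flip v))

/-- The curvature tensor `R(u, v) w`, with the convention
`R(X, Y) = ∇_X ∇_Y - ∇_Y ∇_X - ∇_[X, Y]`, in terms of the Christoffel symbols. -/
def coordCurvature (g : E → E →L[ℝ] E →L[ℝ] ℝ) (z u v w : E) : E :=
  fderiv ℝ (fun z' ↦ christoffel g z' v w) z u - fderiv ℝ (fun z' ↦ christoffel g z' u w) z v
    + christoffel g z u (christoffel g z v w) - christoffel g z v (christoffel g z u w)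

/-- The covariant derivative `(∇_u α)(v₁, …, v_k)` of a differential form `α`. -/
def coordCovDerivForm {k : ℕ} (g : E → E →L[ℝ] E →L[ℝ] ℝ) (α : E → E [⋀^Fin k]→L[ℝ] ℝ)
    (z u : E) (v : Fin k → E) : ℝ :=
  fderiv ℝ α z u v - ∑ i, α z (Function.update v i (christoffel g z u (v i)))

end Coordinates

/-! ## The model form and the Hodge star on `ℝ⁷` -/

/-- The model space `ℝ⁷` with its Euclidean inner product. -/
abbrev E7 : Type := EuclideanSpace ℝ (Fin 7)

/-- The model space `ℝ³`. -/
abbrev E3 : Type := EuclideanSpace ℝ (Fin 3)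

/-- The standard basis of `ℝ⁷`. -/
def stdVec (i : Fin 7) : E7 := EuclideanSpace.single i 1

/-- The elementary form `dx_i ∧ dx_j ∧ dx_k` (coordinates are numbered from `0` to `6`). -/
def dx3 (i j k : Fin 7) (u v w : E7) : ℝ :=
  Matrix.det !![u i, u j, u k; v i, v j, v k; w i, w j, w k]

/-- `φ₀ = dx₁₂₃ + dx₁₄₅ + dx₁₆₇ + dx₂₄₆ - dx₂₅₇ - dx₃₄₇ - dx₃₅₆` on `ℝ⁷`. -/
def stdG2Form (u v w : E7) : ℝ :=
  dx3 0 1 2 u v w + dx3 0 3 4 u v w + dx3 0 5 6 u v w + dx3 1 3 5 u v w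
    - dx3 1 4 6 u v w - dx3 2 3 6 u v w - dx3 2 4 5 u v w

/-- The standard volume form `dx₁₂₃₄₅₆₇` of `ℝ⁷`. -/
def stdVol : E7 [⋀^Fin 7]→L[ℝ] ℝ :=
  { (EuclideanSpace.basisFun (Fin 7) ℝ).toBasis.det with
    cont := by
      change Continuous fun v : Fin 7 → E7 ↦ (EuclideanSpace.basisFun (Fin 7) ℝ).toBasis.det v
      simp only [Module.Basis.det_apply]
      refine Continuous.matrix_det (continuous_matrix fun i j ↦ ?_)
      simp only [Module.Basis.toMatrix_apply, OrthonormalBasis.coe_toBasis_repr_apply,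
        EuclideanSpace.basisFun_repr]
      fun_prop }

/-- The Hodge star of a 3-form on the oriented Euclidean space `ℝ⁷`:
`⋆α = ∑_{i < j < k} α(e_i, e_j, e_k) vol(e_i, e_j, e_k, ⬝, ⬝, ⬝, ⬝)`. -/
def hodgeStar3 (α : E7 [⋀^Fin 3]→L[ℝ] ℝ) : E7 [⋀^Fin 4]→L[ℝ] ℝ :=
  (1 / 6 : ℝ) • ∑ i, ∑ j, ∑ k, α ![stdVec i, stdVec j, stdVec k] •
    (((stdVol.curryLeft (stdVec i)).curryLeft (stdVec j)).curryLeft (stdVec k))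

/-! ## The ambient manifold -/

section Ambient

variable {M : Type*} [TopologicalSpace M] [ChartedSpace E7 M] [IsManifold (𝓡 7) ∞ M]

instance (x : M) : FiniteDimensional ℝ (TangentSpace (𝓡 7) x) :=
  inferInstanceAs (FiniteDimensional ℝ E7)

/-- The expression `T_x M → ℝ⁷` of tangent vectors at `x` in the preferred chart at `p`. -/
abbrev toChart (p x : M) : TangentSpace (𝓡 7) x →L[ℝ] E7 :=
  (trivializationAt E7 (TangentSpace (𝓡 7) : M → Type _) p).continuousLinearMapAt ℝ x

/-- The tangent vector at `x` with given expression in the preferred chart at `p`. -/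
abbrev ofChart (p x : M) : E7 →L[ℝ] TangentSpace (𝓡 7) x :=
  (trivializationAt E7 (TangentSpace (𝓡 7) : M → Type _) p).symmL ℝ x

/-- The expression of a differential form in the preferred chart at `p`. -/
def formInChart {k : ℕ} (α : (x : M) → TangentSpace (𝓡 7) x [⋀^Fin k]→L[ℝ] ℝ) (p : M) (z : E7) :
    E7 [⋀^Fin k]→L[ℝ] ℝ :=
  (α ((extChartAt (𝓡 7) p).symm z)).compContinuousLinearMap
    (ofChart p ((extChartAt (𝓡 7) p).symm z))

/-- Smooth differential forms. -/
def IsSmoothForm {k : ℕ} (α : (x : M) → TangentSpace (𝓡 7) x [⋀^Fin k]→L[ℝ] ℝ) : Prop :=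
  ∀ p : M, ContDiffOn ℝ ∞ (formInChart α p) (extChartAt (𝓡 7) p).target

/-- `dα = 0`; the exterior derivative at `p` is computed in the preferred chart at `p`. -/
def IsClosedForm {k : ℕ} (α : (x : M) → TangentSpace (𝓡 7) x [⋀^Fin k]→L[ℝ] ℝ) : Prop :=
  ∀ p : M, extDeriv (formInChart α p) (extChartAt (𝓡 7) p p) = 0

variable [RiemannianBundle (fun x : M ↦ TangentSpace (𝓡 7) x)]

/-- The expression of the Riemannian metric of `M` in the preferred chart at `p`. -/
def metricInChart (p : M) (z : E7) : E7 →L[ℝ] E7 →L[ℝ] ℝ :=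
  (innerSL ℝ (E := TangentSpace (𝓡 7) ((extChartAt (𝓡 7) p).symm z))).bilinearComp
    (ofChart p ((extChartAt (𝓡 7) p).symm z)) (ofChart p ((extChartAt (𝓡 7) p).symm z))

/-- The Riemannian curvature tensor `R(u, v) w` of `M` at `p`. -/
def curvature (p : M) (u v w : TangentSpace (𝓡 7) p) : TangentSpace (𝓡 7) p :=
  ofChart p p (coordCurvature (metricInChart p) (extChartAt (𝓡 7) p p)
    (toChart p p u) (toChart p p v) (toChart p p w))

/-- The covariant derivative `(∇_u α)(v₁, …, v_k)` of a differential form on `M` at `p`. -/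
def covDerivForm {k : ℕ} (α : (x : M) → TangentSpace (𝓡 7) x [⋀^Fin k]→L[ℝ] ℝ) (p : M)
    (u : TangentSpace (𝓡 7) p) (v : Fin k → TangentSpace (𝓡 7) p) : ℝ :=
  coordCovDerivForm (metricInChart p) (formInChart α p) (extChartAt (𝓡 7) p p)
    (toChart p p u) (fun i ↦ toChart p p (v i))

variable (M) in
/-- A `G₂`-structure `(φ, g)`, where `g` is the given Riemannian metric of `M`: a smooth 3-form
which at every point corresponds to `φ₀` under some isometry of the tangent space with `ℝ⁷`. -/
structure G2Structure where
  /-- The 3-form `φ`. -/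
  form : (x : M) → TangentSpace (𝓡 7) x [⋀^Fin 3]→L[ℝ] ℝ
  smooth : IsSmoothForm form
  exists_frame : ∀ x : M, ∃ L : E7 ≃L[ℝ] TangentSpace (𝓡 7) x,
    (∀ u v : E7, inner ℝ (L u) (L v) = inner ℝ u v) ∧
      ∀ u v w : E7, form x ![L u, L v, L w] = stdG2Form u v w

namespace G2Structure

variable (G : G2Structure M)

/-- A `G₂`-frame at `x`. -/
def frame (x : M) : E7 ≃L[ℝ] TangentSpace (𝓡 7) x := (G.exists_frame x).choose

lemma inner_frame (x : M) (u v : E7) : inner ℝ (G.frame x u) (G.frame x v) = inner ℝ u v :=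
  (G.exists_frame x).choose_spec.1 u v

lemma form_frame (x : M) (u v w : E7) :
    G.form x ![G.frame x u, G.frame x v, G.frame x w] = stdG2Form u v w :=
  (G.exists_frame x).choose_spec.2 u v w

/-- The 4-form `⋆φ`, for the metric `g` and the orientation given by the `G₂`-frames. -/
def starForm (x : M) : TangentSpace (𝓡 7) x [⋀^Fin 4]→L[ℝ] ℝ :=
  (hodgeStar3 ((G.form x).compContinuousLinearMap (G.frame x : E7 →L[ℝ] TangentSpace (𝓡 7) x))
    ).compContinuousLinearMap ((G.frame x).symm : TangentSpace (𝓡 7) x →L[ℝ] E7)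

/-- The structure is torsion-free: `dφ = 0` and `d⋆φ = 0`. -/
def IsTorsionFree : Prop := IsClosedForm G.form ∧ IsClosedForm G.starForm

/-- The vector product, `u × v = ∑ᵢ φ(u, v, bᵢ) bᵢ` in an orthonormal basis `b`. -/
def cross (x : M) (u v : TangentSpace (𝓡 7) x) : TangentSpace (𝓡 7) x :=
  ∑ i, G.form x ![u, v, G.frame x (stdVec i)] • G.frame x (stdVec i)

/-- The defining property `⟨u × v, w⟩ = φ(u, v, w)` of the vector product. -/
lemma inner_cross (x : M) (u v w : TangentSpace (𝓡 7) x) :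
    inner ℝ (G.cross x u v) w = G.form x ![u, v, w] := by
  obtain ⟨w, rfl⟩ := (G.frame x).surjective w
  have h : ∀ w', (G.form x).toContinuousLinearMap ![u, v, 0] 2 w' = G.form x ![u, v, w'] := by
    intro w'
    rw [ContinuousAlternatingMap.toContinuousLinearMap_apply]
    congr 1
    ext i
    fin_cases i <;> simp
  have hw : w = ∑ i, w i • stdVec i := by
    ext j
    simp [stdVec, Pi.single_apply]
  rw [← h]
  conv_rhs => rw [hw]
  simp only [cross, sum_inner, real_inner_smul_left, inner_frame, map_sum, map_smul]
  refine Finset.sum_congr rfl fun i _ ↦ ?_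
  rw [h]
  simp [stdVec, EuclideanSpace.inner_single_left, mul_comm]

lemma norm_cross_sq (x : M) (u v : TangentSpace (𝓡 7) x) :
    inner ℝ (G.cross x u v) (G.cross x u v)
      = inner ℝ u u * inner ℝ v v - inner ℝ u v * inner ℝ u v := by
  obtain ⟨u, rfl⟩ := (G.frame x).surjective u
  obtain ⟨v, rfl⟩ := (G.frame x).surjective v
  rw [inner_cross]
  have h : ∀ w', (G.form x).toContinuousLinearMap ![G.frame x u, G.frame x v, 0] 2 w'
      = G.form x ![G.frame x u, G.frame x v, w'] := by
    intro w'
    rw [ContinuousAlternatingMap.toContinuousLinearMap_apply]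
    congr 1
    ext i
    fin_cases i <;> simp
  rw [← h, cross, map_sum]
  simp only [map_smul]
  simp only [h, form_frame, inner_frame]
  simp only [PiLp.inner_apply, Fin.sum_univ_seven, stdG2Form, dx3, stdVec, Matrix.det_fin_three]
  simp
  ring

end G2Structure

end Ambient

/-! ## Submanifolds

`Y` is a 3-manifold, possibly with boundary or corners, and `f : Y → M` an immersion. A vector
field along `f` is a family `s y ∈ T_{f y} M`. -/

section Submanifold

variable {M : Type*} [TopologicalSpace M] [ChartedSpace E7 M] [IsManifold (𝓡 7) ∞ M]
  [RiemannianBundle (fun x : M ↦ TangentSpace (𝓡 7) x)]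
  {H : Type*} [TopologicalSpace H] (I : ModelWithCorners ℝ E3 H)
  {Y : Type*} [TopologicalSpace Y] [ChartedSpace H Y] [IsManifold I ∞ Y]
  (f : Y → M)

/-- The covariant derivative `∇_v s` at `y` of a vector field `s` along `f`, for the Levi-Civita
connection of `M`: in coordinates, `ds(v) + Γ(df(v), s)`. -/
def covDeriv (s : (y : Y) → TangentSpace (𝓡 7) (f y)) (y : Y) (v : TangentSpace I y) :
    TangentSpace (𝓡 7) (f y) :=
  ofChart (f y) (f y)
    (mvfderiv I (fun y' ↦ toChart (f y) (f y') (s y')) y v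
      + christoffel (metricInChart (f y)) (extChartAt (𝓡 7) (f y) (f y))
          (toChart (f y) (f y) (mfderiv I (𝓡 7) f y v)) (toChart (f y) (f y) (s y)))

/-- The tangent space of the submanifold at `y`, as a subspace of `T_{f y} M`. -/
def tangentPlane (y : Y) : Submodule ℝ (TangentSpace (𝓡 7) (f y)) :=
  (mfderiv I (𝓡 7) f y).toLinearMap.range

instance (y : Y) : (tangentPlane I f y).HasOrthogonalProjection :=
  haveI : CompleteSpace (tangentPlane I f y) := FiniteDimensional.complete ℝ _
  inferInstance

/-- The normal space `ν_y` of the submanifold. -/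
def normalSpace (y : Y) : Submodule ℝ (TangentSpace (𝓡 7) (f y)) := (tangentPlane I f y)ᗮ

instance (y : Y) : (normalSpace I f y).HasOrthogonalProjection :=
  inferInstanceAs (tangentPlane I f y)ᗮ.HasOrthogonalProjection

/-- Smooth sections of the normal bundle `ν`. -/
structure IsNormalSection (s : (y : Y) → TangentSpace (𝓡 7) (f y)) : Prop where
  smooth : ContMDiff I (𝓡 7).tangent ∞ (fun y ↦ (⟨f y, s y⟩ : TangentBundle (𝓡 7) M))
  normal : ∀ y, s y ∈ normalSpace I f y

/-- The normal connection, `∇^⊥_v s = π_ν (∇_v s)`. -/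
def normalDeriv (s : (y : Y) → TangentSpace (𝓡 7) (f y)) (y : Y) (v : TangentSpace I y) :
    TangentSpace (𝓡 7) (f y) :=
  (normalSpace I f y).starProjection (covDeriv I f s y v)

/-- The second fundamental form as a shape operator, `A(s)(u) = -∇^⊤_u s` (as a vector of
`T_{f y} M` tangent to the submanifold) for a normal vector field `s`. -/
def shape (s : (y : Y) → TangentSpace (𝓡 7) (f y)) (y : Y) (u : TangentSpace I y) :
    TangentSpace (𝓡 7) (f y) :=
  -(tangentPlane I f y).starProjection (covDeriv I f s y u)

/-- A normal vector field, smooth near `y`, which extends a given normal vector `η` at `y`. -/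
def normalExtend (y : Y) (η : TangentSpace (𝓡 7) (f y)) (y' : Y) : TangentSpace (𝓡 7) (f y') :=
  (normalSpace I f y').starProjection (FiberBundle.extend E7 η (f y'))

/-- The immersed submanifold is associative: its tangent spaces are stable under `×`. -/
def IsAssociative (G : G2Structure M) : Prop :=
  ∀ (y : Y), ∀ u ∈ tangentPlane I f y, ∀ v ∈ tangentPlane I f y,
    G.cross (f y) u v ∈ tangentPlane I f y

/-- A choice, at each point, of an orthonormal basis `e₀, e₁, e₂` of the tangent space of `Y` with
`e₂ = e₀ × e₁` and of an orthonormal basis `η₀, …, η₃` of the normal space. The operators below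
only use the values of the frame at each point, so no regularity in `y` is required. -/
structure AdaptedFrame (G : G2Structure M) where
  e : (y : Y) → Fin 3 → TangentSpace I y
  orthonormal_e : ∀ y, Orthonormal ℝ fun i ↦ mfderiv I (𝓡 7) f y (e y i)
  cross_e : ∀ y, mfderiv I (𝓡 7) f y (e y 2)
    = G.cross (f y) (mfderiv I (𝓡 7) f y (e y 0)) (mfderiv I (𝓡 7) f y (e y 1))
  η : (y : Y) → Fin 4 → TangentSpace (𝓡 7) (f y)
  orthonormal_η : ∀ y, Orthonormal ℝ (η y)
  normal_η : ∀ y k, η y k ∈ normalSpace I f y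

namespace AdaptedFrame

variable {I f} {G : G2Structure M} (F : AdaptedFrame I f G)

/-- The vector `e_i` as a vector tangent to `M`. -/
def df (y : Y) (i : Fin 3) : TangentSpace (𝓡 7) (f y) := mfderiv I (𝓡 7) f y (F.e y i)

/-- The deformation operator
`D s = ∑ᵢ eᵢ × ∇^⊥_{eᵢ} s + ∑ₖ (∇_s ⋆φ)(ηₖ, e₀, e₁, e₂) ηₖ`. -/
def D (s : (y : Y) → TangentSpace (𝓡 7) (f y)) (y : Y) : TangentSpace (𝓡 7) (f y) :=
  ∑ i, G.cross (f y) (F.df y i) (normalDeriv I f s y (F.e y i))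
    + ∑ k, covDerivForm G.starForm (f y) (s y) ![F.η y k, F.df y 0, F.df y 1, F.df y 2] • F.η y k

/-- The connection of `TY`: `∇^⊤_v W ∈ T_y Y` corresponds to the tangential part of the covariant
derivative of `W` in `M`. -/
def tangentDeriv (W : (y : Y) → TangentSpace I y) (y : Y) (v : TangentSpace I y) :
    TangentSpace I y :=
  ∑ i, inner ℝ (covDeriv I f (fun y' ↦ mfderiv I (𝓡 7) f y' (W y')) y v) (F.df y i) • F.e y i

/-- The invariant second derivative `∇^{⊥2}_{v,w} s = ∇^⊥_v ∇^⊥_W s - ∇^⊥_{∇^⊤_v W} s` at `y`, where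
`W` is a local vector field on `Y` which extends the vector `w`. -/
def secondDeriv (s : (y : Y) → TangentSpace (𝓡 7) (f y)) (y : Y) (v w : TangentSpace I y) :
    TangentSpace (𝓡 7) (f y) :=
  let W : (y' : Y) → TangentSpace I y' := FiberBundle.extend E3 w
  normalDeriv I f (fun y' ↦ normalDeriv I f s y' (W y')) y v
    - normalDeriv I f s y (F.tangentDeriv W y v)

/-- The connection Laplacian `∇^{⊥*}∇^⊥ s = -∑ᵢ ∇^{⊥2}_{eᵢ,eᵢ} s`. -/
def laplacian (s : (y : Y) → TangentSpace (𝓡 7) (f y)) (y : Y) : TangentSpace (𝓡 7) (f y) :=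
  -∑ i, F.secondDeriv s y (F.e y i) (F.e y i)

/-- The partial Ricci operator `ℛ s = π_ν ∑ᵢ R(eᵢ, s) eᵢ`. -/
def partialRicci (s : (y : Y) → TangentSpace (𝓡 7) (f y)) (y : Y) : TangentSpace (𝓡 7) (f y) :=
  (normalSpace I f y).starProjection (∑ i, curvature (f y) (F.df y i) (s y) (F.df y i))

/-- The transpose `Aᵗ B = ∑ₖ ⟨B, A(ηₖ)⟩ ηₖ` at `y` of the second fundamental form `A`, for the inner
product `⟨B, C⟩ = ∑ᵢ ⟨B eᵢ, C eᵢ⟩` of endomorphisms. -/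
def shapeTranspose (y : Y) (B : TangentSpace I y → TangentSpace (𝓡 7) (f y)) :
    TangentSpace (𝓡 7) (f y) :=
  ∑ k, (∑ i, inner ℝ (B (F.e y i)) (shape I f (normalExtend I f y (F.η y k)) y (F.e y i))) • F.η y k

/-- Simons' operator `𝒜 s = Aᵗ (A s)`. -/
def simons (s : (y : Y) → TangentSpace (𝓡 7) (f y)) (y : Y) : TangentSpace (𝓡 7) (f y) :=
  F.shapeTranspose y (shape I f s y)

/-- Adapted frames exist, so that the operators above are available on every immersed associative
submanifold. -/
theorem nonempty (himm : ∀ y, Function.Injective (mfderiv I (𝓡 7) f y))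
    (hassoc : IsAssociative I f G) : Nonempty (AdaptedFrame I f G) := by
  have key : ∀ y : Y, ∃ e : Fin 3 → TangentSpace I y,
      Orthonormal ℝ (fun i ↦ mfderiv I (𝓡 7) f y (e i)) ∧ mfderiv I (𝓡 7) f y (e 2)
        = G.cross (f y) (mfderiv I (𝓡 7) f y (e 0)) (mfderiv I (𝓡 7) f y (e 1)) := by
    intro y
    have hdim : Module.finrank ℝ (tangentPlane I f y) = 3 := by
      rw [tangentPlane, LinearMap.finrank_range_of_inj (himm y)]
      exact finrank_euclideanSpace_fin
    let b := (stdOrthonormalBasis ℝ (tangentPlane I f y)).reindex (finCongr hdim)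
    have hb : ∀ i j, inner ℝ (b i : TangentSpace (𝓡 7) (f y)) (b j) = if i = j then (1 : ℝ) else 0 :=
      fun i j ↦ orthonormal_iff_ite.1 b.orthonormal i j
    obtain ⟨e0, h0⟩ := (b 0).2
    obtain ⟨e1, h1⟩ := (b 1).2
    obtain ⟨e2, h2⟩ := hassoc y _ (b 0).2 _ (b 1).2
    refine ⟨![e0, e1, e2], ?_, ?_⟩
    · have h0' : mfderiv I (𝓡 7) f y e0 = b 0 := h0
      have h1' : mfderiv I (𝓡 7) f y e1 = b 1 := h1
      have h2' : mfderiv I (𝓡 7) f y e2 = G.cross (f y) (b 0) (b 1) := h2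
      have hc0 : inner ℝ (G.cross (f y) (b 0) (b 1)) (b 0 : TangentSpace (𝓡 7) (f y)) = 0 := by
        rw [G.inner_cross]
        exact (G.form (f y)).map_eq_zero_of_eq _ (i := 0) (j := 2) rfl (by decide)
      have hc1 : inner ℝ (G.cross (f y) (b 0) (b 1)) (b 1 : TangentSpace (𝓡 7) (f y)) = 0 := by
        rw [G.inner_cross]
        exact (G.form (f y)).map_eq_zero_of_eq _ (i := 1) (j := 2) rfl (by decide)
      have hc2 := G.norm_cross_sq (f y) (b 0) (b 1)
      rw [hb, hb, hb] at hc2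
      rw [orthonormal_iff_ite]
      intro i j
      fin_cases i <;> fin_cases j <;>
        simp [h0', h1', h2', hb, hc0, hc1, -inner_self_eq_norm_sq_to_K] <;>
        first
        | (rw [real_inner_comm]; assumption)
        | simpa using hc2
    · have h0' : mfderiv I (𝓡 7) f y e0 = b 0 := h0
      have h1' : mfderiv I (𝓡 7) f y e1 = b 1 := h1
      have h2' : mfderiv I (𝓡 7) f y e2 = G.cross (f y) (b 0) (b 1) := h2
      simp [h0', h1', h2']
  have key' : ∀ y : Y, ∃ η : Fin 4 → TangentSpace (𝓡 7) (f y),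
      Orthonormal ℝ η ∧ ∀ k, η k ∈ normalSpace I f y := by
    intro y
    have hdim : Module.finrank ℝ (tangentPlane I f y) = 3 := by
      rw [tangentPlane, LinearMap.finrank_range_of_inj (himm y)]
      exact finrank_euclideanSpace_fin
    have h7 : Module.finrank ℝ (TangentSpace (𝓡 7) (f y)) = 7 := finrank_euclideanSpace_fin
    have hdim' : Module.finrank ℝ (normalSpace I f y) = 4 := by
      have := (tangentPlane I f y).finrank_add_finrank_orthogonal
      rw [normalSpace]
      omega
    let b := (stdOrthonormalBasis ℝ (normalSpace I f y)).reindex (finCongr hdim')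
    exact ⟨fun k ↦ b k, b.orthonormal.comp_linearIsometry (normalSpace I f y).subtypeₗᵢ,
      fun k ↦ (b k).2⟩
  choose e he he' using key
  choose η hη hη' using key'
  exact ⟨⟨e, he, he', η, hη, hη'⟩⟩

end AdaptedFrame

end Submanifold

end AssocGeom

end

/-!
The formula is a Weitzenböck formula, and what makes it work is that the vector product of a
torsion-free structure is parallel. This is the theorem of Fernández and Gray
(`covDerivProduct_eq_zero`). By the norm identity of the product, `⟨(∇_x C)(u, v), w⟩` has only `49`
independent components in a `G₂`-frame; since the Levi-Civita connection is torsion-free, `dφ = 0`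
and `d⋆φ = 0` are linear equations for these components, and they have full rank
(`IsStdFrame.eq_zero`). The second one requires `⋆φ` in terms of the product (`hodgeStar3_eq`,
`G2Structure.starForm_apply`). It follows that `∇⋆φ = 0`, so that the zeroth order term of `D`
vanishes and `D s = ∑ᵢ eᵢ × ∇^⊥_{eᵢ} s`.

The square of `D` at a point is then computed in coordinates
(`IsAssociativePatch.sum_cross_normalProj_alongDeriv_coordDirac`). On normal vectors the maps
`eᵢ ×` satisfy the Clifford relations `eᵢ × (eᵢ × s) = -s` and
`eᵢ × (eⱼ × s) = -(eᵢ × eⱼ) × s` for `i ≠ j`. The second derivatives of `s` therefore split into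
their trace, which gives the Laplacian, and their commutators, which are given by the equation of
Ricci: the normal part of the ambient curvature, and a term quadratic in the second fundamental
form (`IsAssociativePatch.normal_commutator`). Two facts finish the computation.

* The curvature acts on a parallel product by derivations. Together with the first Bianchi identity,
  this turns the sum of the terms `(eᵢ × eⱼ) × R(eᵢ, eⱼ)s` into `ℛ s`, up to sign
  (`IsParallelProduct.sum_coordCurvature`).
* The normal part of `∇(eᵢ × eⱼ)` shows that the second fundamental form is compatible with the
  product (`IsAssociativePatch.normalProj_alongDeriv_cross`), and it is symmetric. This turns the
  quadratic terms into `-𝒜 s`.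

The operators `∇`, `∇^⊥`, `D` are defined in the preferred chart at each point, whereas iterating
them requires derivatives in one chart near a point. So covariant derivatives are first compared
between charts (`IsCoordChange.christoffelL`, `toChart_covDeriv`). The frames in the definition of
`D` need not be smooth or even continuous; in a fixed chart `D` is expressed by the inverse of the
Gram matrix of the coordinate vector fields (`AdaptedFrame.toChart_D`), which also shows that `D s`
is smooth. Derivatives on `Y` are taken within the domain of a chart, in the sense of
`fderivWithin`, which covers boundary points.
-/

noncomputable section

set_option maxSynthPendingDepth 3

namespace AssocGeom

/-! ### Levi-Civita connection and curvature in coordinates -/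

section LocalGeometry

variable {E : Type*} [NormedAddCommGroup E] [NormedSpace ℝ E]

/-- A smooth Riemannian metric on an open subset `Ω` of `E`, as a function with values in bilinear
forms. -/
structure IsLocalMetric (g : E → E →L[ℝ] E →L[ℝ] ℝ) (Ω : Set E) : Prop where
  isOpen : IsOpen Ω
  contDiffOn : ContDiffOn ℝ ∞ g Ω
  symm : ∀ z ∈ Ω, ∀ u v, g z u v = g z v u
  pos : ∀ z ∈ Ω, ∀ u, u ≠ 0 → 0 < g z u u

/-- The Christoffel symbol as a continuous bilinear map, which can be differentiated as a whole. -/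
def christoffelL (g : E → E →L[ℝ] E →L[ℝ] ℝ) (z : E) : E →L[ℝ] E →L[ℝ] E :=
  (ContinuousLinearMap.compL ℝ E (E →L[ℝ] ℝ) E (g z).inverse).comp
    ((1 / 2 : ℝ) • (fderiv ℝ g z + (fderiv ℝ g z).flip
      - ((ContinuousLinearMap.flipₗᵢ ℝ E E ℝ : (E →L[ℝ] E →L[ℝ] ℝ) ≃ₗᵢ[ℝ] (E →L[ℝ] E →L[ℝ] ℝ)) :
          (E →L[ℝ] E →L[ℝ] ℝ) →L[ℝ] (E →L[ℝ] E →L[ℝ] ℝ)).comp (fderiv ℝ g z).flip))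

lemma christoffelL_apply (g : E → E →L[ℝ] E →L[ℝ] ℝ) (z u v : E) :
    christoffelL g z u v = christoffel g z u v := by
  simp [christoffelL, christoffel]

/-- A smooth map `γ` into `Ω`, defined on a set `S` on which differential calculus is
well-behaved, such as a relatively open subset of a half-space: derivatives within `S` are unique,
and second derivatives within `S` are symmetric. -/
structure IsLocalMap {V : Type*} [NormedAddCommGroup V] [NormedSpace ℝ V] (γ : V → E) (S : Set V)
    (Ω : Set E) : Prop where
  uniqueDiffOn : UniqueDiffOn ℝ S
  subset_closure : S ⊆ closure (interior S)
  contDiffOn : ContDiffOn ℝ ∞ γ S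
  mapsTo : Set.MapsTo γ S Ω

/-- The covariant derivative in the constant direction `v` of a vector field `ξ` along `γ`, where
all derivatives are taken within `S`. -/
def alongDeriv {V : Type*} [NormedAddCommGroup V] [NormedSpace ℝ V]
    (g : E → E →L[ℝ] E →L[ℝ] ℝ) (S : Set V) (γ : V → E) (v : V) (ξ : V → E) (x : V) : E :=
  fderivWithin ℝ ξ S x v + christoffelL g (γ x) (fderivWithin ℝ γ S x v) (ξ x)

section Calculus

variable {V : Type*} [NormedAddCommGroup V] [NormedSpace ℝ V]
  {F G : Type*} [NormedAddCommGroup F] [NormedSpace ℝ F] [NormedAddCommGroup G] [NormedSpace ℝ G]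

/-- The product rule for a bilinear map which depends on a point of `γ`. -/
lemma fderivWithin_bilin {B : E → F →L[ℝ] F →L[ℝ] G} {γ : V → E} {ξ η : V → F} {S : Set V} {x : V}
    (hS : UniqueDiffWithinAt ℝ S x) (hB : DifferentiableAt ℝ B (γ x))
    (hγ : DifferentiableWithinAt ℝ γ S x) (hξ : DifferentiableWithinAt ℝ ξ S x)
    (hη : DifferentiableWithinAt ℝ η S x) (v : V) :
    fderivWithin ℝ (fun x ↦ B (γ x) (ξ x) (η x)) S x v
      = fderiv ℝ B (γ x) (fderivWithin ℝ γ S x v) (ξ x) (η x)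
        + B (γ x) (fderivWithin ℝ ξ S x v) (η x) + B (γ x) (ξ x) (fderivWithin ℝ η S x v) := by
  have h := (((hB.hasFDerivAt.comp_hasFDerivWithinAt x hγ.hasFDerivWithinAt).clm_apply
    hξ.hasFDerivWithinAt).clm_apply hη.hasFDerivWithinAt).fderivWithin hS
  have h' := congrArg (fun L ↦ L v) h
  simp only [Function.comp_apply] at h'
  refine Eq.trans ?_ (h'.trans ?_)
  · rfl
  · simp [add_comm, add_left_comm]

lemma fderivWithin_fderivWithin_apply {F' : V → F} {S : Set V} {x : V} (hS : UniqueDiffOn ℝ S)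
    (hF : ContDiffOn ℝ ∞ F' S) (hx : x ∈ S) (v w : V) :
    fderivWithin ℝ (fun x ↦ fderivWithin ℝ F' S x w) S x v
      = fderivWithin ℝ (fderivWithin ℝ F' S) S x v w := by
  rw [fderivWithin_clm_apply (hS x hx)
    (((hF.fderivWithin hS (m := ∞) (by simp)).differentiableOn (by simp)) x hx)
    (differentiableWithinAt_const w)]
  simp

lemma fderivWithin_fderivWithin_comm {F' : V → F} {S : Set V} {x : V} (hS : UniqueDiffOn ℝ S)
    (hcl : S ⊆ closure (interior S)) (hF : ContDiffOn ℝ ∞ F' S) (hx : x ∈ S) (v w : V) :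
    fderivWithin ℝ (fun x ↦ fderivWithin ℝ F' S x w) S x v
      = fderivWithin ℝ (fun x ↦ fderivWithin ℝ F' S x v) S x w := by
  rw [fderivWithin_fderivWithin_apply hS hF hx, fderivWithin_fderivWithin_apply hS hF hx]
  exact (hF x hx).isSymmSndFDerivWithinAt (by
    rw [minSmoothness_of_isRCLikeNormedField]
    exact WithTop.coe_le_coe.2 (le_top : (2 : ℕ∞) ≤ ⊤)) hS (hcl hx) hx v w

end Calculus

namespace IsLocalMetric

variable {g : E → E →L[ℝ] E →L[ℝ] ℝ} {Ω : Set E} (hg : IsLocalMetric g Ω) {z : E}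
include hg

lemma contDiffAt (hz : z ∈ Ω) : ContDiffAt ℝ ∞ g z :=
  hg.contDiffOn.contDiffAt (hg.isOpen.mem_nhds hz)

lemma differentiableAt (hz : z ∈ Ω) : DifferentiableAt ℝ g z :=
  (hg.contDiffAt hz).differentiableAt (by simp)

lemma ext (hz : z ∈ Ω) {u v : E} (h : ∀ w, g z u w = g z v w) : u = v := by
  by_contra hne
  have := hg.pos z hz (u - v) (sub_ne_zero.2 hne)
  simp [h] at this

lemma fderiv_symm (hz : z ∈ Ω) (w u v : E) : fderiv ℝ g z w u v = fderiv ℝ g z w v u := by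
  have h : ∀ a b : E, fderiv ℝ g z w a b = fderiv ℝ (fun z ↦ g z a b) z w := by
    intro a b
    have := fderiv_clm_apply ((hg.differentiableAt hz).clm_apply (differentiableAt_const a))
      (differentiableAt_const b)
    rw [this, fderiv_clm_apply (hg.differentiableAt hz) (differentiableAt_const a)]
    simp
  rw [h, h]
  congr 1
  refine Filter.EventuallyEq.fderiv_eq ?_
  filter_upwards [hg.isOpen.mem_nhds hz] with z hz using hg.symm z hz u v

variable [FiniteDimensional ℝ E]

/-- The musical isomorphism: `christoffel` is not a junk value on `Ω`. -/
lemma isInvertible (hz : z ∈ Ω) : (g z).IsInvertible := by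
  have hinj : Function.Injective (g z).toLinearMap := by
    intro u v huv
    exact hg.ext hz fun w ↦ congrArg (fun L : E →L[ℝ] ℝ ↦ L w) huv
  have hfr : Module.finrank ℝ E = Module.finrank ℝ (E →L[ℝ] ℝ) := by
    have h := (LinearMap.toContinuousLinearMap (𝕜 := ℝ) (E := E) (F' := ℝ)).finrank_eq
    rw [← h]
    exact (Subspace.dual_finrank_eq (K := ℝ) (V := E)).symm
  let e := (LinearEquiv.ofInjectiveOfFinrankEq (g z).toLinearMap hinj hfr).toContinuousLinearEquiv
  exact ⟨e, by ext; rfl⟩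

lemma apply_inverse (hz : z ∈ Ω) (α : E →L[ℝ] ℝ) : g z ((g z).inverse α) = α := by
  obtain ⟨e, he⟩ := hg.isInvertible hz
  rw [← he]
  simp

/-- The Koszul formula. -/
lemma apply_christoffel (hz : z ∈ Ω) (u v w : E) :
    g z (christoffelL g z u v) w
      = (1 / 2) * (fderiv ℝ g z u v w + fderiv ℝ g z v u w - fderiv ℝ g z w u v) := by
  rw [christoffelL_apply, christoffel, hg.apply_inverse hz]
  simp

lemma christoffel_symm (hz : z ∈ Ω) (u v : E) :
    christoffelL g z u v = christoffelL g z v u := by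
  refine hg.ext hz fun w ↦ ?_
  rw [hg.apply_christoffel hz, hg.apply_christoffel hz, hg.fderiv_symm hz w u v]
  ring

/-- The metric is parallel. -/
lemma fderiv_eq (hz : z ∈ Ω) (w u v : E) :
    fderiv ℝ g z w u v = g z (christoffelL g z w u) v + g z u (christoffelL g z w v) := by
  rw [hg.symm z hz u, hg.apply_christoffel hz, hg.apply_christoffel hz]
  linarith [hg.fderiv_symm hz w v u, hg.fderiv_symm hz u v w, hg.fderiv_symm hz v u w]

lemma contDiffOn_inverse : ContDiffOn ℝ ∞ (fun z ↦ (g z).inverse) Ω := fun z hz ↦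
  ((hg.isInvertible hz).contDiffAt_map_inverse.comp z (hg.contDiffAt hz)).contDiffWithinAt

set_option synthInstance.maxHeartbeats 100000 in
lemma contDiffOn_christoffelL : ContDiffOn ℝ ∞ (christoffelL g) Ω := by
  have hd : ContDiffOn ℝ ∞ (fderiv ℝ g) Ω :=
    hg.contDiffOn.fderiv_of_isOpen hg.isOpen (by simp)
  have hf : ContDiffOn ℝ ∞ (fun z ↦ (fderiv ℝ g z).flip) Ω :=
    (ContinuousLinearMap.flipₗᵢ ℝ E E (E →L[ℝ] ℝ)).contDiff.comp_contDiffOn hd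
  exact ((ContinuousLinearMap.compL ℝ E (E →L[ℝ] ℝ) E).contDiff.comp_contDiffOn
    hg.contDiffOn_inverse).clm_comp (((hd.add hf).sub (contDiffOn_const.clm_comp hf)).const_smul _)

lemma differentiableAt_christoffelL (hz : z ∈ Ω) : DifferentiableAt ℝ (christoffelL g) z :=
  (hg.contDiffOn_christoffelL.contDiffAt (hg.isOpen.mem_nhds hz)).differentiableAt (by simp)

lemma coordCurvature_eq (hz : z ∈ Ω) (u v w : E) :
    coordCurvature g z u v w = fderiv ℝ (christoffelL g) z u v w - fderiv ℝ (christoffelL g) z v u w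
      + christoffelL g z u (christoffelL g z v w) - christoffelL g z v (christoffelL g z u w) := by
  have h : ∀ a b c : E, fderiv ℝ (fun z' ↦ christoffel g z' b c) z a
      = fderiv ℝ (christoffelL g) z a b c := by
    intro a b c
    have hd := hg.differentiableAt_christoffelL hz
    have e : (fun z' ↦ christoffel g z' b c) = fun z' ↦ christoffelL g z' b c :=
      funext fun z' ↦ (christoffelL_apply g z' b c).symm
    rw [e, fderiv_clm_apply (hd.clm_apply (differentiableAt_const b)) (differentiableAt_const c),
      fderiv_clm_apply hd (differentiableAt_const b)]
    simp
  simp only [coordCurvature, h, christoffelL_apply]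

/-- The first Bianchi identity. -/
lemma coordCurvature_bianchi (hz : z ∈ Ω) (u v w : E) :
    coordCurvature g z u v w + coordCurvature g z v w u + coordCurvature g z w u v = 0 := by
  have h : ∀ a b c : E, fderiv ℝ (christoffelL g) z a b c = fderiv ℝ (christoffelL g) z a c b := by
    intro a b c
    have hd := hg.differentiableAt_christoffelL hz
    have h' : ∀ b c : E, fderiv ℝ (christoffelL g) z a b c
        = fderiv ℝ (fun z ↦ christoffelL g z b c) z a := by
      intro b c
      rw [fderiv_clm_apply (hd.clm_apply (differentiableAt_const b)) (differentiableAt_const c),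
        fderiv_clm_apply hd (differentiableAt_const b)]
      simp
    rw [h', h']
    congr 1
    refine Filter.EventuallyEq.fderiv_eq ?_
    filter_upwards [hg.isOpen.mem_nhds hz] with z hz using hg.christoffel_symm hz b c
  simp only [hg.coordCurvature_eq hz]
  rw [h u v w, h v w u, h w u v, hg.christoffel_symm hz v w, hg.christoffel_symm hz u w,
    hg.christoffel_symm hz v u]
  abel

end IsLocalMetric

section Along

variable [FiniteDimensional ℝ E] {V : Type*} [NormedAddCommGroup V] [NormedSpace ℝ V]
  {g : E → E →L[ℝ] E →L[ℝ] ℝ} {Ω : Set E} (hg : IsLocalMetric g Ω) {γ : V → E} {S : Set V}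
  (hγ : IsLocalMap γ S Ω) {ξ η : V → E} {x : V}

omit [FiniteDimensional ℝ E] in
lemma alongDeriv_congr (h : Set.EqOn ξ η S) (hx : x ∈ S) (v : V) :
    alongDeriv g S γ v ξ x = alongDeriv g S γ v η x := by
  rw [alongDeriv, alongDeriv, fderivWithin_congr h (h hx), h hx]

include hγ

omit [FiniteDimensional ℝ E] in
lemma IsLocalMap.contDiffOn_fderivWithin {F : Type*} [NormedAddCommGroup F] [NormedSpace ℝ F]
    {ζ : V → F} (hζ : ContDiffOn ℝ ∞ ζ S) (v : V) :
    ContDiffOn ℝ ∞ (fun x ↦ fderivWithin ℝ ζ S x v) S :=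
  (hζ.fderivWithin hγ.uniqueDiffOn (by simp)).clm_apply contDiffOn_const

omit [FiniteDimensional ℝ E] in
lemma IsLocalMap.alongDeriv_add (hξ : ContDiffOn ℝ ∞ ξ S) (hη : ContDiffOn ℝ ∞ η S) (hx : x ∈ S)
    (v : V) : alongDeriv g S γ v (fun x ↦ ξ x + η x) x
      = alongDeriv g S γ v ξ x + alongDeriv g S γ v η x := by
  simp only [alongDeriv]
  rw [fderivWithin_fun_add (hγ.uniqueDiffOn x hx) (hξ.differentiableOn (by simp) x hx)
    (hη.differentiableOn (by simp) x hx)]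
  simp only [_root_.add_apply, map_add]
  abel

omit [FiniteDimensional ℝ E] in
lemma IsLocalMap.alongDeriv_sub (hξ : ContDiffOn ℝ ∞ ξ S) (hη : ContDiffOn ℝ ∞ η S) (hx : x ∈ S)
    (v : V) : alongDeriv g S γ v (fun x ↦ ξ x - η x) x
      = alongDeriv g S γ v ξ x - alongDeriv g S γ v η x := by
  simp only [alongDeriv]
  rw [fderivWithin_fun_sub (hγ.uniqueDiffOn x hx) (hξ.differentiableOn (by simp) x hx)
    (hη.differentiableOn (by simp) x hx)]
  simp only [_root_.sub_apply, map_sub]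
  abel

omit [FiniteDimensional ℝ E] in
lemma IsLocalMap.alongDeriv_smul {c : V → ℝ} (hc : ContDiffOn ℝ ∞ c S) (hξ : ContDiffOn ℝ ∞ ξ S)
    (hx : x ∈ S) (v : V) : alongDeriv g S γ v (fun x ↦ c x • ξ x) x
      = fderivWithin ℝ c S x v • ξ x + c x • alongDeriv g S γ v ξ x := by
  simp only [alongDeriv]
  rw [fderivWithin_fun_smul (hγ.uniqueDiffOn x hx) (hc.differentiableOn (by simp) x hx)
    (hξ.differentiableOn (by simp) x hx)]
  simp only [_root_.add_apply, _root_.smul_apply, ContinuousLinearMap.smulRight_apply, map_smul,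
    smul_add]
  abel

omit [FiniteDimensional ℝ E] in
lemma IsLocalMap.alongDeriv_sum {ι : Type*} (s : Finset ι) {ζ : ι → V → E}
    (hζ : ∀ i ∈ s, ContDiffOn ℝ ∞ (ζ i) S) (hx : x ∈ S) (v : V) :
    alongDeriv g S γ v (fun x ↦ ∑ i ∈ s, ζ i x) x = ∑ i ∈ s, alongDeriv g S γ v (ζ i) x := by
  simp only [alongDeriv]
  rw [fderivWithin_fun_sum (hγ.uniqueDiffOn x hx)
    (fun i hi ↦ (hζ i hi).differentiableOn (by simp) x hx)]
  simp [Finset.sum_add_distrib]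

include hg

lemma IsLocalMetric.contDiffOn_alongDeriv (hξ : ContDiffOn ℝ ∞ ξ S) (v : V) :
    ContDiffOn ℝ ∞ (alongDeriv g S γ v ξ) S :=
  (hγ.contDiffOn_fderivWithin hξ v).add
    (((hg.contDiffOn_christoffelL.comp hγ.contDiffOn hγ.mapsTo).clm_apply
      (hγ.contDiffOn_fderivWithin hγ.contDiffOn v)).clm_apply hξ)

/-- The connection is compatible with the metric. -/
lemma IsLocalMetric.fderivWithin_metric (hξ : ContDiffOn ℝ ∞ ξ S) (hη : ContDiffOn ℝ ∞ η S)
    (hx : x ∈ S) (v : V) :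
    fderivWithin ℝ (fun x ↦ g (γ x) (ξ x) (η x)) S x v
      = g (γ x) (alongDeriv g S γ v ξ x) (η x) + g (γ x) (ξ x) (alongDeriv g S γ v η x) := by
  rw [fderivWithin_bilin (hγ.uniqueDiffOn x hx) (hg.differentiableAt (hγ.mapsTo hx))
    (hγ.contDiffOn.differentiableOn (by simp) x hx) (hξ.differentiableOn (by simp) x hx)
    (hη.differentiableOn (by simp) x hx), hg.fderiv_eq (hγ.mapsTo hx)]
  simp only [alongDeriv, map_add, _root_.add_apply]
  ring

/-- The connection is torsion-free. -/
lemma IsLocalMetric.alongDeriv_fderivWithin_comm (hx : x ∈ S) (v w : V) :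
    alongDeriv g S γ v (fun x ↦ fderivWithin ℝ γ S x w) x
      = alongDeriv g S γ w (fun x ↦ fderivWithin ℝ γ S x v) x := by
  rw [alongDeriv, alongDeriv, hg.christoffel_symm (hγ.mapsTo hx),
    fderivWithin_fderivWithin_comm hγ.uniqueDiffOn hγ.subset_closure hγ.contDiffOn hx]

/-- The commutator of covariant derivatives along `γ` is the curvature of the ambient metric. -/
lemma IsLocalMetric.alongDeriv_alongDeriv_sub (hξ : ContDiffOn ℝ ∞ ξ S) (hx : x ∈ S) (v w : V) :
    alongDeriv g S γ v (alongDeriv g S γ w ξ) x - alongDeriv g S γ w (alongDeriv g S γ v ξ) x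
      = coordCurvature g (γ x) (fderivWithin ℝ γ S x v) (fderivWithin ℝ γ S x w) (ξ x) := by
  have hd : ∀ v w, fderivWithin ℝ (alongDeriv g S γ w ξ) S x v
      = fderivWithin ℝ (fun x ↦ fderivWithin ℝ ξ S x w) S x v
        + (fderiv ℝ (christoffelL g) (γ x) (fderivWithin ℝ γ S x v) (fderivWithin ℝ γ S x w) (ξ x)
          + christoffelL g (γ x) (fderivWithin ℝ (fun x ↦ fderivWithin ℝ γ S x w) S x v) (ξ x)
          + christoffelL g (γ x) (fderivWithin ℝ γ S x w) (fderivWithin ℝ ξ S x v)) := by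
    intro v w
    have hS := hγ.uniqueDiffOn x hx
    have h1 := (hγ.contDiffOn_fderivWithin hξ w).differentiableOn (by simp) x hx
    have h2 := (hγ.contDiffOn_fderivWithin hγ.contDiffOn w).differentiableOn (by simp) x hx
    have h3 : DifferentiableWithinAt ℝ
        (fun x ↦ christoffelL g (γ x) (fderivWithin ℝ γ S x w) (ξ x)) S x :=
      (((hg.contDiffOn_christoffelL.comp hγ.contDiffOn hγ.mapsTo).clm_apply
        (hγ.contDiffOn_fderivWithin hγ.contDiffOn w)).clm_apply hξ).differentiableOn
          (by simp) x hx
    rw [← fderivWithin_bilin hS (hg.differentiableAt_christoffelL (hγ.mapsTo hx))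
      (hγ.contDiffOn.differentiableOn (by simp) x hx) h2 (hξ.differentiableOn (by simp) x hx),
      ← _root_.add_apply, ← fderivWithin_fun_add hS h1 h3]
    rfl
  have h : ∀ v w, alongDeriv g S γ v (alongDeriv g S γ w ξ) x
      = fderivWithin ℝ (alongDeriv g S γ w ξ) S x v
        + christoffelL g (γ x) (fderivWithin ℝ γ S x v) (alongDeriv g S γ w ξ x) :=
    fun v w ↦ rfl
  rw [h, h, hd, hd,
    fderivWithin_fderivWithin_comm hγ.uniqueDiffOn hγ.subset_closure hξ hx v w,
    fderivWithin_fderivWithin_comm hγ.uniqueDiffOn hγ.subset_closure hγ.contDiffOn hx v w,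
    hg.coordCurvature_eq (hγ.mapsTo hx)]
  simp only [alongDeriv, map_add]
  abel

end Along

/-! ### Parallel products -/

section Product

/-- A smooth family `C` of bilinear products on `E` which is parallel for the Levi-Civita
connection of `g`. -/
structure IsParallelProduct (g : E → E →L[ℝ] E →L[ℝ] ℝ) (C : E → E →L[ℝ] E →L[ℝ] E)
    (Ω : Set E) : Prop where
  contDiffOn : ContDiffOn ℝ ∞ C Ω
  parallel : ∀ z ∈ Ω, ∀ w u v, fderiv ℝ C z w u v + christoffelL g z w (C z u v)
    = C z (christoffelL g z w u) v + C z u (christoffelL g z w v)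

variable {V : Type*} [NormedAddCommGroup V] [NormedSpace ℝ V]
  {g : E → E →L[ℝ] E →L[ℝ] ℝ} {Ω : Set E} (hg : IsLocalMetric g Ω) {γ : V → E} {S : Set V}
  (hγ : IsLocalMap γ S Ω) {ξ η : V → E} {x : V} {C : E → E →L[ℝ] E →L[ℝ] E}
  (hC : IsParallelProduct g C Ω)

include hC hγ

lemma IsParallelProduct.contDiffOn_apply (hξ : ContDiffOn ℝ ∞ ξ S) (hη : ContDiffOn ℝ ∞ η S) :
    ContDiffOn ℝ ∞ (fun x ↦ C (γ x) (ξ x) (η x)) S :=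
  ((hC.contDiffOn.comp hγ.contDiffOn hγ.mapsTo).clm_apply hξ).clm_apply hη

include hg

/-- Covariant derivatives along `γ` are derivations of a parallel product. -/
lemma IsParallelProduct.alongDeriv_apply (hξ : ContDiffOn ℝ ∞ ξ S) (hη : ContDiffOn ℝ ∞ η S)
    (hx : x ∈ S) (v : V) :
    alongDeriv g S γ v (fun x ↦ C (γ x) (ξ x) (η x)) x
      = C (γ x) (alongDeriv g S γ v ξ x) (η x) + C (γ x) (ξ x) (alongDeriv g S γ v η x) := by
  have hd : DifferentiableAt ℝ C (γ x) :=
    (hC.contDiffOn.contDiffAt (hg.isOpen.mem_nhds (hγ.mapsTo hx))).differentiableAt (by simp)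
  simp only [alongDeriv]
  rw [fderivWithin_bilin (hγ.uniqueDiffOn x hx) hd
    (hγ.contDiffOn.differentiableOn (by simp) x hx) (hξ.differentiableOn (by simp) x hx)
    (hη.differentiableOn (by simp) x hx)]
  have h := hC.parallel (γ x) (hγ.mapsTo hx) (fderivWithin ℝ γ S x v) (ξ x) (η x)
  simp only [map_add, _root_.add_apply]
  rw [← sub_eq_zero] at h ⊢
  rw [← h]
  abel

end Product

/-- The curvature endomorphisms are derivations of a parallel product: compare the commutator of
two covariant derivatives of `C (a, b)` along the identity of `Ω` with those of `a` and `b`. -/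
lemma IsParallelProduct.coordCurvature_apply [FiniteDimensional ℝ E]
    {g : E → E →L[ℝ] E →L[ℝ] ℝ} {Ω : Set E} (hg : IsLocalMetric g Ω)
    {C : E → E →L[ℝ] E →L[ℝ] E} (hC : IsParallelProduct g C Ω) {z : E} (hz : z ∈ Ω)
    (u v a b : E) :
    coordCurvature g z u v (C z a b)
      = C z (coordCurvature g z u v a) b + C z a (coordCurvature g z u v b) := by
  have hid : IsLocalMap (id : E → E) Ω Ω :=
    ⟨hg.isOpen.uniqueDiffOn, by rw [hg.isOpen.interior_eq]; exact subset_closure,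
      contDiffOn_id, fun _ h ↦ h⟩
  have hf : ∀ w, fderivWithin ℝ (id : E → E) Ω z w = w := fun w ↦ by
    rw [fderivWithin_id (hid.uniqueDiffOn z hz)]; rfl
  have ha : ContDiffOn ℝ ∞ (fun _ : E ↦ a) Ω := contDiffOn_const
  have hb : ContDiffOn ℝ ∞ (fun _ : E ↦ b) Ω := contDiffOn_const
  have hR : ∀ {ξ : E → E}, ContDiffOn ℝ ∞ ξ Ω → coordCurvature g z u v (ξ z)
      = alongDeriv g Ω id u (alongDeriv g Ω id v ξ) z
        - alongDeriv g Ω id v (alongDeriv g Ω id u ξ) z := by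
    intro ξ hξ
    rw [hg.alongDeriv_alongDeriv_sub hid hξ hz, hf, hf, id]
  have h2 : ∀ u v : E, alongDeriv g Ω id u (alongDeriv g Ω id v fun x ↦ C (id x) a b) z
      = C z (alongDeriv g Ω id u (alongDeriv g Ω id v fun _ ↦ a) z) b
        + C z (alongDeriv g Ω id v (fun _ ↦ a) z) (alongDeriv g Ω id u (fun _ ↦ b) z)
        + (C z (alongDeriv g Ω id u (fun _ ↦ a) z) (alongDeriv g Ω id v (fun _ ↦ b) z)
          + C z a (alongDeriv g Ω id u (alongDeriv g Ω id v fun _ ↦ b) z)) := by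
    intro u v
    have hva := hg.contDiffOn_alongDeriv hid ha v
    have hvb := hg.contDiffOn_alongDeriv hid hb v
    rw [alongDeriv_congr (fun x hx ↦ hC.alongDeriv_apply hg hid ha hb hx v) hz,
      hid.alongDeriv_add (hC.contDiffOn_apply hid hva hb) (hC.contDiffOn_apply hid ha hvb) hz,
      hC.alongDeriv_apply hg hid hva hb hz, hC.alongDeriv_apply hg hid ha hvb hz]
    rfl
  have h3 := hR (hC.contDiffOn_apply hid ha hb)
  rw [h2, h2] at h3
  have h4 := hR ha
  have h5 := hR hb
  simp only [id] at h3
  rw [h3, h4, h5]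
  simp only [map_sub, _root_.sub_apply]
  abel

end LocalGeometry

/-! ### Algebra of cross products -/

section CrossProduct

variable {E : Type*} [NormedAddCommGroup E] [NormedSpace ℝ E]

/-- `C` is a vector cross product for the inner product `g`: the form `g (C u v) w` is alternating,
and `|C u v|² = |u|² |v|² - ⟨u, v⟩²`. -/
structure IsCrossProduct (g : E →L[ℝ] E →L[ℝ] ℝ) (C : E →L[ℝ] E →L[ℝ] E) : Prop where
  symm : ∀ u v, g u v = g v u
  pos : ∀ u, u ≠ 0 → 0 < g u u
  antisymm : ∀ u v, C u v = -C v u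
  cyclic : ∀ u v w, g (C u v) w = g (C v w) u
  norm_sq : ∀ u v, g (C u v) (C u v) = g u u * g v v - g u v * g u v

namespace IsCrossProduct

variable {g : E →L[ℝ] E →L[ℝ] ℝ} {C : E →L[ℝ] E →L[ℝ] E} (h : IsCrossProduct g C)
include h

lemma ext {u v : E} (huv : ∀ w, g u w = g v w) : u = v := by
  by_contra hne
  have := h.pos (u - v) (sub_ne_zero.2 hne)
  simp [huv] at this

lemma cross_self (u : E) : C u u = 0 := by
  refine h.ext fun w ↦ ?_
  have := congrArg (fun x ↦ g x w) (h.antisymm u u)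
  simp only [map_neg, _root_.neg_apply] at this
  simp only [map_zero, _root_.zero_apply]
  linarith

lemma cross_right (u v w : E) : g (C u v) w = -g v (C u w) := by
  rw [h.symm v, h.cyclic u w, h.antisymm w v, h.cyclic u v]
  simp

lemma inner_cross_right (u v : E) : g v (C u v) = 0 := by
  rw [h.symm, h.cyclic, h.cross_self]
  simp

/-- Polarization of the norm identity, together with `⟨u × v, w⟩ = -⟨v, u × w⟩`. -/
lemma cross_cross_self (u v : E) : C u (C u v) = g u v • u - g u u • v := by
  refine h.ext fun w ↦ ?_
  have h1 := h.norm_sq u (v + w)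
  have h2 := h.norm_sq u v
  have h3 := h.norm_sq u w
  simp only [map_add, _root_.add_apply] at h1
  rw [h.cross_right, h.symm]
  rw [h.symm (C u w) (C u v), h.symm w v] at h1
  simp only [map_sub, map_smul, _root_.sub_apply, _root_.smul_apply, smul_eq_mul]
  rw [h.symm (C u w)]
  linarith

lemma cross_cross_add (u v w : E) :
    C u (C v w) + C v (C u w) = g u w • v + g v w • u - (2 * g u v) • w := by
  have h1 := h.cross_cross_self (u + v) w
  have h2 := h.cross_cross_self u w
  have h3 := h.cross_cross_self v w
  simp only [map_add, _root_.add_apply] at h1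
  rw [h2, h3, h.symm v u] at h1
  rw [← sub_eq_zero] at h1 ⊢
  rw [← h1]
  module

/-- The product of pairwise orthogonal vectors is antiassociative. -/
lemma cross_cross_of_orthogonal {u v w : E} (huv : g u v = 0) (huw : g u w = 0)
    (hvw : g v w = 0) : C u (C v w) = -C (C u v) w := by
  have h1 := h.cross_cross_add u w v
  rw [huw, h.symm w v, hvw, huv] at h1
  rw [h.antisymm (C u v) w, h.antisymm v w, map_neg]
  simp only [zero_smul, add_zero, mul_zero, sub_zero] at h1
  rw [neg_neg, neg_eq_iff_add_eq_zero, h1]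

end IsCrossProduct

end CrossProduct

/-! ### The Hodge dual of the model form -/

section Hodge

/-- Contraction of an elementary 3-form with an alternating array. -/
lemma sum_dx3_mul (l m n : Fin 7) (F : Fin 7 → Fin 7 → Fin 7 → ℝ)
    (h12 : ∀ i j k, F j i k = -F i j k) (h23 : ∀ i j k, F i k j = -F i j k) :
    ∑ i, ∑ j, ∑ k, dx3 l m n (stdVec i) (stdVec j) (stdVec k) * F i j k = 6 * F l m n := by
  have key : ∀ a b c : Fin 7, ∑ i, ∑ j, ∑ k,
      stdVec i a * stdVec j b * stdVec k c * F i j k = F a b c := by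
    intro a b c
    simp [stdVec, Finset.sum_ite_eq]
  have h1 := key l m n
  have h2 := key l n m
  have h3 := key m l n
  have h4 := key m n l
  have h5 := key n l m
  have h6 := key n m l
  have e2 := h23 l m n
  have e3 := h12 l m n
  have e4 : F m n l = F l m n := by rw [h23 m l n, h12 l m n, neg_neg]
  have e5 : F n l m = F l m n := by rw [h12 l n m, h23 l m n, neg_neg]
  have e6 : F n m l = -F l m n := by rw [h12 m n l, e4]
  have : 6 * F l m n = F l m n - F l n m - F m l n + F m n l + F n l m - F n m l := by
    rw [e2, e3, e4, e5, e6]; ring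
  rw [this, ← h1, ← h2, ← h3, ← h4, ← h5, ← h6]
  simp only [← Finset.sum_sub_distrib, ← Finset.sum_add_distrib]
  refine Finset.sum_congr rfl fun i _ ↦ Finset.sum_congr rfl fun j _ ↦
    Finset.sum_congr rfl fun k _ ↦ ?_
  simp only [dx3, Matrix.det_fin_three, Matrix.of_apply, Matrix.cons_val', Matrix.cons_val_zero,
    Matrix.cons_val_one, Matrix.cons_val]
  ring

lemma stdVol_apply (v : Fin 7 → E7) : stdVol v = Matrix.det (Matrix.of fun i j ↦ v i j) := by
  rw [← Matrix.det_transpose]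
  change (EuclideanSpace.basisFun (Fin 7) ℝ).toBasis.det v = _
  rw [Module.Basis.det_apply]
  congr 1

lemma stdVol_012 (a b c d : E7) : stdVol ![stdVec 0, stdVec 1, stdVec 2, a, b, c, d]
    = Matrix.det !![a 3, a 4, a 5, a 6; b 3, b 4, b 5, b 6; c 3, c 4, c 5, c 6; d 3, d 4, d 5, d 6] := by
  rw [stdVol_apply]
  simp [Matrix.det_succ_row_zero, Fin.sum_univ_succ, stdVec, Fin.succAbove]

lemma stdVol_034 (a b c d : E7) : stdVol ![stdVec 0, stdVec 3, stdVec 4, a, b, c, d]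
    = Matrix.det !![a 1, a 2, a 5, a 6; b 1, b 2, b 5, b 6; c 1, c 2, c 5, c 6; d 1, d 2, d 5, d 6] := by
  rw [stdVol_apply]
  simp [Matrix.det_succ_row_zero, Fin.sum_univ_succ, stdVec, Fin.succAbove]

lemma stdVol_056 (a b c d : E7) : stdVol ![stdVec 0, stdVec 5, stdVec 6, a, b, c, d]
    = Matrix.det !![a 1, a 2, a 3, a 4; b 1, b 2, b 3, b 4; c 1, c 2, c 3, c 4; d 1, d 2, d 3, d 4] := by
  rw [stdVol_apply]
  simp [Matrix.det_succ_row_zero, Fin.sum_univ_succ, stdVec, Fin.succAbove]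
  ring

lemma stdVol_135 (a b c d : E7) : stdVol ![stdVec 1, stdVec 3, stdVec 5, a, b, c, d]
    = Matrix.det !![a 0, a 2, a 4, a 6; b 0, b 2, b 4, b 6; c 0, c 2, c 4, c 6; d 0, d 2, d 4, d 6] := by
  rw [stdVol_apply]
  simp [Matrix.det_succ_row_zero, Fin.sum_univ_succ, stdVec, Fin.succAbove]
  ring

lemma stdVol_146 (a b c d : E7) : stdVol ![stdVec 1, stdVec 4, stdVec 6, a, b, c, d]
    = Matrix.det !![a 0, a 2, a 3, a 5; b 0, b 2, b 3, b 5; c 0, c 2, c 3, c 5; d 0, d 2, d 3, d 5] := by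
  rw [stdVol_apply]
  simp [Matrix.det_succ_row_zero, Fin.sum_univ_succ, stdVec, Fin.succAbove]
  ring

lemma stdVol_236 (a b c d : E7) : stdVol ![stdVec 2, stdVec 3, stdVec 6, a, b, c, d]
    = Matrix.det !![a 0, a 1, a 4, a 5; b 0, b 1, b 4, b 5; c 0, c 1, c 4, c 5; d 0, d 1, d 4, d 5] := by
  rw [stdVol_apply]
  simp [Matrix.det_succ_row_zero, Fin.sum_univ_succ, stdVec, Fin.succAbove]
  ring

lemma stdVol_245 (a b c d : E7) : stdVol ![stdVec 2, stdVec 4, stdVec 5, a, b, c, d]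
    = Matrix.det !![a 0, a 1, a 3, a 6; b 0, b 1, b 3, b 6; c 0, c 1, c 3, c 6; d 0, d 1, d 3, d 6] := by
  rw [stdVol_apply]
  simp [Matrix.det_succ_row_zero, Fin.sum_univ_succ, stdVec, Fin.succAbove]
  ring

end Hodge

section Hodge

/-- The components of the vector product of `φ₀`. -/
lemma stdG2Form_stdVec (a b : E7) (m : Fin 7) : stdG2Form a b (stdVec m) =
    ![a 1 * b 2 - a 2 * b 1 + a 3 * b 4 - a 4 * b 3 + a 5 * b 6 - a 6 * b 5,
      a 2 * b 0 - a 0 * b 2 + a 3 * b 5 - a 5 * b 3 - a 4 * b 6 + a 6 * b 4,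
      a 0 * b 1 - a 1 * b 0 - a 3 * b 6 + a 6 * b 3 - a 4 * b 5 + a 5 * b 4,
      a 4 * b 0 - a 0 * b 4 + a 5 * b 1 - a 1 * b 5 - a 6 * b 2 + a 2 * b 6,
      a 0 * b 3 - a 3 * b 0 - a 6 * b 1 + a 1 * b 6 - a 5 * b 2 + a 2 * b 5,
      a 6 * b 0 - a 0 * b 6 + a 1 * b 3 - a 3 * b 1 - a 2 * b 4 + a 4 * b 2,
      a 0 * b 5 - a 5 * b 0 - a 1 * b 4 + a 4 * b 1 - a 2 * b 3 + a 3 * b 2] m := by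
  simp only [stdG2Form, dx3, Matrix.det_fin_three, stdVec]
  fin_cases m <;> simp <;> ring

lemma det_fin_four (a b c d e f g h i j k l m n o p : ℝ) :
    Matrix.det !![a, b, c, d; e, f, g, h; i, j, k, l; m, n, o, p]
      = a * (f * (k * p - l * o) - g * (j * p - l * n) + h * (j * o - k * n))
        - b * (e * (k * p - l * o) - g * (i * p - l * m) + h * (i * o - k * m))
        + c * (e * (j * p - l * n) - f * (i * p - l * m) + h * (i * n - j * m))
        - d * (e * (j * o - k * n) - f * (i * o - k * m) + g * (i * n - j * m)) := by
  simp [Matrix.det_succ_row_zero, Fin.sum_univ_succ, Fin.succAbove]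
  ring

/-- The Hodge dual of `φ₀` in terms of `φ₀` and the inner product: it is, up to sign, the form
`⟨a × (b × c), d⟩` corrected by the part which is not alternating. -/
lemma hodgeStar3_eq {α : E7 [⋀^Fin 3]→L[ℝ] ℝ} (hα : ∀ u v w, α ![u, v, w] = stdG2Form u v w)
    (a b c d : E7) :
    hodgeStar3 α ![a, b, c, d]
      = -(∑ m, stdG2Form b c (stdVec m) * stdG2Form a (stdVec m) d + inner ℝ a b * inner ℝ c d
          - inner ℝ a c * inner ℝ b d) := by
  have h0 : hodgeStar3 α ![a, b, c, d] = (1 / 6) * ∑ i, ∑ j, ∑ k,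
      stdG2Form (stdVec i) (stdVec j) (stdVec k)
        * stdVol ![stdVec i, stdVec j, stdVec k, a, b, c, d] := by
    simp [hodgeStar3, hα, ContinuousAlternatingMap.sum_apply]
  have h12 : ∀ i j k : Fin 7, stdVol ![stdVec j, stdVec i, stdVec k, a, b, c, d]
      = -stdVol ![stdVec i, stdVec j, stdVec k, a, b, c, d] := fun i j k ↦ by
    refine Eq.trans ?_ (stdVol.toAlternatingMap.map_swap
      ![stdVec i, stdVec j, stdVec k, a, b, c, d] (show (0 : Fin 7) ≠ 1 by decide))
    change stdVol _ = stdVol _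
    congr 1
    ext n : 1
    fin_cases n <;> rfl
  have h23 : ∀ i j k : Fin 7, stdVol ![stdVec i, stdVec k, stdVec j, a, b, c, d]
      = -stdVol ![stdVec i, stdVec j, stdVec k, a, b, c, d] := fun i j k ↦ by
    refine Eq.trans ?_ (stdVol.toAlternatingMap.map_swap
      ![stdVec i, stdVec j, stdVec k, a, b, c, d] (show (1 : Fin 7) ≠ 2 by decide))
    change stdVol _ = stdVol _
    congr 1
    ext n : 1
    fin_cases n <;> rfl
  have hs := fun l m n ↦ sum_dx3_mul l m n
    (fun i j k ↦ stdVol ![stdVec i, stdVec j, stdVec k, a, b, c, d]) h12 h23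
  have h1 : hodgeStar3 α ![a, b, c, d]
      = stdVol ![stdVec 0, stdVec 1, stdVec 2, a, b, c, d]
        + stdVol ![stdVec 0, stdVec 3, stdVec 4, a, b, c, d]
        + stdVol ![stdVec 0, stdVec 5, stdVec 6, a, b, c, d]
        + stdVol ![stdVec 1, stdVec 3, stdVec 5, a, b, c, d]
        - stdVol ![stdVec 1, stdVec 4, stdVec 6, a, b, c, d]
        - stdVol ![stdVec 2, stdVec 3, stdVec 6, a, b, c, d]
        - stdVol ![stdVec 2, stdVec 4, stdVec 5, a, b, c, d] := by
    rw [h0]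
    simp only [stdG2Form, add_mul, sub_mul, Finset.sum_add_distrib, Finset.sum_sub_distrib, hs]
    ring
  have hcross : ∀ m, stdG2Form b c (stdVec m) * stdG2Form a (stdVec m) d
      = stdG2Form b c (stdVec m) * -stdG2Form a d (stdVec m) := fun m ↦ by
    simp only [stdG2Form, dx3, Matrix.det_fin_three, Matrix.of_apply, Matrix.cons_val',
      Matrix.cons_val_zero, Matrix.cons_val_one, Matrix.cons_val]
    ring
  rw [h1, stdVol_012, stdVol_034, stdVol_056, stdVol_135, stdVol_146, stdVol_236, stdVol_245]
  simp only [hcross]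
  simp only [Fin.sum_univ_seven, stdG2Form_stdVec, det_fin_four, PiLp.inner_apply,
    Matrix.cons_val, RCLike.inner_apply, conj_trivial]
  ring

end Hodge

/-! ### Infinitesimal deformations of the model form -/

section FramesOfE7

/-- The multiplication table of the vector product of `φ₀` in the standard basis of `ℝ⁷`. -/
structure IsStdFrame {E : Type*} [AddCommGroup E] (C : E → E → E) (e : Fin 7 → E) : Prop where
  antisymm : ∀ i j, C (e i) (e j) = -C (e j) (e i)
  t01 : C (e 0) (e 1) = e 2
  t02 : C (e 0) (e 2) = -e 1
  t03 : C (e 0) (e 3) = e 4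
  t04 : C (e 0) (e 4) = -e 3
  t05 : C (e 0) (e 5) = e 6
  t06 : C (e 0) (e 6) = -e 5
  t12 : C (e 1) (e 2) = e 0
  t13 : C (e 1) (e 3) = e 5
  t14 : C (e 1) (e 4) = -e 6
  t15 : C (e 1) (e 5) = -e 3
  t16 : C (e 1) (e 6) = e 4
  t23 : C (e 2) (e 3) = -e 6
  t24 : C (e 2) (e 4) = -e 5
  t25 : C (e 2) (e 5) = e 4
  t26 : C (e 2) (e 6) = e 3
  t34 : C (e 3) (e 4) = e 0
  t35 : C (e 3) (e 5) = e 1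
  t36 : C (e 3) (e 6) = -e 2
  t45 : C (e 4) (e 5) = -e 2
  t46 : C (e 4) (e 6) = -e 1
  t56 : C (e 5) (e 6) = e 0

lemma forall_lt_lt_fin_seven {P : Fin 7 → Fin 7 → Fin 7 → Prop}
    (h : P 0 1 2 ∧ P 0 1 3 ∧ P 0 1 4 ∧ P 0 1 5 ∧ P 0 1 6 ∧ P 0 2 3 ∧ P 0 2 4 ∧ P 0 2 5 ∧ P 0 2 6 ∧
      P 0 3 4 ∧ P 0 3 5 ∧ P 0 3 6 ∧ P 0 4 5 ∧ P 0 4 6 ∧ P 0 5 6 ∧ P 1 2 3 ∧ P 1 2 4 ∧ P 1 2 5 ∧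
      P 1 2 6 ∧ P 1 3 4 ∧ P 1 3 5 ∧ P 1 3 6 ∧ P 1 4 5 ∧ P 1 4 6 ∧ P 1 5 6 ∧ P 2 3 4 ∧ P 2 3 5 ∧
      P 2 3 6 ∧ P 2 4 5 ∧ P 2 4 6 ∧ P 2 5 6 ∧ P 3 4 5 ∧ P 3 4 6 ∧ P 3 5 6 ∧ P 4 5 6) :
    ∀ i j k, i < j → j < k → P i j k := by
  intro i j k hij hjk
  fin_cases i <;> fin_cases j <;> first
    | exact absurd hij (by decide)
    | (fin_cases k <;> first
      | exact absurd hjk (by decide)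
      | simp only [Fin.zero_eta, Fin.mk_one, Fin.reduceFinMk, h])

/-- The algebra behind the theorem of Fernández and Gray. A family of 3-forms `β x`, depending on a
vector `x`, vanishes if it satisfies the linearization `ha` of the norm identity of a cross product,
and if the alternations `hb` and `hc`, which express `dφ = 0` and `d⋆φ = 0`, vanish. By `ha`, only
seven components of each `β x` are independent, and `hb` and `hc` are linear equations of full rank
`49` for these components. -/
lemma IsStdFrame.eq_zero {E : Type*} [AddCommGroup E] {C : E → E → E} {e : Fin 7 → E}
    (h : IsStdFrame C e) {β : E → E → E → E → ℝ}
    (h12 : ∀ x u v w, β x v u w = -β x u v w) (h23 : ∀ x u v w, β x u w v = -β x u v w)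
    (hn : ∀ x u v w, β x u v (-w) = -β x u v w)
    (ha : ∀ x u v w, β x u v (C u w) + β x u w (C u v) = 0)
    (hb : ∀ u v w t, β u v w t - β v u w t + β w u v t - β t u v w = 0)
    (hc : ∀ x u v w t,
      (β x u (C v w) t - β x v w (C u t)) - (β u x (C v w) t - β u v w (C x t))
      + (β v x (C u w) t - β v u w (C x t)) - (β w x (C u v) t - β w u v (C x t))
      + (β t x (C u v) w - β t u v (C x w)) = 0) (x i j k : Fin 7) :
    β (e x) (e i) (e j) (e k) = 0 := by
  -- the symmetries of `β x`
  have p213 : ∀ u v w x, β x v u w = -β x u v w := fun u v w x ↦ h12 x u v w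
  have p132 : ∀ u v w x, β x u w v = -β x u v w := fun u v w x ↦ h23 x u v w
  have p231 : ∀ u v w x, β x v w u = β x u v w := fun u v w x ↦ by rw [h23, h12, neg_neg]
  have p312 : ∀ u v w x, β x w u v = β x u v w := fun u v w x ↦ by rw [h12, h23, neg_neg]
  have p321 : ∀ u v w x, β x w v u = -β x u v w := fun u v w x ↦ by rw [h12, p231]
  have hn' : ∀ x u v w, β x u (-v) w = -β x u v w := fun x u v w ↦ by rw [h23, hn, h23, neg_neg]
  have z12 : ∀ x u v, β x u u v = 0 := fun x u v ↦ by linarith [h12 x u u v]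
  have z23 : ∀ x u v, β x v u u = 0 := fun x u v ↦ by linarith [h23 x v u u]
  have z13 : ∀ x u v, β x u v u = 0 := fun x u v ↦ by rw [h23, z12, neg_zero]
  have t01 := h.t01
  have t03 := h.t03
  have t04 := h.t04
  have t05 := h.t05
  have t06 := h.t06
  have t12 := h.t12
  have t13 := h.t13
  have t14 := h.t14
  have t15 := h.t15
  have t16 := h.t16
  have t23 := h.t23
  have t24 := h.t24
  have t25 := h.t25
  have t26 := h.t26
  have t34 := h.t34
  have t35 := h.t35
  have t45 := h.t45
  have t46 := h.t46
  have t10 : C (e 1) (e 0) = -e 2 := by rw [h.antisymm, h.t01]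
  have t30 : C (e 3) (e 0) = -e 4 := by rw [h.antisymm, h.t03]
  have t31 : C (e 3) (e 1) = -e 5 := by rw [h.antisymm, h.t13]
  have t32 : C (e 3) (e 2) = e 6 := by rw [h.antisymm, h.t23, neg_neg]
  have t40 : C (e 4) (e 0) = e 3 := by rw [h.antisymm, h.t04, neg_neg]
  have t50 : C (e 5) (e 0) = -e 6 := by rw [h.antisymm, h.t05]
  have t51 : C (e 5) (e 1) = e 3 := by rw [h.antisymm, h.t15, neg_neg]
  have t53 : C (e 5) (e 3) = -e 1 := by rw [h.antisymm, h.t35]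
  have t60 : C (e 6) (e 0) = e 5 := by rw [h.antisymm, h.t06, neg_neg]
  have t61 : C (e 6) (e 1) = -e 4 := by rw [h.antisymm, h.t16]
  have t62 : C (e 6) (e 2) = -e 3 := by rw [h.antisymm, h.t26]
  have t64 : C (e 6) (e 4) = e 1 := by rw [h.antisymm, h.t46, neg_neg]
  -- The consequences of `ha`: every component is zero or, up to sign, one of those with indices
  -- `013`, `014`, `015`, `016`, `035`, `036`, `136`.
  have f012 : ∀ x, β x (e 0) (e 1) (e 2) = 0 := fun x ↦ by
    have := ha x (e 0) (e 1) (e 1)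
    simp only [t01] at this
    linarith
  have f034 : ∀ x, β x (e 0) (e 3) (e 4) = 0 := fun x ↦ by
    have := ha x (e 0) (e 3) (e 3)
    simp only [t03] at this
    linarith
  have f056 : ∀ x, β x (e 0) (e 5) (e 6) = 0 := fun x ↦ by
    have := ha x (e 0) (e 5) (e 5)
    simp only [t05] at this
    linarith
  have f135 : ∀ x, β x (e 1) (e 3) (e 5) = 0 := fun x ↦ by
    have := ha x (e 1) (e 3) (e 3)
    simp only [t13] at this
    linarith
  have f146 : ∀ x, β x (e 1) (e 4) (e 6) = 0 := fun x ↦ by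
    have := ha x (e 1) (e 4) (e 4)
    simp only [hn, t14] at this
    linarith
  have f236 : ∀ x, β x (e 2) (e 3) (e 6) = 0 := fun x ↦ by
    have := ha x (e 2) (e 3) (e 3)
    simp only [hn, t23] at this
    linarith
  have f245 : ∀ x, β x (e 2) (e 4) (e 5) = 0 := fun x ↦ by
    have := ha x (e 2) (e 4) (e 4)
    simp only [hn, t24] at this
    linarith
  have f024 : ∀ x, β x (e 0) (e 2) (e 4) = -β x (e 0) (e 1) (e 3) := fun x ↦ by
    have := ha x (e 0) (e 1) (e 4)
    simp only [hn, t04, t01, p132 (e 0) (e 2) (e 4)] at this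
    linarith
  have f125 : ∀ x, β x (e 1) (e 2) (e 5) = -β x (e 0) (e 1) (e 3) := fun x ↦ by
    have := ha x (e 1) (e 0) (e 5)
    simp only [hn, t15, t10, p213 (e 0) (e 1) (e 3), p132 (e 1) (e 2) (e 5)] at this
    linarith
  have f345 : ∀ x, β x (e 3) (e 4) (e 5) = -β x (e 0) (e 1) (e 3) := fun x ↦ by
    have := ha x (e 3) (e 0) (e 5)
    simp only [hn, t35, t30, p312 (e 0) (e 1) (e 3), p132 (e 3) (e 4) (e 5)] at this
    linarith
  have f023 : ∀ x, β x (e 0) (e 2) (e 3) = β x (e 0) (e 1) (e 4) := fun x ↦ by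
    have := ha x (e 0) (e 1) (e 3)
    simp only [t03, t01, p132 (e 0) (e 2) (e 3)] at this
    linarith
  have f126 : ∀ x, β x (e 1) (e 2) (e 6) = β x (e 0) (e 1) (e 4) := fun x ↦ by
    have := ha x (e 1) (e 0) (e 6)
    simp only [hn, t16, t10, p213 (e 0) (e 1) (e 4), p132 (e 1) (e 2) (e 6)] at this
    linarith
  have f346 : ∀ x, β x (e 3) (e 4) (e 6) = β x (e 0) (e 1) (e 4) := fun x ↦ by
    have := ha x (e 4) (e 0) (e 6)
    simp only [hn, t46, t40, p312 (e 0) (e 1) (e 4), p231 (e 3) (e 4) (e 6)] at this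
    linarith
  have f026 : ∀ x, β x (e 0) (e 2) (e 6) = -β x (e 0) (e 1) (e 5) := fun x ↦ by
    have := ha x (e 0) (e 1) (e 6)
    simp only [hn, t06, t01, p132 (e 0) (e 2) (e 6)] at this
    linarith
  have f123 : ∀ x, β x (e 1) (e 2) (e 3) = β x (e 0) (e 1) (e 5) := fun x ↦ by
    have := ha x (e 1) (e 0) (e 3)
    simp only [hn, t13, t10, p213 (e 0) (e 1) (e 5), p132 (e 1) (e 2) (e 3)] at this
    linarith
  have f356 : ∀ x, β x (e 3) (e 5) (e 6) = β x (e 0) (e 1) (e 5) := fun x ↦ by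
    have := ha x (e 5) (e 0) (e 3)
    simp only [hn, t53, t50, p312 (e 0) (e 1) (e 5), p213 (e 3) (e 5) (e 6)] at this
    linarith
  have f025 : ∀ x, β x (e 0) (e 2) (e 5) = β x (e 0) (e 1) (e 6) := fun x ↦ by
    have := ha x (e 0) (e 1) (e 5)
    simp only [t05, t01, p132 (e 0) (e 2) (e 5)] at this
    linarith
  have f124 : ∀ x, β x (e 1) (e 2) (e 4) = -β x (e 0) (e 1) (e 6) := fun x ↦ by
    have := ha x (e 1) (e 0) (e 4)
    simp only [hn, t14, t10, p213 (e 0) (e 1) (e 6), p132 (e 1) (e 2) (e 4)] at this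
    linarith
  have f456 : ∀ x, β x (e 4) (e 5) (e 6) = -β x (e 0) (e 1) (e 6) := fun x ↦ by
    have := ha x (e 6) (e 0) (e 4)
    simp only [t64, t60, p312 (e 0) (e 1) (e 6), p312 (e 4) (e 5) (e 6)] at this
    linarith
  have f046 : ∀ x, β x (e 0) (e 4) (e 6) = -β x (e 0) (e 3) (e 5) := fun x ↦ by
    have := ha x (e 0) (e 3) (e 6)
    simp only [hn, t06, t03, p132 (e 0) (e 4) (e 6)] at this
    linarith
  have f134 : ∀ x, β x (e 1) (e 3) (e 4) = -β x (e 0) (e 3) (e 5) := fun x ↦ by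
    have := ha x (e 3) (e 0) (e 1)
    simp only [hn, t31, t30, p213 (e 0) (e 3) (e 5), p213 (e 1) (e 3) (e 4)] at this
    linarith
  have f156 : ∀ x, β x (e 1) (e 5) (e 6) = -β x (e 0) (e 3) (e 5) := fun x ↦ by
    have := ha x (e 5) (e 0) (e 1)
    simp only [hn, t51, t50, p312 (e 0) (e 3) (e 5), p213 (e 1) (e 5) (e 6)] at this
    linarith
  have f045 : ∀ x, β x (e 0) (e 4) (e 5) = β x (e 0) (e 3) (e 6) := fun x ↦ by
    have := ha x (e 0) (e 3) (e 5)
    simp only [t05, t03, p132 (e 0) (e 4) (e 5)] at this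
    linarith
  have f234 : ∀ x, β x (e 2) (e 3) (e 4) = β x (e 0) (e 3) (e 6) := fun x ↦ by
    have := ha x (e 3) (e 0) (e 2)
    simp only [hn, t32, t30, p213 (e 0) (e 3) (e 6), p213 (e 2) (e 3) (e 4)] at this
    linarith
  have f256 : ∀ x, β x (e 2) (e 5) (e 6) = β x (e 0) (e 3) (e 6) := fun x ↦ by
    have := ha x (e 6) (e 0) (e 2)
    simp only [hn, t62, t60, p312 (e 0) (e 3) (e 6), p312 (e 2) (e 5) (e 6)] at this
    linarith
  have f145 : ∀ x, β x (e 1) (e 4) (e 5) = β x (e 1) (e 3) (e 6) := fun x ↦ by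
    have := ha x (e 1) (e 3) (e 4)
    simp only [hn, t14, t13] at this
    linarith
  have f235 : ∀ x, β x (e 2) (e 3) (e 5) = β x (e 1) (e 3) (e 6) := fun x ↦ by
    have := ha x (e 3) (e 1) (e 2)
    simp only [hn, t32, t31, p213 (e 1) (e 3) (e 6), p213 (e 2) (e 3) (e 5)] at this
    linarith
  have f246 : ∀ x, β x (e 2) (e 4) (e 6) = -β x (e 1) (e 3) (e 6) := fun x ↦ by
    have := ha x (e 6) (e 1) (e 2)
    simp only [hn, t62, t61, p312 (e 1) (e 3) (e 6), p312 (e 2) (e 4) (e 6)] at this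
    linarith
  -- the equations `hb` on increasing quadruples of basis vectors
  have qb0123 := hb (e 0) (e 1) (e 2) (e 3)
  simp only [f123, f023, f012] at qb0123
  have qb0124 := hb (e 0) (e 1) (e 2) (e 4)
  simp only [f124, f024, f012] at qb0124
  have qb0125 := hb (e 0) (e 1) (e 2) (e 5)
  simp only [f125, f025, f012] at qb0125
  have qb0126 := hb (e 0) (e 1) (e 2) (e 6)
  simp only [f126, f026, f012] at qb0126
  have qb0134 := hb (e 0) (e 1) (e 3) (e 4)
  simp only [f134, f034] at qb0134
  have qb0135 := hb (e 0) (e 1) (e 3) (e 5)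
  simp only [f135] at qb0135
  have qb0136 := hb (e 0) (e 1) (e 3) (e 6)
  have qb0145 := hb (e 0) (e 1) (e 4) (e 5)
  simp only [f145, f045] at qb0145
  have qb0146 := hb (e 0) (e 1) (e 4) (e 6)
  simp only [f146, f046] at qb0146
  have qb0156 := hb (e 0) (e 1) (e 5) (e 6)
  simp only [f156, f056] at qb0156
  have qb0234 := hb (e 0) (e 2) (e 3) (e 4)
  simp only [f234, f034, f024, f023] at qb0234
  have qb0235 := hb (e 0) (e 2) (e 3) (e 5)
  simp only [f235, f025, f023] at qb0235
  have qb0236 := hb (e 0) (e 2) (e 3) (e 6)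
  simp only [f236, f026, f023] at qb0236
  have qb0245 := hb (e 0) (e 2) (e 4) (e 5)
  simp only [f245, f045, f025, f024] at qb0245
  have qb0246 := hb (e 0) (e 2) (e 4) (e 6)
  simp only [f246, f046, f026, f024] at qb0246
  have qb0256 := hb (e 0) (e 2) (e 5) (e 6)
  simp only [f256, f056, f026, f025] at qb0256
  have qb0345 := hb (e 0) (e 3) (e 4) (e 5)
  simp only [f345, f045, f034] at qb0345
  have qb0346 := hb (e 0) (e 3) (e 4) (e 6)
  simp only [f346, f046, f034] at qb0346
  have qb0356 := hb (e 0) (e 3) (e 5) (e 6)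
  simp only [f356, f056] at qb0356
  have qb0456 := hb (e 0) (e 4) (e 5) (e 6)
  simp only [f456, f056, f046, f045] at qb0456
  have qb1234 := hb (e 1) (e 2) (e 3) (e 4)
  simp only [f234, f134, f124, f123] at qb1234
  have qb1235 := hb (e 1) (e 2) (e 3) (e 5)
  simp only [f235, f135, f125, f123] at qb1235
  have qb1236 := hb (e 1) (e 2) (e 3) (e 6)
  simp only [f236, f126, f123] at qb1236
  have qb1245 := hb (e 1) (e 2) (e 4) (e 5)
  simp only [f245, f145, f125, f124] at qb1245
  have qb1246 := hb (e 1) (e 2) (e 4) (e 6)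
  simp only [f246, f146, f126, f124] at qb1246
  have qb1256 := hb (e 1) (e 2) (e 5) (e 6)
  simp only [f256, f156, f126, f125] at qb1256
  have qb1345 := hb (e 1) (e 3) (e 4) (e 5)
  simp only [f345, f145, f135, f134] at qb1345
  have qb1346 := hb (e 1) (e 3) (e 4) (e 6)
  simp only [f346, f146, f134] at qb1346
  have qb1356 := hb (e 1) (e 3) (e 5) (e 6)
  simp only [f356, f156, f135] at qb1356
  have qb1456 := hb (e 1) (e 4) (e 5) (e 6)
  simp only [f456, f156, f146, f145] at qb1456
  have qb2345 := hb (e 2) (e 3) (e 4) (e 5)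
  simp only [f345, f245, f235, f234] at qb2345
  have qb2346 := hb (e 2) (e 3) (e 4) (e 6)
  simp only [f346, f246, f236, f234] at qb2346
  have qb2356 := hb (e 2) (e 3) (e 5) (e 6)
  simp only [f356, f256, f236, f235] at qb2356
  have qb2456 := hb (e 2) (e 4) (e 5) (e 6)
  simp only [f456, f256, f246, f245] at qb2456
  have qb3456 := hb (e 3) (e 4) (e 5) (e 6)
  simp only [f456, f356, f346, f345] at qb3456
  -- as many equations `hc` as are needed for full rank
  have qc01234 := hc (e 0) (e 1) (e 2) (e 3) (e 4)
  simp only [hn, hn', z12, z23, t23, t14, t04, t13, t12, t03, p132 (e 1) (e 4) (e 6), p132 (e 0)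
      (e 4) (e 6), p132 (e 0) (e 4) (e 5)] at qc01234
  simp only [f146, f236, f046, f045, f123, f124] at qc01234
  have qc01235 := hc (e 0) (e 1) (e 2) (e 3) (e 5)
  simp only [hn, hn', z12, z23, t23, t15, t05, t13, t12, t03, p132 (e 1) (e 5) (e 6), p132 (e 0)
      (e 5) (e 6)] at qc01235
  simp only [f156, f056, f236, f126, f124] at qc01235
  have qc01236 := hc (e 0) (e 1) (e 2) (e 3) (e 6)
  simp only [hn, hn', z12, z23, t23, t16, t06, t13, t12, t03] at qc01236
  simp only [f234, f235, f056, f135, f125, f124] at qc01236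
  have qc01245 := hc (e 0) (e 1) (e 2) (e 4) (e 5)
  simp only [hn, hn', z12, z23, t24, t15, t05, t14, t12, t04, p132 (e 2) (e 3) (e 4), p132 (e 0)
      (e 5) (e 6)] at qc01245
  simp only [f234, f246, f056, f146, f126, f123] at qc01245
  have qc01246 := hc (e 0) (e 1) (e 2) (e 4) (e 6)
  simp only [hn, hn', z12, z23, t24, t16, t06, t14, t12, t04] at qc01246
  simp only [f156, f056, f245, f145, f125, f123] at qc01246
  have qc01256 := hc (e 0) (e 1) (e 2) (e 5) (e 6)
  simp only [hn, hn', z12, z23, t25, t16, t06, t15, t12, t05, p132 (e 2) (e 4) (e 5)] at qc01256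
  simp only [f146, f245, f046, f125, f126] at qc01256
  have qc01345 := hc (e 0) (e 1) (e 3) (e 4) (e 5)
  simp only [hn, hn', z12, z13, z23, t34, t15, t05, t14, t13, t04, p213 (e 0) (e 1) (e 5), p132 (e
      0) (e 5) (e 6), p132 (e 0) (e 4) (e 5)] at qc01345
  simp only [f346, f056, f146, f045] at qc01345
  have qc01346 := hc (e 0) (e 1) (e 3) (e 4) (e 6)
  simp only [hn, hn', z12, z23, t34, t16, t06, t14, t13, t04, p213 (e 0) (e 1) (e 6), p132 (e 0)
      (e 4) (e 5)] at qc01346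
  simp only [f345, f145, f056, f135, f045] at qc01346
  have qc01356 := hc (e 0) (e 1) (e 3) (e 5) (e 6)
  simp only [hn, hn', z12, z23, t35, t16, t06, t15, t13, t05, p132 (e 3) (e 4) (e 5)] at qc01356
  simp only [f345, f056, f135] at qc01356
  have qc01456 := hc (e 0) (e 1) (e 4) (e 5) (e 6)
  simp only [hn, hn', z13, z23, t45, t16, t06, t15, t14, t05, p132 (e 0) (e 5) (e 6)] at qc01456
  simp only [f126, f026, f145, f056, f146] at qc01456
  have qc02345 := hc (e 0) (e 2) (e 3) (e 4) (e 5)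
  simp only [hn, hn', z12, z23, t34, t25, t05, t24, t23, t04, p213 (e 0) (e 2) (e 5), p132 (e 0)
      (e 5) (e 6), p132 (e 0) (e 4) (e 6)] at qc02345
  simp only [f025, f346, f246, f056, f236, f046] at qc02345
  have qc02346 := hc (e 0) (e 2) (e 3) (e 4) (e 6)
  simp only [hn, hn', z12, z13, z23, t34, t26, t06, t24, t23, t04, p213 (e 0) (e 2) (e 6), p132 (e
      0) (e 4) (e 6)] at qc02346
  simp only [f026, f345, f056, f245, f235, f046] at qc02346
  have qc02356 := hc (e 0) (e 2) (e 3) (e 5) (e 6)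
  simp only [hn, hn', z13, z23, t35, t26, t06, t25, t23, t05, p213 (e 1) (e 2) (e 6), p132 (e 0)
      (e 5) (e 6)] at qc02356
  simp only [f126, f046, f235, f056, f236] at qc02356
  have qc02456 := hc (e 0) (e 2) (e 4) (e 5) (e 6)
  simp only [hn, hn', z12, z23, t45, t26, t06, t25, t24, t05, p231 (e 3) (e 4) (e 5)] at qc02456
  simp only [f345, f026, f046, f056, f245, f246] at qc02456
  -- the solution of the linear system
  have f013 : ∀ x, β (e x) (e 0) (e 1) (e 3) = 0 := by
    intro x
    fin_cases x
    · change β (e 0) (e 0) (e 1) (e 3) = 0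
      linarith only [qb0125, qb0345, qb1456, qb2356, qc01356, qc02456]
    · change β (e 1) (e 0) (e 1) (e 3) = 0
      linarith only [qb0124, qb0456, qb1345, qb2346, qc01346, qc02345]
    · change β (e 2) (e 0) (e 1) (e 3) = 0
      linarith only [qb0123, qb0356, qb1346, qb2345, qc01345, qc02346]
    · change β (e 3) (e 0) (e 1) (e 3) = 0
      linarith only [qb0234, qb0256, qb1235, qb1246, qc01236, qc01245]
    · change β (e 4) (e 0) (e 1) (e 3) = 0
      linarith only [qb0134, qb0156, qb1236, qb1245, qc01235, qc01246]
    · change β (e 5) (e 0) (e 1) (e 3) = 0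
      linarith only [qb0135, qb0146, qb0236, qb0245, qc01234, qc01256]
    · change β (e 6) (e 0) (e 1) (e 3) = 0
      linarith only [qb0136, qb0145, qb0235, qb0246, qb1234, qb1256, qb3456]
  have f014 : ∀ x, β (e x) (e 0) (e 1) (e 4) = 0 := by
    intro x
    fin_cases x
    · change β (e 0) (e 0) (e 1) (e 4) = 0
      linarith only [qb0126, qb0346, qb1356, qb2456, qc01456, qc02356]
    · change β (e 1) (e 0) (e 1) (e 4) = 0
      linarith only [qb0123, qb0356, qb1346, qb2345, qc01345, qc02346]
    · change β (e 2) (e 0) (e 1) (e 4) = 0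
      linarith only [qb0124, qb0456, qb1345, qb2346, qc01346, qc02345]
    · change β (e 3) (e 0) (e 1) (e 4) = 0
      linarith only [qb0134, qb0156, qb1236, qb1245, qc01235, qc01246]
    · change β (e 4) (e 0) (e 1) (e 4) = 0
      linarith only [qb0234, qb0256, qb1235, qb1246, qc01236, qc01245]
    · change β (e 5) (e 0) (e 1) (e 4) = 0
      linarith only [qb0136, qb0145, qb0235, qb0246, qb1234, qb1256, qb3456]
    · change β (e 6) (e 0) (e 1) (e 4) = 0
      linarith only [qb0135, qb0146, qb0236, qb0245, qc01234, qc01256]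
  have f015 : ∀ x, β (e x) (e 0) (e 1) (e 5) = 0 := by
    intro x
    fin_cases x
    · change β (e 0) (e 0) (e 1) (e 5) = 0
      linarith only [qb0123, qb0356, qb1346, qb2345, qc01345, qc02346]
    · change β (e 1) (e 0) (e 1) (e 5) = 0
      linarith only [qb0126, qb0346, qb1356, qb2456, qc01456, qc02356]
    · change β (e 2) (e 0) (e 1) (e 5) = 0
      linarith only [qb0125, qb0345, qb1456, qb2356, qc01356, qc02456]
    · change β (e 3) (e 0) (e 1) (e 5) = 0
      linarith only [qb0135, qb0146, qb0236, qb0245, qc01234, qc01256]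
    · change β (e 4) (e 0) (e 1) (e 5) = 0
      linarith only [qb0136, qb0145, qb0235, qb0246, qb1234, qb1256, qb3456]
    · change β (e 5) (e 0) (e 1) (e 5) = 0
      linarith only [qb0234, qb0256, qb1235, qb1246, qc01236, qc01245]
    · change β (e 6) (e 0) (e 1) (e 5) = 0
      linarith only [qb0134, qb0156, qb1236, qb1245, qc01235, qc01246]
  have f016 : ∀ x, β (e x) (e 0) (e 1) (e 6) = 0 := by
    intro x
    fin_cases x
    · change β (e 0) (e 0) (e 1) (e 6) = 0
      linarith only [qb0124, qb0456, qb1345, qb2346, qc01346, qc02345]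
    · change β (e 1) (e 0) (e 1) (e 6) = 0
      linarith only [qb0125, qb0345, qb1456, qb2356, qc01356, qc02456]
    · change β (e 2) (e 0) (e 1) (e 6) = 0
      linarith only [qb0126, qb0346, qb1356, qb2456, qc01456, qc02356]
    · change β (e 3) (e 0) (e 1) (e 6) = 0
      linarith only [qb0136, qb0145, qb0235, qb0246, qb1234, qb1256, qb3456]
    · change β (e 4) (e 0) (e 1) (e 6) = 0
      linarith only [qb0135, qb0146, qb0236, qb0245, qc01234, qc01256]
    · change β (e 5) (e 0) (e 1) (e 6) = 0
      linarith only [qb0134, qb0156, qb1236, qb1245, qc01235, qc01246]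
    · change β (e 6) (e 0) (e 1) (e 6) = 0
      linarith only [qb0234, qb0256, qb1235, qb1246, qc01236, qc01245]
  have f035 : ∀ x, β (e x) (e 0) (e 3) (e 5) = 0 := by
    intro x
    fin_cases x
    · change β (e 0) (e 0) (e 3) (e 5) = 0
      linarith only [qb0134, qb0156, qb1236, qb1245, qc01235, qc01246]
    · change β (e 1) (e 0) (e 3) (e 5) = 0
      linarith only [qb0135, qb0146, qb0236, qb0245, qc01234, qc01256]
    · change β (e 2) (e 0) (e 3) (e 5) = 0
      linarith only [qb0136, qb0145, qb0235, qb0246, qb1234, qb1256, qb3456]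
    · change β (e 3) (e 0) (e 3) (e 5) = 0
      linarith only [qb0126, qb0346, qb1356, qb2456, qc01456, qc02356]
    · change β (e 4) (e 0) (e 3) (e 5) = 0
      linarith only [qb0125, qb0345, qb1456, qb2356, qc01356, qc02456]
    · change β (e 5) (e 0) (e 3) (e 5) = 0
      linarith only [qb0124, qb0456, qb1345, qb2346, qc01346, qc02345]
    · change β (e 6) (e 0) (e 3) (e 5) = 0
      linarith only [qb0123, qb0356, qb1346, qb2345, qc01345, qc02346]
  have f036 : ∀ x, β (e x) (e 0) (e 3) (e 6) = 0 := by
    intro x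
    fin_cases x
    · change β (e 0) (e 0) (e 3) (e 6) = 0
      linarith only [qb0234, qb0256, qb1235, qb1246, qc01236, qc01245]
    · change β (e 1) (e 0) (e 3) (e 6) = 0
      linarith only [qb0136, qb0145, qb0235, qb0246, qb1234, qb1256, qb3456]
    · change β (e 2) (e 0) (e 3) (e 6) = 0
      linarith only [qb0135, qb0146, qb0236, qb0245, qc01234, qc01256]
    · change β (e 3) (e 0) (e 3) (e 6) = 0
      linarith only [qb0125, qb0345, qb1456, qb2356, qc01356, qc02456]
    · change β (e 4) (e 0) (e 3) (e 6) = 0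
      linarith only [qb0126, qb0346, qb1356, qb2456, qc01456, qc02356]
    · change β (e 5) (e 0) (e 3) (e 6) = 0
      linarith only [qb0123, qb0356, qb1346, qb2345, qc01345, qc02346]
    · change β (e 6) (e 0) (e 3) (e 6) = 0
      linarith only [qb0124, qb0456, qb1345, qb2346, qc01346, qc02345]
  have f136 : ∀ x, β (e x) (e 1) (e 3) (e 6) = 0 := by
    intro x
    fin_cases x
    · change β (e 0) (e 1) (e 3) (e 6) = 0
      linarith only [qb0136, qb0145, qb0235, qb0246, qb1234, qb1256, qb3456]
    · change β (e 1) (e 1) (e 3) (e 6) = 0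
      linarith only [qb0234, qb0256, qb1235, qb1246, qc01236, qc01245]
    · change β (e 2) (e 1) (e 3) (e 6) = 0
      linarith only [qb0134, qb0156, qb1236, qb1245, qc01235, qc01246]
    · change β (e 3) (e 1) (e 3) (e 6) = 0
      linarith only [qb0124, qb0456, qb1345, qb2346, qc01346, qc02345]
    · change β (e 4) (e 1) (e 3) (e 6) = 0
      linarith only [qb0123, qb0356, qb1346, qb2345, qc01345, qc02346]
    · change β (e 5) (e 1) (e 3) (e 6) = 0
      linarith only [qb0126, qb0346, qb1356, qb2456, qc01456, qc02356]
    · change β (e 6) (e 1) (e 3) (e 6) = 0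
      linarith only [qb0125, qb0345, qb1456, qb2356, qc01356, qc02456]
  have hlt : ∀ i j k : Fin 7, i < j → j < k → β (e x) (e i) (e j) (e k) = 0 := by
    refine forall_lt_lt_fin_seven ?_
    simp only [f012, f034, f056, f135, f146, f236, f245, f013, f024, f125, f345, f014, f023,
      f126, f346, f015, f026, f123, f356, f016, f025, f124, f456, f035, f046, f134, f156, f036,
      f045, f234, f256, f136, f145, f235, f246, neg_zero, and_self]
  rcases lt_trichotomy i j with hij | rfl | hij
  · rcases lt_trichotomy j k with hjk | rfl | hjk
    · exact hlt i j k hij hjk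
    · exact z23 _ _ _
    · rcases lt_trichotomy i k with hik | rfl | hik
      · rw [h23, hlt i k j hik hjk, neg_zero]
      · exact z13 _ _ _
      · rw [p231, hlt k i j hik hij]
  · exact z12 _ _ _
  · rcases lt_trichotomy i k with hik | rfl | hik
    · rw [h12, hlt j i k hij hik, neg_zero]
    · exact z13 _ _ _
    · rcases lt_trichotomy j k with hjk | rfl | hjk
      · rw [p312, hlt j k i hjk hik]
      · exact z23 _ _ _
      · rw [p321, hlt k j i hjk hij, neg_zero]

end FramesOfE7

/-! ### Preferred charts of the ambient manifold -/

section FormCLM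

variable (E : Type*) [NormedAddCommGroup E] [NormedSpace ℝ E]

/-- A 3-form as a continuous trilinear map, depending linearly on the form. -/
def formCLM : (E [⋀^Fin 3]→L[ℝ] ℝ) →L[ℝ] E →L[ℝ] E →L[ℝ] E →L[ℝ] ℝ :=
  let A1 : (E [⋀^Fin 1]→L[ℝ] ℝ) →L[ℝ] (E →L[ℝ] ℝ) :=
    ((ContinuousAlternatingMap.ofSubsingletonLIE (𝕜 := ℝ) (E := E) (F := ℝ)
      (0 : Fin 1)).symm.toContinuousLinearEquiv : (E [⋀^Fin 1]→L[ℝ] ℝ) →L[ℝ] (E →L[ℝ] ℝ))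
  let A2 : (E [⋀^Fin 2]→L[ℝ] ℝ) →L[ℝ] (E →L[ℝ] E →L[ℝ] ℝ) :=
    (ContinuousLinearMap.compL ℝ E (E [⋀^Fin 1]→L[ℝ] ℝ) (E →L[ℝ] ℝ) A1).comp
      ContinuousAlternatingMap.curryLeftLI.toContinuousLinearMap
  (ContinuousLinearMap.compL ℝ E (E [⋀^Fin 2]→L[ℝ] ℝ) (E →L[ℝ] E →L[ℝ] ℝ) A2).comp
    ContinuousAlternatingMap.curryLeftLI.toContinuousLinearMap

variable {E}

lemma formCLM_apply (α : E [⋀^Fin 3]→L[ℝ] ℝ) (u v w : E) : formCLM E α u v w = α ![u, v, w] := by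
  simp only [formCLM]
  change α _ = α _
  congr 1
  ext i : 1
  fin_cases i <;> rfl

end FormCLM

variable {M : Type*} [TopologicalSpace M] [ChartedSpace E7 M] [IsManifold (𝓡 7) ∞ M]

lemma toChart_ofChart {p x : M} (hx : x ∈ (extChartAt (𝓡 7) p).source) (u : E7) :
    toChart p x (ofChart p x u) = u := by
  rw [extChartAt_source] at hx
  exact (trivializationAt E7 (TangentSpace (𝓡 7) : M → Type _) p).continuousLinearMapAt_symmL
    (R := ℝ) hx u

lemma ofChart_toChart {p x : M} (hx : x ∈ (extChartAt (𝓡 7) p).source)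
    (u : TangentSpace (𝓡 7) x) : ofChart p x (toChart p x u) = u := by
  rw [extChartAt_source] at hx
  exact (trivializationAt E7 (TangentSpace (𝓡 7) : M → Type _) p).symmL_continuousLinearMapAt
    (R := ℝ) hx u

lemma toChart_eq_mfderiv {p x : M} (hx : x ∈ (extChartAt (𝓡 7) p).source) :
    toChart p x = mfderiv (𝓡 7) 𝓘(ℝ, E7) (extChartAt (𝓡 7) p) x := by
  rw [extChartAt_source] at hx
  exact TangentBundle.continuousLinearMapAt_trivializationAt hx

lemma toChart_injective {p x : M} (hx : x ∈ (extChartAt (𝓡 7) p).source) :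
    Function.Injective (toChart p x) :=
  Function.LeftInverse.injective (ofChart_toChart hx)

/-- The domain of `transition p q`, the expression in the chart at `p` of points given in the chart
at `q`. -/
def transitionDomain (p q : M) : Set E7 :=
  ((extChartAt (𝓡 7) q).symm ≫ extChartAt (𝓡 7) p).source

/-- The coordinate change from the preferred chart at `q` to the one at `p`. -/
def transition (p q : M) : E7 → E7 := extChartAt (𝓡 7) p ∘ (extChartAt (𝓡 7) q).symm

omit [IsManifold (𝓡 7) ∞ M] in
lemma mem_transitionDomain {p q : M} {z : E7} : z ∈ transitionDomain p q ↔
    z ∈ (extChartAt (𝓡 7) q).target ∧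
      (extChartAt (𝓡 7) q).symm z ∈ (extChartAt (𝓡 7) p).source := by
  simp only [transitionDomain, PartialEquiv.trans_source, PartialEquiv.symm_source,
    Set.mem_inter_iff, Set.mem_preimage]

omit [IsManifold (𝓡 7) ∞ M] in
lemma isOpen_transitionDomain (p q : M) : IsOpen (transitionDomain p q) := by
  have h := (continuousOn_extChartAt_symm (I := 𝓡 7) q).isOpen_inter_preimage
    (isOpen_extChartAt_target q) (isOpen_extChartAt_source (I := 𝓡 7) p)
  have he : transitionDomain p q = (extChartAt (𝓡 7) q).target ∩
      (extChartAt (𝓡 7) q).symm ⁻¹' (extChartAt (𝓡 7) p).source :=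
    Set.ext fun z ↦ mem_transitionDomain
  rwa [he]

lemma contDiffOn_transition (p q : M) : ContDiffOn ℝ ∞ (transition p q) (transitionDomain p q) :=
  contDiffOn_ext_coord_change p q

omit [IsManifold (𝓡 7) ∞ M] in
lemma mapsTo_transition (p q : M) :
    Set.MapsTo (transition p q) (transitionDomain p q) (extChartAt (𝓡 7) p).target := fun _ hz ↦
  (extChartAt (𝓡 7) p).map_source (mem_transitionDomain.1 hz).2

omit [IsManifold (𝓡 7) ∞ M] in
lemma extChartAt_mem_transitionDomain {p q x : M} (hp : x ∈ (extChartAt (𝓡 7) p).source)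
    (hq : x ∈ (extChartAt (𝓡 7) q).source) : extChartAt (𝓡 7) q x ∈ transitionDomain p q := by
  rw [mem_transitionDomain, (extChartAt (𝓡 7) q).left_inv hq]
  exact ⟨(extChartAt (𝓡 7) q).map_source hq, hp⟩

omit [IsManifold (𝓡 7) ∞ M] in
lemma transition_extChartAt {p q x : M} (hq : x ∈ (extChartAt (𝓡 7) q).source) :
    transition p q (extChartAt (𝓡 7) q x) = extChartAt (𝓡 7) p x := by
  rw [transition, Function.comp_apply, (extChartAt (𝓡 7) q).left_inv hq]

/-- Expressions of tangent vectors in two charts differ by the derivative of the coordinate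
change. -/
lemma toChart_eq_fderiv_transition {p q x : M} (hp : x ∈ (extChartAt (𝓡 7) p).source)
    (hq : x ∈ (extChartAt (𝓡 7) q).source) (u : TangentSpace (𝓡 7) x) :
    toChart p x u = fderiv ℝ (transition p q) (extChartAt (𝓡 7) q x) (toChart q x u) := by
  have h1 : (extChartAt (𝓡 7) p : M → E7)
      =ᶠ[nhds x] transition p q ∘ extChartAt (𝓡 7) q := by
    filter_upwards [(isOpen_extChartAt_source (I := 𝓡 7) q).mem_nhds hq] with y hy
    rw [Function.comp_apply, transition_extChartAt hy]
  have hd : DifferentiableAt ℝ (transition p q) (extChartAt (𝓡 7) q x) :=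
    ((contDiffOn_transition p q).contDiffAt ((isOpen_transitionDomain p q).mem_nhds
      (extChartAt_mem_transitionDomain hp hq))).differentiableAt (by simp)
  have hq' := hq
  rw [extChartAt_source] at hq'
  rw [toChart_eq_mfderiv hp, toChart_eq_mfderiv hq, h1.mfderiv_eq,
    mfderiv_comp x hd.mdifferentiableAt (mdifferentiableAt_extChartAt hq'), mfderiv_eq_fderiv]
  rfl

lemma toChart_ofChart_eq {p q x : M} (hp : x ∈ (extChartAt (𝓡 7) p).source)
    (hq : x ∈ (extChartAt (𝓡 7) q).source) (u : E7) :
    toChart p x (ofChart q x u) = fderiv ℝ (transition p q) (extChartAt (𝓡 7) q x) u := by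
  rw [toChart_eq_fderiv_transition hp hq, toChart_ofChart hq]

section Metric

variable [RiemannianBundle (fun x : M ↦ TangentSpace (𝓡 7) x)]

lemma metricInChart_apply' (p : M) (z u v : E7) : metricInChart p z u v
    = inner ℝ (ofChart p ((extChartAt (𝓡 7) p).symm z) u)
      (ofChart p ((extChartAt (𝓡 7) p).symm z) v) := rfl

lemma metricInChart_apply {p x : M} (hx : x ∈ (extChartAt (𝓡 7) p).source) (u v : E7) :
    metricInChart p (extChartAt (𝓡 7) p x) u v = inner ℝ (ofChart p x u) (ofChart p x v) := by
  rw [metricInChart_apply', (extChartAt (𝓡 7) p).left_inv hx]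

lemma metricInChart_toChart {p x : M} (hx : x ∈ (extChartAt (𝓡 7) p).source)
    (u v : TangentSpace (𝓡 7) x) :
    metricInChart p (extChartAt (𝓡 7) p x) (toChart p x u) (toChart p x v) = inner ℝ u v := by
  rw [metricInChart_apply hx, ofChart_toChart hx, ofChart_toChart hx]

lemma metricInChart_transition {p q : M} {z : E7} (hz : z ∈ transitionDomain p q) (u v : E7) :
    metricInChart q z u v = metricInChart p (transition p q z)
      (fderiv ℝ (transition p q) z u) (fderiv ℝ (transition p q) z v) := by
  obtain ⟨h1, h2⟩ := mem_transitionDomain.1 hz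
  set x := (extChartAt (𝓡 7) q).symm z with hx
  have hq : x ∈ (extChartAt (𝓡 7) q).source := (extChartAt (𝓡 7) q).map_target h1
  have hzx : extChartAt (𝓡 7) q x = z := (extChartAt (𝓡 7) q).right_inv h1
  rw [← hzx, metricInChart_apply hq, transition_extChartAt hq, ← toChart_ofChart_eq h2 hq,
    ← toChart_ofChart_eq h2 hq, metricInChart_toChart h2]

lemma isLocalMetric_metricInChart
    [IsContMDiffRiemannianBundle (𝓡 7) ∞ E7 (fun x : M ↦ TangentSpace (𝓡 7) x)] (p : M) :
    IsLocalMetric (metricInChart p) (extChartAt (𝓡 7) p).target where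
  isOpen := isOpen_extChartAt_target p
  contDiffOn := by
    rw [contDiffOn_clm_apply]
    intro u
    rw [contDiffOn_clm_apply]
    intro v
    have hs : ∀ u : E7, ContMDiffOn (𝓡 7) (𝓡 7).tangent ∞
        (fun x ↦ (⟨x, ofChart p x u⟩ : TangentBundle (𝓡 7) M)) (extChartAt (𝓡 7) p).source := by
      intro u
      rw [extChartAt_source]
      refine ((trivializationAt E7 (TangentSpace (𝓡 7) : M → Type _)
        p).contMDiffOn_section_iff (chartAt E7 p).open_source subset_rfl).2 ?_
      refine (contMDiffOn_const (c := u)).congr fun x hx ↦ ?_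
      have := toChart_ofChart (p := p) (x := x) (by rwa [extChartAt_source]) u
      rwa [Trivialization.continuousLinearMapAt_apply,
        Trivialization.coe_linearMapAt_of_mem _ hx] at this
    have h1 := (hs u).inner_bundle (hs v)
    have h2 := h1.comp (contMDiffOn_extChartAt_symm (I := 𝓡 7) (n := ∞) p)
      (fun z hz ↦ (extChartAt (𝓡 7) p).map_target hz)
    exact contMDiffOn_iff_contDiffOn.1 h2
  symm := fun z _ u v ↦ by
    rw [metricInChart_apply', metricInChart_apply', real_inner_comm]
  pos := fun z hz u hu ↦ by
    rw [metricInChart_apply', real_inner_self_eq_norm_sq]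
    have hx := (extChartAt (𝓡 7) p).map_target hz
    have : ofChart p ((extChartAt (𝓡 7) p).symm z) u ≠ 0 := fun h0 ↦ hu (by
      rw [← toChart_ofChart hx u, h0, map_zero])
    positivity

end Metric

/-! ### The covariant derivative of a cross product -/

section FernandezGray

variable {E : Type*} [NormedAddCommGroup E] [NormedSpace ℝ E]

namespace IsCrossProduct

variable {g : E →L[ℝ] E →L[ℝ] ℝ} {C : E →L[ℝ] E →L[ℝ] E} (h : IsCrossProduct g C)
include h

lemma inner_cross_cross (u v w : E) :
    g (C u v) (C u w) = g u u * g v w - g u v * g u w := by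
  rw [h.symm, h.cross_right, h.cross_cross_self]
  simp only [map_sub, map_smul, smul_eq_mul]
  rw [h.symm w u, h.symm w v]
  ring

/-- The complete polarization of the norm identity. -/
lemma inner_cross_cross_add (a b v w : E) :
    g (C a v) (C b w) + g (C b v) (C a w)
      = 2 * (g a b * g v w) - g a v * g b w - g b v * g a w := by
  have h1 := h.inner_cross_cross (a + b) v w
  have h2 := h.inner_cross_cross a v w
  have h3 := h.inner_cross_cross b v w
  simp only [map_add, _root_.add_apply] at h1
  rw [h.symm b a] at h1
  linarith

end IsCrossProduct

lemma eq_zero_of_basis {ι F : Type*} [AddCommGroup F] [Module ℝ F] (e : Module.Basis ι ℝ E)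
    {f : E → F} (hadd : ∀ x y, f (x + y) = f x + f y) (hsmul : ∀ (c : ℝ) x, f (c • x) = c • f x)
    (h : ∀ i, f (e i) = 0) (x : E) : f x = 0 := by
  have : IsLinearMap.mk' f ⟨hadd, hsmul⟩ = 0 := e.ext fun i ↦ by simpa using h i
  simpa using LinearMap.congr_fun this x

/-- The covariant derivative `(∇_x C)(u, v)` of a family of bilinear products. -/
def covDerivProduct (g : E → E →L[ℝ] E →L[ℝ] ℝ) (C : E → E →L[ℝ] E →L[ℝ] E) (z x u v : E) : E :=
  fderiv ℝ C z x u v + christoffelL g z x (C z u v) - C z (christoffelL g z x u) v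
    - C z u (christoffelL g z x v)

variable [FiniteDimensional ℝ E] {g : E → E →L[ℝ] E →L[ℝ] ℝ} {Ω : Set E}
  (hg : IsLocalMetric g Ω) {C : E → E →L[ℝ] E →L[ℝ] E} {z : E}

include hg

lemma IsLocalMetric.fderiv_apply (hz : z ∈ Ω) {ξ η : E → E} (hξ : DifferentiableAt ℝ ξ z)
    (hη : DifferentiableAt ℝ η z) (x : E) :
    fderiv ℝ (fun z ↦ g z (ξ z) (η z)) z x
      = g z (fderiv ℝ ξ z x + christoffelL g z x (ξ z)) (η z)
        + g z (ξ z) (fderiv ℝ η z x + christoffelL g z x (η z)) := by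
  have h := fderivWithin_bilin (B := g) (γ := id) (S := Set.univ) (ξ := ξ) (η := η)
    uniqueDiffWithinAt_univ (hg.differentiableAt hz) differentiableWithinAt_id
    hξ.differentiableWithinAt hη.differentiableWithinAt x
  simp only [fderivWithin_univ, id, fderiv_id] at h
  rw [h, ContinuousLinearMap.id_apply, hg.fderiv_eq hz]
  simp only [map_add, _root_.add_apply]
  ring

variable (hCd : ContDiffOn ℝ ∞ C Ω) (hC : ∀ z ∈ Ω, IsCrossProduct (g z) (C z))

include hCd

lemma differentiableAt_product (hz : z ∈ Ω) (u v : E) :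
    DifferentiableAt ℝ (fun z ↦ C z u v) z :=
  ((((hCd.contDiffAt (hg.isOpen.mem_nhds hz)).differentiableAt (by simp)).clm_apply
    (differentiableAt_const u)).clm_apply (differentiableAt_const v))

lemma fderiv_product_add (hz : z ∈ Ω) (x u v : E) :
    fderiv ℝ (fun z ↦ C z u v) z x + christoffelL g z x (C z u v)
      = covDerivProduct g C z x u v + C z (christoffelL g z x u) v
        + C z u (christoffelL g z x v) := by
  have hd := (hCd.contDiffAt (hg.isOpen.mem_nhds hz)).differentiableAt (by simp)
  rw [fderiv_clm_apply (hd.clm_apply (differentiableAt_const u)) (differentiableAt_const v),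
    fderiv_clm_apply hd (differentiableAt_const u)]
  simp only [covDerivProduct, fderiv_fun_const, Pi.zero_apply, ContinuousLinearMap.comp_zero,
    zero_add, ContinuousLinearMap.flip_apply]
  abel

lemma fderiv_inner_product (hz : z ∈ Ω) (x u v w : E) :
    fderiv ℝ (fun z ↦ g z (C z u v) w) z x
      = g z (covDerivProduct g C z x u v) w + g z (C z (christoffelL g z x u) v) w
        + g z (C z u (christoffelL g z x v)) w + g z (C z u v) (christoffelL g z x w) := by
  rw [hg.fderiv_apply hz (differentiableAt_product hg hCd hz u v) (differentiableAt_const w),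
    fderiv_product_add hg hCd hz]
  simp

lemma fderiv_inner_product_product (hz : z ∈ Ω) (x u v w t : E) :
    fderiv ℝ (fun z ↦ g z (C z u v) (C z w t)) z x
      = g z (covDerivProduct g C z x u v) (C z w t) + g z (C z (christoffelL g z x u) v) (C z w t)
        + g z (C z u (christoffelL g z x v)) (C z w t)
        + (g z (C z u v) (covDerivProduct g C z x w t)
          + g z (C z u v) (C z (christoffelL g z x w) t)
          + g z (C z u v) (C z w (christoffelL g z x t))) := by
  rw [hg.fderiv_apply hz (differentiableAt_product hg hCd hz u v)
    (differentiableAt_product hg hCd hz w t), fderiv_product_add hg hCd hz,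
    fderiv_product_add hg hCd hz]
  simp

omit hCd in
lemma differentiableAt_inner (hz : z ∈ Ω) (u v : E) : DifferentiableAt ℝ (fun z ↦ g z u v) z :=
  (((hg.differentiableAt hz).clm_apply
    (differentiableAt_const u)).clm_apply (differentiableAt_const v))

omit hCd in
lemma fderiv_inner_mul_inner (hz : z ∈ Ω) (x u v w t : E) :
    fderiv ℝ (fun z ↦ g z u v * g z w t) z x
      = (g z (christoffelL g z x u) v + g z u (christoffelL g z x v)) * g z w t
        + g z u v * (g z (christoffelL g z x w) t + g z w (christoffelL g z x t)) := by
  have h : ∀ u v, fderiv ℝ (fun z ↦ g z u v) z x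
      = g z (christoffelL g z x u) v + g z u (christoffelL g z x v) := by
    intro u v
    have := hg.fderiv_apply hz (differentiableAt_const u) (differentiableAt_const v) x
    simpa using this
  rw [fderiv_fun_mul (differentiableAt_inner hg hz u v) (differentiableAt_inner hg hz w t)]
  simp only [_root_.add_apply, _root_.smul_apply, smul_eq_mul, h]
  ring

include hC

lemma covDerivProduct_antisymm (hz : z ∈ Ω) (x u v : E) :
    covDerivProduct g C z x v u = -covDerivProduct g C z x u v := by
  have h1 := fderiv_product_add hg hCd hz x u v
  have h2 := fderiv_product_add hg hCd hz x v u
  have he : (fun z ↦ C z v u) =ᶠ[nhds z] fun z ↦ -C z u v := by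
    filter_upwards [hg.isOpen.mem_nhds hz] with z hz using (hC z hz).antisymm v u
  rw [he.fderiv_eq, fderiv_fun_neg, (hC z hz).antisymm v u,
    (hC z hz).antisymm _ u, (hC z hz).antisymm v] at h2
  simp only [map_neg, _root_.neg_apply] at h2
  linear_combination (norm := module) -h1 - h2

/-- The trilinear form `⟨(∇_x C)(u, v), w⟩` is alternating in `u, v, w`. -/
lemma inner_covDerivProduct_antisymm (hz : z ∈ Ω) (x u v w : E) :
    g z (covDerivProduct g C z x u w) v = -g z (covDerivProduct g C z x u v) w := by
  have h1 := fderiv_inner_product hg hCd hz x u v w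
  have h2 := fderiv_inner_product hg hCd hz x u w v
  have he : (fun z ↦ g z (C z u w) v) =ᶠ[nhds z] fun z ↦ -g z (C z u v) w := by
    filter_upwards [hg.isOpen.mem_nhds hz] with z hz
    rw [(hC z hz).cross_right, (hC z hz).symm]
  have h3 := fun a b c ↦ (hC z hz).cross_right a b c
  rw [he.fderiv_eq, fderiv_fun_neg, _root_.neg_apply, h1] at h2
  rw [h3 _ w v, h3 _ (christoffelL g z x w) v, h3 u w, hg.symm z hz w, hg.symm z hz w,
    hg.symm z hz (christoffelL g z x w)] at h2
  linarith

/-- The covariant derivative of the norm identity. -/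
lemma covDerivProduct_norm (hz : z ∈ Ω) (x u v w : E) :
    g z (covDerivProduct g C z x u v) (C z u w) + g z (covDerivProduct g C z x u w) (C z u v)
      = 0 := by
  have h1 := fderiv_inner_product_product hg hCd hz x u v u w
  have he : (fun z ↦ g z (C z u v) (C z u w))
      =ᶠ[nhds z] fun z ↦ g z u u * g z v w - g z u v * g z u w := by
    filter_upwards [hg.isOpen.mem_nhds hz] with z hz using (hC z hz).inner_cross_cross u v w
  have hd : ∀ a b c d, DifferentiableAt ℝ (fun z ↦ g z a b * g z c d) z := fun a b c d ↦
    (differentiableAt_inner hg hz a b).mul (differentiableAt_inner hg hz c d)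
  rw [he.fderiv_eq, fderiv_fun_sub (hd u u v w) (hd u v u w),
    _root_.sub_apply, fderiv_inner_mul_inner hg hz, fderiv_inner_mul_inner hg hz] at h1
  have h2 := (hC z hz).inner_cross_cross_add u (christoffelL g z x u) v w
  have h3 := (hC z hz).inner_cross_cross u (christoffelL g z x v) w
  have h4 := (hC z hz).inner_cross_cross u v (christoffelL g z x w)
  rw [hg.symm z hz (C z u v) (covDerivProduct g C z x u w)] at h1
  rw [hg.symm z hz (christoffelL g z x u) u] at h1
  linarith

end FernandezGray

/-! ### The theorem of Fernández and Gray -/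

section FernandezGray

variable {E : Type*} [NormedAddCommGroup E] [NormedSpace ℝ E] [FiniteDimensional ℝ E]
  {g : E → E →L[ℝ] E →L[ℝ] ℝ} {Ω : Set E}
  (hg : IsLocalMetric g Ω) {C : E → E →L[ℝ] E →L[ℝ] E} {z : E}
  (hCd : ContDiffOn ℝ ∞ C Ω) (hC : ∀ z ∈ Ω, IsCrossProduct (g z) (C z))

include hg hCd hC

/-- The exterior derivative of the 3-form `⟨C(u, v), w⟩` is the alternation of its covariant
derivative, since the connection is torsion-free. -/
lemma covDerivProduct_of_extDeriv_eq_zero {φ : E → E [⋀^Fin 3]→L[ℝ] ℝ} (hz : z ∈ Ω)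
    (hφ : DifferentiableAt ℝ φ z) (hφC : ∀ z ∈ Ω, ∀ u v w, φ z ![u, v, w] = g z (C z u v) w)
    (hd : extDeriv φ z = 0) (u v w t : E) :
    g z (covDerivProduct g C z u v w) t - g z (covDerivProduct g C z v u w) t
      + g z (covDerivProduct g C z w u v) t - g z (covDerivProduct g C z t u v) w = 0 := by
  have h0 : ∀ x u v w, fderiv ℝ (fun z ↦ φ z ![u, v, w]) z x
      = g z (covDerivProduct g C z x u v) w + g z (C z (christoffelL g z x u) v) w
        - g z (C z (christoffelL g z x v) u) w + g z (C z (christoffelL g z x w) u) v := by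
    intro x u v w
    have he : (fun z ↦ φ z ![u, v, w]) =ᶠ[nhds z] fun z ↦ g z (C z u v) w := by
      filter_upwards [hg.isOpen.mem_nhds hz] with z hz using hφC z hz u v w
    rw [he.fderiv_eq, fderiv_inner_product hg hCd hz, (hC z hz).antisymm u,
      ← (hC z hz).cyclic (christoffelL g z x w) u v]
    simp only [map_neg, _root_.neg_apply]
    ring
  have h1 := congrArg (fun α ↦ α ![u, v, w, t]) hd
  simp only [extDeriv_apply hφ] at h1
  rw [Fin.sum_univ_four] at h1
  have e0 : (0 : Fin 4).removeNth ![u, v, w, t] = ![v, w, t] := by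
    ext i : 1; fin_cases i <;> rfl
  have e1 : (1 : Fin 4).removeNth ![u, v, w, t] = ![u, w, t] := by
    ext i : 1; fin_cases i <;> rfl
  have e2 : (2 : Fin 4).removeNth ![u, v, w, t] = ![u, v, t] := by
    ext i : 1; fin_cases i <;> rfl
  have e3 : (3 : Fin 4).removeNth ![u, v, w, t] = ![u, v, w] := by
    ext i : 1; fin_cases i <;> rfl
  rw [e0, e1, e2, e3] at h1
  simp only [h0, Matrix.cons_val] at h1
  -- the terms with Christoffel symbols cancel in pairs
  rw [hg.christoffel_symm hz v u, hg.christoffel_symm hz w u, hg.christoffel_symm hz t u,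
    hg.christoffel_symm hz w v, hg.christoffel_symm hz t v, hg.christoffel_symm hz t w] at h1
  simp only [Fin.val_zero, Fin.val_one, Fin.val_two, show ((3 : Fin 4) : ℕ) = 3 from rfl] at h1
  norm_num at h1
  linarith

/-- The derivative of the 4-form of the product, in terms of `∇C`. -/
lemma fderiv_of_covDerivProduct {ψ : E → E [⋀^Fin 4]→L[ℝ] ℝ} (hz : z ∈ Ω)
    (hψC : ∀ z ∈ Ω, ∀ a b c d, ψ z ![a, b, c, d]
      = g z (C z b c) (C z a d) - g z a b * g z c d + g z a c * g z b d) (x a b c d : E) :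
    fderiv ℝ (fun z ↦ ψ z ![a, b, c, d]) z x
      = g z (covDerivProduct g C z x b c) (C z a d) + g z (covDerivProduct g C z x a d) (C z b c)
        + (ψ z ![christoffelL g z x a, b, c, d] + ψ z ![a, christoffelL g z x b, c, d]
        + ψ z ![a, b, christoffelL g z x c, d] + ψ z ![a, b, c, christoffelL g z x d]) := by
  have he : (fun z ↦ ψ z ![a, b, c, d]) =ᶠ[nhds z]
      fun z ↦ g z (C z b c) (C z a d) - g z a b * g z c d + g z a c * g z b d := by
    filter_upwards [hg.isOpen.mem_nhds hz] with z hz using hψC z hz a b c d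
  have d1 : ∀ a b c d, DifferentiableAt ℝ (fun z ↦ g z a b * g z c d) z := fun a b c d ↦
    (differentiableAt_inner hg hz a b).mul (differentiableAt_inner hg hz c d)
  have d2 : DifferentiableAt ℝ (fun z ↦ g z (C z b c) (C z a d)) z :=
    (((hg.differentiableAt hz).clm_apply (differentiableAt_product hg hCd hz b c)).clm_apply
      (differentiableAt_product hg hCd hz a d))
  rw [he.fderiv_eq, fderiv_fun_add (d2.fun_sub (d1 a b c d)) (d1 a c b d),
    fderiv_fun_sub d2 (d1 a b c d), _root_.add_apply, _root_.sub_apply,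
    fderiv_inner_mul_inner hg hz, fderiv_inner_mul_inner hg hz,
    fderiv_inner_product_product hg hCd hz, hψC z hz, hψC z hz, hψC z hz, hψC z hz,
    hg.symm z hz (C z b c) (covDerivProduct g C z x a d)]
  ring

/-- The exterior derivative of the 4-form of the product is the alternation of its covariant
derivative. Here `β` stands for the trilinear forms `⟨(∇_x C)(a, b), c⟩`. -/
lemma covDerivProduct_of_extDeriv_four_eq_zero {ψ : E → E [⋀^Fin 4]→L[ℝ] ℝ} (hz : z ∈ Ω)
    (hψ : DifferentiableAt ℝ ψ z) (hψC : ∀ z ∈ Ω, ∀ a b c d, ψ z ![a, b, c, d]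
      = g z (C z b c) (C z a d) - g z a b * g z c d + g z a c * g z b d)
    (hd : extDeriv ψ z = 0) {β : E → E → E → E → ℝ}
    (hβ : ∀ x a b c d, β x a b (C z c d) = g z (covDerivProduct g C z x a b) (C z c d))
    (x a b c d : E) :
    (β x b c (C z a d) + β x a d (C z b c)) - (β a b c (C z x d) + β a x d (C z b c))
      + (β b a c (C z x d) + β b x d (C z a c)) - (β c a b (C z x d) + β c x d (C z a b))
      + (β d a b (C z x c) + β d x c (C z a b)) = 0 := by
  have s01 : ∀ a b c d, ψ z ![b, a, c, d] = -ψ z ![a, b, c, d] := fun a b c d ↦ by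
    refine Eq.trans ?_ ((ψ z).toAlternatingMap.map_swap ![a, b, c, d]
      (show (0 : Fin 4) ≠ 1 by decide))
    change ψ z _ = ψ z _
    congr 1; ext i : 1; fin_cases i <;> rfl
  have s12 : ∀ a b c d, ψ z ![a, c, b, d] = -ψ z ![a, b, c, d] := fun a b c d ↦ by
    refine Eq.trans ?_ ((ψ z).toAlternatingMap.map_swap ![a, b, c, d]
      (show (1 : Fin 4) ≠ 2 by decide))
    change ψ z _ = ψ z _
    congr 1; ext i : 1; fin_cases i <;> rfl
  have s23 : ∀ a b c d, ψ z ![a, b, d, c] = -ψ z ![a, b, c, d] := fun a b c d ↦ by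
    refine Eq.trans ?_ ((ψ z).toAlternatingMap.map_swap ![a, b, c, d]
      (show (2 : Fin 4) ≠ 3 by decide))
    change ψ z _ = ψ z _
    congr 1; ext i : 1; fin_cases i <;> rfl
  have h0 : ∀ x a b c d, fderiv ℝ (fun z ↦ ψ z ![a, b, c, d]) z x
      = β x b c (C z a d) + β x a d (C z b c)
        + (ψ z ![christoffelL g z x a, b, c, d] - ψ z ![christoffelL g z x b, a, c, d]
        + ψ z ![christoffelL g z x c, a, b, d] - ψ z ![christoffelL g z x d, a, b, c]) := by
    intro x a b c d
    rw [fderiv_of_covDerivProduct hg hCd hC hz hψC, hβ, hβ,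
      s01 (christoffelL g z x b) a, s12 a (christoffelL g z x c), s01 (christoffelL g z x c) a,
      s23 a b (christoffelL g z x d), s12 a (christoffelL g z x d), s01 (christoffelL g z x d) a]
    ring
  have h1 := congrArg (fun α ↦ α ![x, a, b, c, d]) hd
  simp only [extDeriv_apply hψ] at h1
  rw [Fin.sum_univ_five] at h1
  have e0 : (0 : Fin 5).removeNth ![x, a, b, c, d] = ![a, b, c, d] := by
    ext i : 1; fin_cases i <;> rfl
  have e1 : (1 : Fin 5).removeNth ![x, a, b, c, d] = ![x, b, c, d] := by
    ext i : 1; fin_cases i <;> rfl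
  have e2 : (2 : Fin 5).removeNth ![x, a, b, c, d] = ![x, a, c, d] := by
    ext i : 1; fin_cases i <;> rfl
  have e3 : (3 : Fin 5).removeNth ![x, a, b, c, d] = ![x, a, b, d] := by
    ext i : 1; fin_cases i <;> rfl
  have e4 : (4 : Fin 5).removeNth ![x, a, b, c, d] = ![x, a, b, c] := by
    ext i : 1; fin_cases i <;> rfl
  rw [e0, e1, e2, e3, e4] at h1
  simp only [h0, Matrix.cons_val] at h1
  -- the terms with Christoffel symbols cancel in pairs
  rw [hg.christoffel_symm hz a x, hg.christoffel_symm hz b x, hg.christoffel_symm hz c x,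
    hg.christoffel_symm hz d x, hg.christoffel_symm hz b a, hg.christoffel_symm hz c a,
    hg.christoffel_symm hz d a, hg.christoffel_symm hz c b, hg.christoffel_symm hz d b,
    hg.christoffel_symm hz d c] at h1
  simp only [Fin.val_zero, Fin.val_one, Fin.val_two, show ((3 : Fin 5) : ℕ) = 3 from rfl,
    show ((4 : Fin 5) : ℕ) = 4 from rfl] at h1
  norm_num at h1
  linarith

/-- The theorem of Fernández and Gray: if the 3-form and the 4-form of a 7-dimensional vector cross
product are closed, then the product is parallel. -/
lemma covDerivProduct_eq_zero {φ : E → E [⋀^Fin 3]→L[ℝ] ℝ} {ψ : E → E [⋀^Fin 4]→L[ℝ] ℝ}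
    (hz : z ∈ Ω) (hφ : DifferentiableAt ℝ φ z)
    (hφC : ∀ z ∈ Ω, ∀ u v w, φ z ![u, v, w] = g z (C z u v) w)
    (hdφ : extDeriv φ z = 0) (hψ : DifferentiableAt ℝ ψ z)
    (hψC : ∀ z ∈ Ω, ∀ a b c d, ψ z ![a, b, c, d]
      = g z (C z b c) (C z a d) - g z a b * g z c d + g z a c * g z b d)
    (hdψ : extDeriv ψ z = 0) (e : Module.Basis (Fin 7) ℝ E)
    (he : IsStdFrame (fun u v ↦ C z u v) e) (x u v : E) :
    covDerivProduct g C z x u v = 0 := by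
  have h23 : ∀ x u v w, g z (covDerivProduct g C z x u w) v
      = -g z (covDerivProduct g C z x u v) w := inner_covDerivProduct_antisymm hg hCd hC hz
  have key := he.eq_zero (β := fun x u v w ↦ g z (covDerivProduct g C z x u v) w)
    (fun x u v w ↦ by simp [covDerivProduct_antisymm hg hCd hC hz x u v])
    h23 (fun x u v w ↦ by simp) (covDerivProduct_norm hg hCd hC hz)
    (covDerivProduct_of_extDeriv_eq_zero hg hCd hC hz hφ hφC hdφ)
    (fun x u v w t ↦ by
      have h := covDerivProduct_of_extDeriv_four_eq_zero hg hCd hC hz hψ hψC hdψ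
        (β := fun x u v w ↦ g z (covDerivProduct g C z x u v) w) (fun _ _ _ _ _ ↦ rfl) x u v w t
      rw [h23 x u t, h23 u x t, h23 v x t, h23 w x t, h23 t x w]
      linarith)
  -- extension from basis vectors, in one argument after the other
  refine hg.ext hz fun w ↦ ?_
  rw [map_zero, _root_.zero_apply]
  refine eq_zero_of_basis e (f := fun w ↦ g z (covDerivProduct g C z x u v) w) (by simp) (by simp)
    (fun k ↦ ?_) w
  refine eq_zero_of_basis e (f := fun v ↦ g z (covDerivProduct g C z x u v) (e k))
    (fun a b ↦ ?_) (fun c a ↦ ?_) (fun j ↦ ?_) v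
  · rw [← _root_.add_apply, ← map_add]
    congr 2
    simp only [covDerivProduct, map_add]
    abel
  · simp only [covDerivProduct, map_smul, map_sub, map_add, _root_.sub_apply, _root_.add_apply,
      _root_.smul_apply, smul_eq_mul]
    ring
  refine eq_zero_of_basis e (f := fun u ↦ g z (covDerivProduct g C z x u (e j)) (e k))
    (fun a b ↦ ?_) (fun c a ↦ ?_) (fun i ↦ ?_) u
  · rw [← _root_.add_apply, ← map_add]
    congr 2
    simp only [covDerivProduct, map_add, _root_.add_apply]
    abel
  · simp only [covDerivProduct, map_smul, map_sub, map_add, _root_.sub_apply, _root_.add_apply,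
      _root_.smul_apply, smul_eq_mul]
    ring
  refine eq_zero_of_basis e (f := fun x ↦ g z (covDerivProduct g C z x (e i) (e j)) (e k))
    (fun a b ↦ ?_) (fun c a ↦ ?_) (fun l ↦ ?_) x
  · rw [← _root_.add_apply, ← map_add]
    congr 2
    simp only [covDerivProduct, map_add, _root_.add_apply]
    abel
  · simp only [covDerivProduct, map_smul, map_sub, map_add, _root_.sub_apply, _root_.add_apply,
      _root_.smul_apply, smul_eq_mul]
    ring
  exact key l i j k

end FernandezGray

/-! ### The vector product of a G₂-structure in coordinates -/

section ProductOf

variable {E : Type*} [NormedAddCommGroup E] [NormedSpace ℝ E]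

/-- The product `C` with `g (C(u, v), w) = φ(u, v, w)`. -/
def productOf (g : E → E →L[ℝ] E →L[ℝ] ℝ) (φ : E → E [⋀^Fin 3]→L[ℝ] ℝ) (z : E) :
    E →L[ℝ] E →L[ℝ] E :=
  (ContinuousLinearMap.compL ℝ E (E →L[ℝ] ℝ) E (g z).inverse).comp (formCLM E (φ z))

variable [FiniteDimensional ℝ E] {g : E → E →L[ℝ] E →L[ℝ] ℝ} {Ω : Set E} (hg : IsLocalMetric g Ω)
include hg

lemma IsLocalMetric.apply_productOf {z : E} (hz : z ∈ Ω) (φ : E → E [⋀^Fin 3]→L[ℝ] ℝ)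
    (u v w : E) : g z (productOf g φ z u v) w = φ z ![u, v, w] := by
  rw [← formCLM_apply]
  exact congrArg (fun L : E →L[ℝ] ℝ ↦ L w) (hg.apply_inverse hz (formCLM E (φ z) u v))

lemma IsLocalMetric.contDiffOn_productOf {φ : E → E [⋀^Fin 3]→L[ℝ] ℝ} (hφ : ContDiffOn ℝ ∞ φ Ω) :
    ContDiffOn ℝ ∞ (productOf g φ) Ω :=
  ((ContinuousLinearMap.compL ℝ E (E →L[ℝ] ℝ) E).contDiff.comp_contDiffOn
    hg.contDiffOn_inverse).clm_comp ((formCLM E).contDiff.comp_contDiffOn hφ)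

end ProductOf

/-- Differentiability of forms can be tested on constant vectors. -/
lemma differentiableAt_form {E F : Type*} [NormedAddCommGroup E] [NormedSpace ℝ E]
    [NormedAddCommGroup F] [NormedSpace ℝ F] [FiniteDimensional ℝ F] {k : ℕ}
    {α : E → F [⋀^Fin k]→L[ℝ] ℝ} {z : E} (h : ∀ v, DifferentiableAt ℝ (fun z ↦ α z v) z) :
    DifferentiableAt ℝ α z := by
  let b := Module.finBasis ℝ F
  let ev : F [⋀^Fin k]→L[ℝ] ℝ →ₗ[ℝ] ((Fin k → Fin (Module.finrank ℝ F)) → ℝ) :=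
    { toFun := fun α i ↦ α fun j ↦ b (i j)
      map_add' := fun _ _ ↦ rfl
      map_smul' := fun _ _ ↦ rfl }
  have hinj : LinearMap.ker ev = ⊥ := by
    rw [LinearMap.ker_eq_bot']
    intro α hα
    refine ContinuousAlternatingMap.toAlternatingMap_injective (Module.Basis.ext_alternating b ?_)
    intro v _
    exact congrFun hα v
  obtain ⟨L, hL⟩ := ev.exists_leftInverse_of_injective hinj
  have he : α = fun z ↦ LinearMap.toContinuousLinearMap L (ev (α z)) :=
    funext fun z ↦ (LinearMap.congr_fun hL (α z)).symm
  rw [he]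
  refine (LinearMap.toContinuousLinearMap L).differentiableAt.comp z ?_
  exact differentiableAt_pi.2 fun i ↦ h fun j ↦ b (i j)

section

variable {M : Type*} [TopologicalSpace M] [ChartedSpace E7 M] [IsManifold (𝓡 7) ∞ M]

lemma toChart_eq_iff {p x : M} (hx : x ∈ (extChartAt (𝓡 7) p).source) {u : E7}
    {v : TangentSpace (𝓡 7) x} : toChart p x v = u ↔ v = ofChart p x u :=
  ⟨fun h ↦ by rw [← h, ofChart_toChart hx], fun h ↦ by rw [h, toChart_ofChart hx]⟩

lemma toChart_surjective {p x : M} (hx : x ∈ (extChartAt (𝓡 7) p).source) :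
    Function.Surjective (toChart p x) := fun u ↦ ⟨_, toChart_ofChart hx u⟩

lemma formInChart_toChart {k : ℕ} (α : (x : M) → TangentSpace (𝓡 7) x [⋀^Fin k]→L[ℝ] ℝ) {p x : M}
    (hx : x ∈ (extChartAt (𝓡 7) p).source) (v : Fin k → TangentSpace (𝓡 7) x) :
    formInChart α p (extChartAt (𝓡 7) p x) (fun i ↦ toChart p x (v i)) = α x v := by
  rw [formInChart, (extChartAt (𝓡 7) p).left_inv hx]
  change α x (fun i ↦ ofChart p x (toChart p x (v i))) = α x v
  congr 1
  exact funext fun i ↦ ofChart_toChart hx _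

lemma formInChart_toChart_three (α : (x : M) → TangentSpace (𝓡 7) x [⋀^Fin 3]→L[ℝ] ℝ) {p x : M}
    (hx : x ∈ (extChartAt (𝓡 7) p).source) (u v w : TangentSpace (𝓡 7) x) :
    formInChart α p (extChartAt (𝓡 7) p x) ![toChart p x u, toChart p x v, toChart p x w]
      = α x ![u, v, w] := by
  rw [← formInChart_toChart α hx]
  congr 1
  ext i : 1
  fin_cases i <;> rfl

lemma formInChart_toChart_four (α : (x : M) → TangentSpace (𝓡 7) x [⋀^Fin 4]→L[ℝ] ℝ) {p x : M}
    (hx : x ∈ (extChartAt (𝓡 7) p).source) (u v w t : TangentSpace (𝓡 7) x) :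
    formInChart α p (extChartAt (𝓡 7) p x)
        ![toChart p x u, toChart p x v, toChart p x w, toChart p x t]
      = α x ![u, v, w, t] := by
  rw [← formInChart_toChart α hx]
  congr 1
  ext i : 1
  fin_cases i <;> rfl

variable [RiemannianBundle (fun x : M ↦ TangentSpace (𝓡 7) x)]

namespace G2Structure

variable (G : G2Structure M)

lemma form_antisymm (x : M) (u v w : TangentSpace (𝓡 7) x) :
    G.form x ![v, u, w] = -G.form x ![u, v, w] := by
  refine Eq.trans ?_ ((G.form x).toAlternatingMap.map_swap ![u, v, w]
    (show (0 : Fin 3) ≠ 1 by decide))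
  change G.form x _ = G.form x _
  congr 1; ext i : 1; fin_cases i <;> rfl

lemma form_antisymm' (x : M) (u v w : TangentSpace (𝓡 7) x) :
    G.form x ![u, w, v] = -G.form x ![u, v, w] := by
  refine Eq.trans ?_ ((G.form x).toAlternatingMap.map_swap ![u, v, w]
    (show (1 : Fin 3) ≠ 2 by decide))
  change G.form x _ = G.form x _
  congr 1; ext i : 1; fin_cases i <;> rfl

lemma cross_antisymm (x : M) (u v : TangentSpace (𝓡 7) x) : G.cross x u v = -G.cross x v u := by
  refine ext_inner_right ℝ fun w ↦ ?_
  rw [inner_neg_left, inner_cross, inner_cross, form_antisymm]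

lemma inner_cross_cyclic (x : M) (u v w : TangentSpace (𝓡 7) x) :
    inner ℝ (G.cross x u v) w = inner ℝ (G.cross x v w) u := by
  rw [inner_cross, inner_cross, G.form_antisymm' x v u w, G.form_antisymm x u v w, neg_neg]

/-- The 4-form `⋆φ` in terms of the vector product and the metric. In particular, it does not depend
on the frame in its definition. -/
lemma starForm_apply (x : M) (a b c d : TangentSpace (𝓡 7) x) :
    G.starForm x ![a, b, c, d] = inner ℝ (G.cross x b c) (G.cross x a d)
      - inner ℝ a b * inner ℝ c d + inner ℝ a c * inner ℝ b d := by
  obtain ⟨a, rfl⟩ := (G.frame x).surjective a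
  obtain ⟨b, rfl⟩ := (G.frame x).surjective b
  obtain ⟨c, rfl⟩ := (G.frame x).surjective c
  obtain ⟨d, rfl⟩ := (G.frame x).surjective d
  have h1 : G.starForm x ![G.frame x a, G.frame x b, G.frame x c, G.frame x d]
      = hodgeStar3 ((G.form x).compContinuousLinearMap
        (G.frame x : E7 →L[ℝ] TangentSpace (𝓡 7) x)) ![a, b, c, d] := by
    rw [starForm, ContinuousAlternatingMap.compContinuousLinearMap_apply]
    congr 1
    ext i : 1
    fin_cases i <;> simp
  have hα : ∀ u v w, (G.form x).compContinuousLinearMap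
      (G.frame x : E7 →L[ℝ] TangentSpace (𝓡 7) x) ![u, v, w] = stdG2Form u v w := by
    intro u v w
    rw [← G.form_frame x, ContinuousAlternatingMap.compContinuousLinearMap_apply]
    congr 1
    ext i : 1
    fin_cases i <;> rfl
  have h2 : inner ℝ (G.cross x (G.frame x b) (G.frame x c))
      (G.cross x (G.frame x a) (G.frame x d))
      = -∑ m, stdG2Form b c (stdVec m) * stdG2Form a (stdVec m) d := by
    rw [cross, sum_inner, ← Finset.sum_neg_distrib]
    refine Finset.sum_congr rfl fun m _ ↦ ?_
    rw [real_inner_smul_left, real_inner_comm, inner_cross, form_frame, form_antisymm', form_frame]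
    ring
  rw [h1, hodgeStar3_eq hα, h2]
  simp only [inner_frame]
  ring

lemma stdVec_apply (i j : Fin 7) : stdVec i j = if j = i then 1 else 0 := by
  simp [stdVec]

lemma isStdFrame_frame (x : M) : IsStdFrame (G.cross x) fun i ↦ G.frame x (stdVec i) where
  antisymm i j := G.cross_antisymm x _ _
  t01 := by simp [cross, form_frame, stdG2Form_stdVec, Fin.sum_univ_seven, stdVec_apply]
  t02 := by simp [cross, form_frame, stdG2Form_stdVec, Fin.sum_univ_seven, stdVec_apply]
  t03 := by simp [cross, form_frame, stdG2Form_stdVec, Fin.sum_univ_seven, stdVec_apply]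
  t04 := by simp [cross, form_frame, stdG2Form_stdVec, Fin.sum_univ_seven, stdVec_apply]
  t05 := by simp [cross, form_frame, stdG2Form_stdVec, Fin.sum_univ_seven, stdVec_apply]
  t06 := by simp [cross, form_frame, stdG2Form_stdVec, Fin.sum_univ_seven, stdVec_apply]
  t12 := by simp [cross, form_frame, stdG2Form_stdVec, Fin.sum_univ_seven, stdVec_apply]
  t13 := by simp [cross, form_frame, stdG2Form_stdVec, Fin.sum_univ_seven, stdVec_apply]
  t14 := by simp [cross, form_frame, stdG2Form_stdVec, Fin.sum_univ_seven, stdVec_apply]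
  t15 := by simp [cross, form_frame, stdG2Form_stdVec, Fin.sum_univ_seven, stdVec_apply]
  t16 := by simp [cross, form_frame, stdG2Form_stdVec, Fin.sum_univ_seven, stdVec_apply]
  t23 := by simp [cross, form_frame, stdG2Form_stdVec, Fin.sum_univ_seven, stdVec_apply]
  t24 := by simp [cross, form_frame, stdG2Form_stdVec, Fin.sum_univ_seven, stdVec_apply]
  t25 := by simp [cross, form_frame, stdG2Form_stdVec, Fin.sum_univ_seven, stdVec_apply]
  t26 := by simp [cross, form_frame, stdG2Form_stdVec, Fin.sum_univ_seven, stdVec_apply]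
  t34 := by simp [cross, form_frame, stdG2Form_stdVec, Fin.sum_univ_seven, stdVec_apply]
  t35 := by simp [cross, form_frame, stdG2Form_stdVec, Fin.sum_univ_seven, stdVec_apply]
  t36 := by simp [cross, form_frame, stdG2Form_stdVec, Fin.sum_univ_seven, stdVec_apply]
  t45 := by simp [cross, form_frame, stdG2Form_stdVec, Fin.sum_univ_seven, stdVec_apply]
  t46 := by simp [cross, form_frame, stdG2Form_stdVec, Fin.sum_univ_seven, stdVec_apply]
  t56 := by simp [cross, form_frame, stdG2Form_stdVec, Fin.sum_univ_seven, stdVec_apply]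

/-- The expression of the vector product in the preferred chart at `p`. -/
def crossInChart (p : M) : E7 → E7 →L[ℝ] E7 →L[ℝ] E7 :=
  productOf (metricInChart p) (formInChart G.form p)

variable [IsContMDiffRiemannianBundle (𝓡 7) ∞ E7 (fun x : M ↦ TangentSpace (𝓡 7) x)]

lemma contDiffOn_crossInChart (p : M) :
    ContDiffOn ℝ ∞ (G.crossInChart p) (extChartAt (𝓡 7) p).target :=
  (isLocalMetric_metricInChart p).contDiffOn_productOf (G.smooth p)

lemma crossInChart_toChart {p x : M} (hx : x ∈ (extChartAt (𝓡 7) p).source)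
    (u v : TangentSpace (𝓡 7) x) :
    G.crossInChart p (extChartAt (𝓡 7) p x) (toChart p x u) (toChart p x v)
      = toChart p x (G.cross x u v) := by
  have hz := (extChartAt (𝓡 7) p).map_source hx
  refine (isLocalMetric_metricInChart p).ext hz fun w ↦ ?_
  obtain ⟨w, rfl⟩ := toChart_surjective hx w
  rw [crossInChart, (isLocalMetric_metricInChart p).apply_productOf hz,
    formInChart_toChart_three _ hx, metricInChart_toChart hx, inner_cross]

lemma isCrossProduct_crossInChart {p : M} {z : E7} (hz : z ∈ (extChartAt (𝓡 7) p).target) :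
    IsCrossProduct (metricInChart p z) (G.crossInChart p z) := by
  obtain ⟨x, hx, rfl⟩ : ∃ x, x ∈ (extChartAt (𝓡 7) p).source ∧ extChartAt (𝓡 7) p x = z :=
    ⟨_, (extChartAt (𝓡 7) p).map_target hz, (extChartAt (𝓡 7) p).right_inv hz⟩
  have hm := isLocalMetric_metricInChart p
  refine ⟨hm.symm _ hz, hm.pos _ hz, fun u v ↦ ?_, fun u v w ↦ ?_, fun u v ↦ ?_⟩
  · obtain ⟨u, rfl⟩ := toChart_surjective hx u
    obtain ⟨v, rfl⟩ := toChart_surjective hx v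
    rw [G.crossInChart_toChart hx, G.crossInChart_toChart hx, G.cross_antisymm, map_neg]
  · obtain ⟨u, rfl⟩ := toChart_surjective hx u
    obtain ⟨v, rfl⟩ := toChart_surjective hx v
    obtain ⟨w, rfl⟩ := toChart_surjective hx w
    rw [G.crossInChart_toChart hx, G.crossInChart_toChart hx, metricInChart_toChart hx,
      metricInChart_toChart hx, inner_cross_cyclic]
  · obtain ⟨u, rfl⟩ := toChart_surjective hx u
    obtain ⟨v, rfl⟩ := toChart_surjective hx v
    rw [G.crossInChart_toChart hx]
    simp only [metricInChart_toChart hx]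
    exact G.norm_cross_sq x u v

lemma formInChart_form_apply {p : M} {z : E7} (hz : z ∈ (extChartAt (𝓡 7) p).target)
    (u v w : E7) : formInChart G.form p z ![u, v, w]
      = metricInChart p z (G.crossInChart p z u v) w :=
  ((isLocalMetric_metricInChart p).apply_productOf hz _ u v w).symm

lemma formInChart_starForm_apply {p : M} {z : E7} (hz : z ∈ (extChartAt (𝓡 7) p).target)
    (a b c d : E7) : formInChart G.starForm p z ![a, b, c, d]
      = metricInChart p z (G.crossInChart p z b c) (G.crossInChart p z a d)
        - metricInChart p z a b * metricInChart p z c d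
        + metricInChart p z a c * metricInChart p z b d := by
  obtain ⟨x, hx, rfl⟩ : ∃ x, x ∈ (extChartAt (𝓡 7) p).source ∧ extChartAt (𝓡 7) p x = z :=
    ⟨_, (extChartAt (𝓡 7) p).map_target hz, (extChartAt (𝓡 7) p).right_inv hz⟩
  obtain ⟨a, rfl⟩ := toChart_surjective hx a
  obtain ⟨b, rfl⟩ := toChart_surjective hx b
  obtain ⟨c, rfl⟩ := toChart_surjective hx c
  obtain ⟨d, rfl⟩ := toChart_surjective hx d
  rw [G.crossInChart_toChart hx, G.crossInChart_toChart hx, formInChart_toChart_four _ hx]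
  simp only [metricInChart_toChart hx]
  exact G.starForm_apply x a b c d

lemma differentiableAt_formInChart_starForm {p : M} {z : E7}
    (hz : z ∈ (extChartAt (𝓡 7) p).target) :
    DifferentiableAt ℝ (formInChart G.starForm p) z := by
  refine differentiableAt_form fun v ↦ ?_
  have hv : v = ![v 0, v 1, v 2, v 3] := by ext i : 1; fin_cases i <;> rfl
  have hm := isLocalMetric_metricInChart p
  have he : (fun z ↦ formInChart G.starForm p z v) =ᶠ[nhds z] fun z ↦
      metricInChart p z (G.crossInChart p z (v 1) (v 2)) (G.crossInChart p z (v 0) (v 3))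
        - metricInChart p z (v 0) (v 1) * metricInChart p z (v 2) (v 3)
        + metricInChart p z (v 0) (v 2) * metricInChart p z (v 1) (v 3) := by
    filter_upwards [hm.isOpen.mem_nhds hz] with z hz
    rw [← G.formInChart_starForm_apply hz, ← hv]
  refine DifferentiableAt.congr_of_eventuallyEq ?_ he
  have hC := G.contDiffOn_crossInChart p
  exact ((((hm.differentiableAt hz).clm_apply (differentiableAt_product hm hC hz _ _)).clm_apply
      (differentiableAt_product hm hC hz _ _)).fun_sub
    ((differentiableAt_inner hm hz _ _).fun_mul (differentiableAt_inner hm hz _ _))).fun_add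
    ((differentiableAt_inner hm hz _ _).fun_mul (differentiableAt_inner hm hz _ _))

/-- The vector product of a torsion-free structure is parallel, in the chart centred at the given
point. -/
lemma IsTorsionFree.covDerivProduct_self_eq_zero {G : G2Structure M} (hG : G.IsTorsionFree) (p : M)
    (x u v : E7) :
    covDerivProduct (metricInChart p) (G.crossInChart p) (extChartAt (𝓡 7) p p) x u v = 0 := by
  have hp := mem_extChartAt_source (I := 𝓡 7) p
  have hz := (extChartAt (𝓡 7) p).map_source hp
  have hm := isLocalMetric_metricInChart p
  let T : E7 ≃ₗ[ℝ] E7 := LinearEquiv.ofBijective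
    ((toChart p p).toLinearMap ∘ₗ (G.frame p).toLinearMap)
    ⟨(toChart_injective hp).comp (G.frame p).injective,
      (toChart_surjective hp).comp (G.frame p).surjective⟩
  let e : Module.Basis (Fin 7) ℝ E7 := (EuclideanSpace.basisFun (Fin 7) ℝ).toBasis.map T
  have he : ∀ i, e i = toChart p p (G.frame p (stdVec i)) := by
    intro i
    simp only [e, Module.Basis.map_apply, OrthonormalBasis.coe_toBasis,
      EuclideanSpace.basisFun_apply]
    rfl
  have hstd : IsStdFrame (fun u v ↦ G.crossInChart p (extChartAt (𝓡 7) p p) u v) e := by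
    have h := G.isStdFrame_frame p
    constructor <;> intros <;> simp only [he, G.crossInChart_toChart hp]
    · rw [G.cross_antisymm, map_neg]
    all_goals simp only [h.t01, h.t02, h.t03, h.t04, h.t05, h.t06, h.t12, h.t13, h.t14, h.t15,
      h.t16, h.t23, h.t24, h.t25, h.t26, h.t34, h.t35, h.t36, h.t45, h.t46, h.t56, map_neg]
  exact covDerivProduct_eq_zero hm (G.contDiffOn_crossInChart p)
    (fun z hz ↦ G.isCrossProduct_crossInChart hz) hz
    (((G.smooth p).contDiffAt (hm.isOpen.mem_nhds hz)).differentiableAt (by simp))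
    (fun z hz ↦ G.formInChart_form_apply hz) (hG.1 p) (G.differentiableAt_formInChart_starForm hz)
    (fun z hz ↦ G.formInChart_starForm_apply hz) (hG.2 p) e hstd x u v

/-- The 4-form `⋆φ` of a torsion-free structure is parallel. -/
lemma IsTorsionFree.covDerivForm_starForm {G : G2Structure M} (hG : G.IsTorsionFree) (p : M)
    (u : TangentSpace (𝓡 7) p) (v : Fin 4 → TangentSpace (𝓡 7) p) :
    covDerivForm G.starForm p u v = 0 := by
  have hp := mem_extChartAt_source (I := 𝓡 7) p
  have hz := (extChartAt (𝓡 7) p).map_source hp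
  have hm := isLocalMetric_metricInChart p
  rw [covDerivForm, coordCovDerivForm]
  generalize toChart p p u = x
  obtain ⟨w, hw⟩ : ∃ w : Fin 4 → E7, w = fun i ↦ toChart p p (v i) := ⟨_, rfl⟩
  have hwi : ∀ i, toChart p p (v i) = w i := fun i ↦ (congrFun hw i).symm
  simp only [hwi]
  have hw' : w = ![w 0, w 1, w 2, w 3] := by ext i : 1; fin_cases i <;> rfl
  have h := fderiv_of_covDerivProduct hm (G.contDiffOn_crossInChart p)
    (fun z hz ↦ G.isCrossProduct_crossInChart hz) hz
    (fun z hz ↦ G.formInChart_starForm_apply hz) x (w 0) (w 1) (w 2) (w 3)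
  rw [hG.covDerivProduct_self_eq_zero, hG.covDerivProduct_self_eq_zero, ← hw'] at h
  have hd : fderiv ℝ (fun z ↦ formInChart G.starForm p z w) (extChartAt (𝓡 7) p p) x
      = fderiv ℝ (formInChart G.starForm p) (extChartAt (𝓡 7) p p) x w := by
    have := ((ContinuousAlternatingMap.apply ℝ E7 ℝ w).hasFDerivAt.comp (extChartAt (𝓡 7) p p)
      (G.differentiableAt_formInChart_starForm hz).hasFDerivAt).fderiv
    exact congrArg (fun L : E7 →L[ℝ] ℝ ↦ L x) this
  rw [← hd, h, Fin.sum_univ_four]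
  have e : ∀ i (y : E7), Function.update w i y
      = ![![y, w 1, w 2, w 3], ![w 0, y, w 2, w 3], ![w 0, w 1, y, w 3], ![w 0, w 1, w 2, y]] i := by
    intro i y
    ext j : 1
    fin_cases i <;> fin_cases j <;> rfl
  simp only [e, ← christoffelL_apply, map_zero, _root_.zero_apply, Matrix.cons_val]
  ring

end G2Structure

end

/-! ### Coordinate changes -/

section CoordChange

variable {E : Type*} [NormedAddCommGroup E] [NormedSpace ℝ E]

/-- A coordinate change `τ : W → Ω` which carries the metric `g'` to the metric `g`. -/
structure IsCoordChange (g g' : E → E →L[ℝ] E →L[ℝ] ℝ) (τ : E → E) (W Ω Ω' : Set E) : Prop where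
  isOpen : IsOpen W
  subset : W ⊆ Ω'
  contDiffOn : ContDiffOn ℝ ∞ τ W
  mapsTo : Set.MapsTo τ W Ω
  metric : ∀ z ∈ W, ∀ u v, g' z u v = g (τ z) (fderiv ℝ τ z u) (fderiv ℝ τ z v)

variable [FiniteDimensional ℝ E] {g g' : E → E →L[ℝ] E →L[ℝ] ℝ} {τ : E → E} {W Ω Ω' : Set E}
  (hτ : IsCoordChange g g' τ W Ω Ω') (hg : IsLocalMetric g Ω) (hg' : IsLocalMetric g' Ω')
  {z : E}
include hτ

omit [FiniteDimensional ℝ E] in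
lemma IsCoordChange.isLocalMap : IsLocalMap τ W Ω :=
  ⟨hτ.isOpen.uniqueDiffOn, by rw [hτ.isOpen.interior_eq]; exact subset_closure, hτ.contDiffOn,
    hτ.mapsTo⟩

include hg' in
lemma IsCoordChange.fderiv_surjective (hz : z ∈ W) : Function.Surjective (fderiv ℝ τ z) := by
  have hinj : Function.Injective (fderiv ℝ τ z).toLinearMap := by
    intro u v huv
    refine hg'.ext (hτ.subset hz) fun w ↦ ?_
    rw [hτ.metric z hz, hτ.metric z hz]
    have : fderiv ℝ τ z u = fderiv ℝ τ z v := huv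
    rw [this]
  exact LinearMap.injective_iff_surjective.1 hinj

omit [FiniteDimensional ℝ E] in
lemma IsCoordChange.contDiffOn_fderiv : ContDiffOn ℝ ∞ (fderiv ℝ τ) W :=
  hτ.contDiffOn.fderiv_of_isOpen hτ.isOpen (by simp)

omit [FiniteDimensional ℝ E] in
lemma IsCoordChange.differentiableAt_fderiv (hz : z ∈ W) : DifferentiableAt ℝ (fderiv ℝ τ) z :=
  (hτ.contDiffOn_fderiv.contDiffAt (hτ.isOpen.mem_nhds hz)).differentiableAt (by simp)

include hg hg'

/-- The transformation law of the Christoffel symbols. -/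
lemma IsCoordChange.christoffelL (hz : z ∈ W) (u v : E) :
    fderiv ℝ (fderiv ℝ τ) z u v + christoffelL g (τ z) (fderiv ℝ τ z u) (fderiv ℝ τ z v)
      = fderiv ℝ τ z (christoffelL g' z u v) := by
  have hm := hτ.isLocalMap
  have hS : Set.EqOn (fderivWithin ℝ τ W) (fderiv ℝ τ) W := fun z hz ↦
    fderivWithin_of_isOpen hτ.isOpen hz
  have hP : ∀ u v, alongDeriv g W τ u (fun z ↦ fderivWithin ℝ τ W z v) z
      = fderiv ℝ (fderiv ℝ τ) z u v
        + AssocGeom.christoffelL g (τ z) (fderiv ℝ τ z u) (fderiv ℝ τ z v) := by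
    intro u v
    rw [alongDeriv, fderivWithin_fderivWithin_apply hm.uniqueDiffOn hτ.contDiffOn hz,
      fderivWithin_congr hS (hS hz), hS hz, fderivWithin_of_isOpen hτ.isOpen hz]
  -- The difference of the two sides is symmetric in `u, v`, and skew in `v, w` for the metric, hence
  -- it vanishes.
  have key : ∀ u v w,
      g (τ z) (alongDeriv g W τ u (fun z ↦ fderivWithin ℝ τ W z v) z
          - fderiv ℝ τ z (AssocGeom.christoffelL g' z u v)) (fderiv ℝ τ z w)
        = -g (τ z) (alongDeriv g W τ u (fun z ↦ fderivWithin ℝ τ W z w) z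
          - fderiv ℝ τ z (AssocGeom.christoffelL g' z u w)) (fderiv ℝ τ z v) := by
    intro u v w
    have h1 := hg.fderivWithin_metric hm (hm.contDiffOn_fderivWithin hτ.contDiffOn v)
      (hm.contDiffOn_fderivWithin hτ.contDiffOn w) hz u
    have h2 : Set.EqOn (fun x ↦ g (τ x) (fderivWithin ℝ τ W x v) (fderivWithin ℝ τ W x w))
        (fun x ↦ g' x v w) W := fun x hx ↦ by
      simp only [hS hx, hτ.metric x hx]
    have h3 := hg'.fderiv_apply (hτ.subset hz) (differentiableAt_const v)
      (differentiableAt_const w) u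
    rw [fderivWithin_congr h2 (h2 hz), fderivWithin_of_isOpen hτ.isOpen hz, h3] at h1
    simp only [fderiv_fun_const, Pi.zero_apply, _root_.zero_apply, zero_add, hS hz,
      hτ.metric z hz] at h1
    simp only [map_sub, _root_.sub_apply]
    rw [hg.symm _ (hτ.mapsTo hz) (fderiv ℝ τ z v)] at h1
    rw [hg.symm _ (hτ.mapsTo hz) (fderiv ℝ τ z v)] at h1
    linarith
  have hsymm : ∀ u v, alongDeriv g W τ u (fun z ↦ fderivWithin ℝ τ W z v) z
          - fderiv ℝ τ z (AssocGeom.christoffelL g' z u v)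
        = alongDeriv g W τ v (fun z ↦ fderivWithin ℝ τ W z u) z
          - fderiv ℝ τ z (AssocGeom.christoffelL g' z v u) := by
    intro u v
    rw [hg.alongDeriv_fderivWithin_comm hm hz, hg'.christoffel_symm (hτ.subset hz)]
  rw [← hP, ← sub_eq_zero]
  refine hg.ext (hτ.mapsTo hz) fun w ↦ ?_
  obtain ⟨w, rfl⟩ := hτ.fderiv_surjective hg' hz w
  have e1 := key u v w
  have e2 := key v u w
  have e3 := key w u v
  rw [hsymm w u, hsymm w v] at e3
  rw [hsymm v u] at e2
  rw [map_zero, _root_.zero_apply]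
  linarith

/-- The transformation law of the covariant derivative of a product. -/
lemma IsCoordChange.covDerivProduct {C C' : E → E →L[ℝ] E →L[ℝ] E} (hC : ContDiffOn ℝ ∞ C Ω)
    (hC' : ContDiffOn ℝ ∞ C' Ω')
    (h : ∀ z ∈ W, ∀ u v, C (τ z) (fderiv ℝ τ z u) (fderiv ℝ τ z v) = fderiv ℝ τ z (C' z u v))
    (hz : z ∈ W) (x u v : E) :
    covDerivProduct g C (τ z) (fderiv ℝ τ z x) (fderiv ℝ τ z u) (fderiv ℝ τ z v)
      = fderiv ℝ τ z (covDerivProduct g' C' z x u v) := by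
  have hdC : DifferentiableAt ℝ C (τ z) :=
    (hC.contDiffAt (hg.isOpen.mem_nhds (hτ.mapsTo hz))).differentiableAt (by simp)
  have hdC' : DifferentiableAt ℝ C' z :=
    (hC'.contDiffAt (hg'.isOpen.mem_nhds (hτ.subset hz))).differentiableAt (by simp)
  have hdτ : DifferentiableAt ℝ τ z :=
    (hτ.contDiffOn.contDiffAt (hτ.isOpen.mem_nhds hz)).differentiableAt (by simp)
  have hd2 := hτ.differentiableAt_fderiv hz
  have hD : ∀ a, DifferentiableAt ℝ (fun z ↦ fderiv ℝ τ z a) z := fun a ↦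
    hd2.clm_apply (differentiableAt_const a)
  have hDa : ∀ a, fderiv ℝ (fun z ↦ fderiv ℝ τ z a) z x = fderiv ℝ (fderiv ℝ τ) z x a := by
    intro a
    rw [fderiv_clm_apply hd2 (differentiableAt_const a)]
    simp
  have h1 : fderiv ℝ (fun z ↦ C (τ z) (fderiv ℝ τ z u) (fderiv ℝ τ z v)) z x
      = fderiv ℝ (fun z ↦ fderiv ℝ τ z (C' z u v)) z x := by
    refine congrArg (fun L : E →L[ℝ] E ↦ L x) (Filter.EventuallyEq.fderiv_eq ?_)
    filter_upwards [hτ.isOpen.mem_nhds hz] with z hz using h z hz u v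
  have h2 := fderivWithin_bilin (B := C) (γ := τ) (S := Set.univ)
    (ξ := fun z ↦ fderiv ℝ τ z u) (η := fun z ↦ fderiv ℝ τ z v)
    uniqueDiffWithinAt_univ hdC hdτ.differentiableWithinAt
    (hD u).differentiableWithinAt (hD v).differentiableWithinAt x
  simp only [fderivWithin_univ] at h2
  have hdp := differentiableAt_product hg' hC' (hτ.subset hz) u v
  rw [h2, fderiv_clm_apply hd2 hdp] at h1
  have h3 := fderiv_product_add hg' hC' (hτ.subset hz) x u v
  have h4 := congrArg (fun y ↦ fderiv ℝ τ z y) h3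
  have hL := hτ.christoffelL hg hg' hz
  simp only [map_add, ← h z hz, ← hL, _root_.add_apply] at h4
  simp only [_root_.add_apply, ContinuousLinearMap.comp_apply, ContinuousLinearMap.flip_apply,
    hDa] at h1
  have h5 := hL x (C' z u v)
  rw [← h z hz] at h5
  rw [AssocGeom.covDerivProduct]
  linear_combination (norm := module) h1 + h4

end CoordChange

section

variable {M : Type*} [TopologicalSpace M] [ChartedSpace E7 M] [IsManifold (𝓡 7) ∞ M]
  [RiemannianBundle (fun x : M ↦ TangentSpace (𝓡 7) x)]

lemma isCoordChange_transition (p q : M) : IsCoordChange (metricInChart p) (metricInChart q)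
    (transition p q) (transitionDomain p q) (extChartAt (𝓡 7) p).target
    (extChartAt (𝓡 7) q).target :=
  ⟨isOpen_transitionDomain p q, fun _ hz ↦ (mem_transitionDomain.1 hz).1,
    contDiffOn_transition p q, mapsTo_transition p q,
    fun _ hz u v ↦ metricInChart_transition hz u v⟩

variable [IsContMDiffRiemannianBundle (𝓡 7) ∞ E7 (fun x : M ↦ TangentSpace (𝓡 7) x)]

/-- The vector product of a torsion-free structure is parallel in every chart. -/
lemma G2Structure.IsTorsionFree.isParallelProduct {G : G2Structure M} (hG : G.IsTorsionFree)
    (p : M) : IsParallelProduct (metricInChart p) (G.crossInChart p)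
      (extChartAt (𝓡 7) p).target where
  contDiffOn := G.contDiffOn_crossInChart p
  parallel := by
    intro z hz w u v
    obtain ⟨x, hx, rfl⟩ : ∃ x, x ∈ (extChartAt (𝓡 7) p).source ∧ extChartAt (𝓡 7) p x = z :=
      ⟨_, (extChartAt (𝓡 7) p).map_target hz, (extChartAt (𝓡 7) p).right_inv hz⟩
    have hq := mem_extChartAt_source (I := 𝓡 7) x
    have hτ := isCoordChange_transition p x
    have hzx := extChartAt_mem_transitionDomain hx hq
    have key := hτ.covDerivProduct (isLocalMetric_metricInChart p) (isLocalMetric_metricInChart x)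
      (G.contDiffOn_crossInChart p) (G.contDiffOn_crossInChart x)
      (fun y hy u v ↦ by
        obtain ⟨h1, h2⟩ := mem_transitionDomain.1 hy
        obtain ⟨y', hy', rfl⟩ : ∃ y', y' ∈ (extChartAt (𝓡 7) x).source ∧
            extChartAt (𝓡 7) x y' = y :=
          ⟨_, (extChartAt (𝓡 7) x).map_target h1, (extChartAt (𝓡 7) x).right_inv h1⟩
        rw [(extChartAt (𝓡 7) x).left_inv hy'] at h2
        obtain ⟨u, rfl⟩ := toChart_surjective hy' u
        obtain ⟨v, rfl⟩ := toChart_surjective hy' v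
        rw [← toChart_eq_fderiv_transition h2 hy', ← toChart_eq_fderiv_transition h2 hy',
          transition_extChartAt hy', G.crossInChart_toChart h2, G.crossInChart_toChart hy',
          ← toChart_eq_fderiv_transition h2 hy']) hzx
    have hs := hτ.fderiv_surjective (isLocalMetric_metricInChart x) hzx
    obtain ⟨w, rfl⟩ := hs w
    obtain ⟨u, rfl⟩ := hs u
    obtain ⟨v, rfl⟩ := hs v
    have h := key w u v
    rw [hG.covDerivProduct_self_eq_zero, map_zero, transition_extChartAt hq, covDerivProduct] at h
    linear_combination (norm := module) h

end

/-! ### Algebra of associative planes -/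

section AssociativePlane

variable {E : Type*} [NormedAddCommGroup E] [NormedSpace ℝ E]

/-- An oriented orthonormal frame of a three-dimensional space stable under `C`. -/
structure IsAssociativeFrame (g : E →L[ℝ] E →L[ℝ] ℝ) (C : E →L[ℝ] E →L[ℝ] E) (t : Fin 3 → E) :
    Prop where
  orthonormal : ∀ i j, g (t i) (t j) = if i = j then 1 else 0
  cross : C (t 0) (t 1) = t 2

/-- The orthogonal projection to the complement of an orthonormal frame `t`. -/
def normalProj (g : E →L[ℝ] E →L[ℝ] ℝ) (t : Fin 3 → E) : E →ₗ[ℝ] E where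
  toFun X := X - ∑ a, g X (t a) • t a
  map_add' X Y := by
    simp only [map_add, _root_.add_apply, add_smul, Finset.sum_add_distrib]
    abel
  map_smul' r X := by
    simp only [map_smul, _root_.smul_apply, smul_eq_mul, mul_smul, ← Finset.smul_sum,
      RingHom.id_apply, smul_sub]

lemma normalProj_apply (g : E →L[ℝ] E →L[ℝ] ℝ) (t : Fin 3 → E) (X : E) :
    normalProj g t X = X - ∑ a, g X (t a) • t a := rfl

namespace IsAssociativeFrame

variable {g : E →L[ℝ] E →L[ℝ] ℝ} {C : E →L[ℝ] E →L[ℝ] E} {t : Fin 3 → E}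
  (ht : IsAssociativeFrame g C t)

section

include ht

lemma inner_normalProj (X : E) (i : Fin 3) : g (normalProj g t X) (t i) = 0 := by
  simp only [normalProj_apply, map_sub, map_sum, map_smul, _root_.sub_apply, _root_.sum_apply,
    _root_.smul_apply, smul_eq_mul, ht.orthonormal]
  simp

lemma normalProj_frame (i : Fin 3) : normalProj g t (t i) = 0 := by
  simp [normalProj_apply, ht.orthonormal]

omit ht in
lemma normalProj_of_normal {X : E} (hX : ∀ i, g X (t i) = 0) : normalProj g t X = X := by
  simp [normalProj_apply, hX]

end

variable (hC : IsCrossProduct g C)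
include hC ht

lemma cross_12 : C (t 1) (t 2) = t 0 := by
  rw [← ht.cross, hC.antisymm (t 0) (t 1), map_neg, hC.cross_cross_self, ht.orthonormal,
    ht.orthonormal]
  simp

lemma cross_20 : C (t 2) (t 0) = t 1 := by
  rw [← ht.cross, hC.antisymm, hC.cross_cross_self, ht.orthonormal, ht.orthonormal]
  simp

lemma cross_frame (i j : Fin 3) : ∃ c : Fin 3 → ℝ, C (t i) (t j) = ∑ a, c a • t a := by
  have h01 := ht.cross
  have h12 := ht.cross_12 hC
  have h20 := ht.cross_20 hC
  have h10 := hC.antisymm (t 1) (t 0)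
  have h21 := hC.antisymm (t 2) (t 1)
  have h02 := hC.antisymm (t 0) (t 2)
  rw [h01] at h10
  rw [h12] at h21
  rw [h20] at h02
  fin_cases i <;> fin_cases j
  exacts [⟨0, by simp [hC.cross_self]⟩, ⟨![0, 0, 1], by simp [Fin.sum_univ_three, h01]⟩,
    ⟨![0, -1, 0], by simp [Fin.sum_univ_three, h02]⟩,
    ⟨![0, 0, -1], by simp [Fin.sum_univ_three, h10]⟩, ⟨0, by simp [hC.cross_self]⟩,
    ⟨![1, 0, 0], by simp [Fin.sum_univ_three, h12]⟩,
    ⟨![0, 1, 0], by simp [Fin.sum_univ_three, h20]⟩,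
    ⟨![-1, 0, 0], by simp [Fin.sum_univ_three, h21]⟩, ⟨0, by simp [hC.cross_self]⟩]

/-- The product of a tangent and a normal vector is normal. -/
lemma inner_cross_normal {X : E} (hX : ∀ i, g X (t i) = 0) (i j : Fin 3) :
    g (C (t i) X) (t j) = 0 := by
  obtain ⟨c, hc⟩ := ht.cross_frame hC i j
  rw [hC.cross_right, hc]
  simp [hX]

lemma normalProj_cross_normal {X : E} (hX : ∀ i, g X (t i) = 0) (i : Fin 3) :
    normalProj g t (C (t i) X) = C (t i) X :=
  normalProj_of_normal (ht.inner_cross_normal hC hX i)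

lemma normalProj_cross (X : E) (i : Fin 3) :
    normalProj g t (C (t i) X) = C (t i) (normalProj g t X) := by
  rw [← ht.normalProj_cross_normal hC (ht.inner_normalProj X), normalProj_apply g t X]
  simp only [map_sub, map_sum, map_smul]
  have h : ∀ a, normalProj g t (C (t i) (t a)) = 0 := by
    intro a
    obtain ⟨c, hc⟩ := ht.cross_frame hC i a
    simp [hc, ht.normalProj_frame]
  simp [h]

lemma normalProj_cross_left (X : E) (i : Fin 3) :
    normalProj g t (C X (t i)) = C (normalProj g t X) (t i) := by
  rw [hC.antisymm, map_neg, ht.normalProj_cross hC, ← hC.antisymm]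

/-- In dimension seven, a normal vector `n ≠ 0` and the products `tᵢ × n` span the normal space. -/
lemma eq_zero_of_normal (hE : Module.finrank ℝ E = 7) {n P : E} (hn : ∀ i, g n (t i) = 0)
    (hn0 : n ≠ 0) (hP : ∀ i, g P (t i) = 0) (hPn : g P n = 0)
    (hPt : ∀ i, g P (C (t i) n) = 0) : P = 0 := by
  by_contra hP0
  -- otherwise `tᵢ`, `tᵢ × n`, `n`, `P` are eight orthogonal vectors
  have hn' : ∀ i, g (t i) n = 0 := fun i ↦ by rw [hC.symm, hn]
  have htn : ∀ i j, g (C (t i) n) (t j) = 0 := ht.inner_cross_normal hC hn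
  have htt : ∀ i j, g (C (t i) n) (C (t j) n) = if i = j then g n n else 0 := by
    intro i j
    rw [hC.antisymm, hC.antisymm (t j)]
    simp only [map_neg, _root_.neg_apply, neg_neg, hC.inner_cross_cross, ht.orthonormal, hn]
    split_ifs <;> simp
  have hnn := hC.pos n hn0
  have hPP := hC.pos P hP0
  let v : Fin 3 ⊕ Fin 3 ⊕ Fin 2 → E := Sum.elim t (Sum.elim (fun i ↦ C (t i) n) ![n, P])
  have hv : LinearIndependent ℝ v := by
    refine LinearMap.linearIndependent_of_isOrthoᵢ
      (B := LinearMap.mk₂ ℝ (fun u v ↦ g u v) (by simp) (by simp) (by simp) (by simp)) (v := v)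
      ?_ ?_
    · intro i j hij
      change g (v i) (v j) = 0
      rcases i with i | i | i <;> rcases j with j | j | j
      · have h : i ≠ j := fun h ↦ hij (congrArg _ h)
        simp [v, ht.orthonormal, h]
      · simp [v, hC.symm (t i), htn]
      · fin_cases j <;> simp [v, hC.symm (t i), hn, hP]
      · simp [v, htn]
      · have h : i ≠ j := fun h ↦ hij (congrArg _ (congrArg _ h))
        simp [v, htt, h]
      · fin_cases j <;> simp [v, hC.symm (C (t i) n), hPt, hC.inner_cross_right]
      · fin_cases i <;> simp [v, hn, hP]
      · fin_cases i <;> simp [v, hPt, hC.inner_cross_right]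
      · fin_cases i <;> fin_cases j <;> simp [v, hPn, hC.symm n P] at hij ⊢
    · rintro (i | i | i)
      · simp [v, ht.orthonormal]
      · simpa [v, htt] using hnn.ne'
      · fin_cases i <;> simp [v, hnn.ne', hPP.ne']
  have : FiniteDimensional ℝ E := FiniteDimensional.of_finrank_pos (by rw [hE]; norm_num)
  have := hv.fintype_card_le_finrank
  rw [hE] at this
  simp at this

/-- In dimension seven, the product of two normal vectors is tangent. -/
lemma normalProj_cross_of_normal (hE : Module.finrank ℝ E = 7) {n w : E}
    (hn : ∀ i, g n (t i) = 0) (hw : ∀ i, g w (t i) = 0) : normalProj g t (C w n) = 0 := by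
  by_cases hn0 : n = 0
  · simp [hn0]
  have hk : ∀ X, (∀ i, g X (t i) = 0) → g (normalProj g t (C w n)) X = g (C w n) X := by
    intro X hX
    simp only [normalProj_apply, map_sub, map_sum, map_smul, _root_.sub_apply, _root_.sum_apply,
      _root_.smul_apply, smul_eq_mul, hC.symm (t _) X, hX]
    simp
  refine ht.eq_zero_of_normal hC hE hn hn0 (ht.inner_normalProj _) ?_ fun i ↦ ?_
  · rw [hk n hn, hC.symm, hC.inner_cross_right]
  · rw [hk _ (ht.inner_cross_normal hC hn i), hC.antisymm w n, hC.antisymm (t i) n]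
    simp only [map_neg, _root_.neg_apply, neg_neg, hC.inner_cross_cross, hn, hw]
    simp

lemma normalProj_cross_of_right_normal (hE : Module.finrank ℝ E = 7) {n : E}
    (hn : ∀ i, g n (t i) = 0) (X : E) :
    normalProj g t (C X n) = ∑ a, g X (t a) • C (t a) n := by
  have h1 : C X n = C (normalProj g t X) n + ∑ a, g X (t a) • C (t a) n := by
    simp only [normalProj_apply, map_sub, map_sum, map_smul, _root_.sub_apply, _root_.sum_apply,
      _root_.smul_apply]
    abel
  rw [h1, map_add, ht.normalProj_cross_of_normal hC hE hn (ht.inner_normalProj X), zero_add,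
    map_sum]
  simp only [map_smul, ht.normalProj_cross_normal hC hn]

lemma cross_cross_normal_self {X : E} (hX : ∀ i, g X (t i) = 0) (i : Fin 3) :
    C (t i) (C (t i) X) = -X := by
  rw [hC.cross_cross_self, hC.symm, hX, ht.orthonormal]
  simp

lemma cross_cross_normal {X : E} (hX : ∀ i, g X (t i) = 0) {i j : Fin 3} (hij : i ≠ j) :
    C (t i) (C (t j) X) = -C (C (t i) (t j)) X :=
  hC.cross_cross_of_orthogonal (by simp [ht.orthonormal, hij]) (by rw [hC.symm, hX])
    (by rw [hC.symm, hX])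

/-- The Clifford relations of the products `tᵢ ×` on the normal space: the square of the symbol of
the Dirac operator splits into the trace of `Q` and its alternation. -/
lemma sum_cross_cross {Q : Fin 3 → Fin 3 → E} (hQ : ∀ k i j, g (Q k i) (t j) = 0) :
    ∑ k, C (t k) (∑ i, C (t i) (Q k i)) = -∑ k, Q k k - (C (t 2) (Q 0 1 - Q 1 0)
      + C (t 0) (Q 1 2 - Q 2 1) + C (t 1) (Q 2 0 - Q 0 2)) := by
  simp only [Fin.sum_univ_three, map_add, map_sub, ht.cross_cross_normal_self hC (hQ _ _)]
  rw [ht.cross_cross_normal hC (hQ 0 1) (by decide), ht.cross_cross_normal hC (hQ 0 2) (by decide),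
    ht.cross_cross_normal hC (hQ 1 0) (by decide), ht.cross_cross_normal hC (hQ 1 2) (by decide),
    ht.cross_cross_normal hC (hQ 2 0) (by decide), ht.cross_cross_normal hC (hQ 2 1) (by decide),
    hC.antisymm (t 1) (t 0), hC.antisymm (t 2) (t 1), hC.antisymm (t 0) (t 2), ht.cross,
    ht.cross_12 hC, ht.cross_20 hC]
  simp only [map_neg, _root_.neg_apply]
  abel

end IsAssociativeFrame

end AssociativePlane

/-! ### The square of the deformation operator in coordinates -/

section CoordinatePatch

variable {E : Type*} [NormedAddCommGroup E] [NormedSpace ℝ E]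
  {V : Type*} [NormedAddCommGroup V] [NormedSpace ℝ V]

/-- The orthogonal projection to the span of `t₀, t₁, t₂`, if `c` is the inverse of the Gram matrix
of this family. -/
def gramProj (g : E →L[ℝ] E →L[ℝ] ℝ) (c : Fin 3 → Fin 3 → ℝ) (t : Fin 3 → E) (X : E) : E :=
  ∑ a, (∑ b, c a b * g X (t b)) • t a

/-- The coordinate vector fields `∂γ/∂eᵢ` of a parametrized submanifold. -/
def coordField (S : Set V) (γ : V → E) (e : Fin 3 → V) (x : V) (i : Fin 3) : E :=
  fderivWithin ℝ γ S x (e i)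

/-- A parametrized associative submanifold, with coordinate vector fields which are orthonormal at
`x₀`, and with a smooth inverse `c` of the Gram matrix of the coordinate vector fields. -/
structure IsAssociativePatch (g : E → E →L[ℝ] E →L[ℝ] ℝ) (C : E → E →L[ℝ] E →L[ℝ] E) (γ : V → E)
    (S : Set V) (e : Fin 3 → V) (c : V → Fin 3 → Fin 3 → ℝ) (x₀ : V) : Prop where
  mem : x₀ ∈ S
  contDiffOn : ∀ a b, ContDiffOn ℝ ∞ (fun x ↦ c x a b) S
  inverse : ∀ x ∈ S, ∀ a d, ∑ b, c x a b * g (γ x) (coordField S γ e x b) (coordField S γ e x d)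
    = if a = d then 1 else 0
  stable : ∀ x ∈ S, ∀ i j, gramProj (g (γ x)) (c x) (coordField S γ e x)
      (C (γ x) (coordField S γ e x i) (coordField S γ e x j))
    = C (γ x) (coordField S γ e x i) (coordField S γ e x j)
  frame : IsAssociativeFrame (g (γ x₀)) (C (γ x₀)) (coordField S γ e x₀)

/-- The normal derivative `∇^⊥ξ` in the direction `eᵢ` of a vector field along `γ`. -/
def normalAlongDeriv (g : E → E →L[ℝ] E →L[ℝ] ℝ) (S : Set V) (γ : V → E) (e : Fin 3 → V)
    (c : V → Fin 3 → Fin 3 → ℝ) (ξ : V → E) (i : Fin 3) (x : V) : E :=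
  alongDeriv g S γ (e i) ξ x
    - gramProj (g (γ x)) (c x) (coordField S γ e x) (alongDeriv g S γ (e i) ξ x)

/-- The operator `∑ᵢⱼ cᵢⱼ ∂ᵢγ × ∇^⊥_j ξ`, which is `∑ᵢ eᵢ × ∇^⊥_{eᵢ} ξ` for every orthonormal frame
`(eᵢ)` if `c` is the inverse of the Gram matrix. -/
def coordDirac (g : E → E →L[ℝ] E →L[ℝ] ℝ) (C : E → E →L[ℝ] E →L[ℝ] E) (S : Set V) (γ : V → E)
    (e : Fin 3 → V) (c : V → Fin 3 → Fin 3 → ℝ) (ξ : V → E) (x : V) : E :=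
  ∑ i, ∑ j, c x i j • C (γ x) (coordField S γ e x i) (normalAlongDeriv g S γ e c ξ j x)

variable [FiniteDimensional ℝ E] {g : E → E →L[ℝ] E →L[ℝ] ℝ} {Ω : Set E}
  (hg : IsLocalMetric g Ω) {γ : V → E} {S : Set V} (hγ : IsLocalMap γ S Ω)
  {C : E → E →L[ℝ] E →L[ℝ] E} (hC : IsParallelProduct g C Ω)
  (hX : ∀ z ∈ Ω, IsCrossProduct (g z) (C z)) {e : Fin 3 → V} {c : V → Fin 3 → Fin 3 → ℝ} {x₀ : V}
  (hP : IsAssociativePatch g C γ S e c x₀) {ξ : V → E}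

include hγ in
omit [FiniteDimensional ℝ E] in
lemma IsLocalMap.contDiffOn_coordField (i : Fin 3) :
    ContDiffOn ℝ ∞ (fun x ↦ coordField S γ e x i) S :=
  hγ.contDiffOn_fderivWithin hγ.contDiffOn (e i)

include hg hγ in
omit [FiniteDimensional ℝ E] in
lemma IsLocalMetric.contDiffOn_inner {ξ η : V → E} (hξ : ContDiffOn ℝ ∞ ξ S)
    (hη : ContDiffOn ℝ ∞ η S) : ContDiffOn ℝ ∞ (fun x ↦ g (γ x) (ξ x) (η x)) S :=
  ((hg.contDiffOn.comp hγ.contDiffOn hγ.mapsTo).clm_apply hξ).clm_apply hη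

namespace IsAssociativePatch

include hP

include hγ in
omit [FiniteDimensional ℝ E] in
/-- The normal part of the derivative of a tangent vector field. -/
lemma normalProj_alongDeriv_sum {w : Fin 3 → V → ℝ} (hw : ∀ a, ContDiffOn ℝ ∞ (w a) S) (v : V) :
    normalProj (g (γ x₀)) (coordField S γ e x₀)
        (alongDeriv g S γ v (fun x ↦ ∑ a, w a x • coordField S γ e x a) x₀)
      = ∑ a, w a x₀ • normalProj (g (γ x₀)) (coordField S γ e x₀)
        (alongDeriv g S γ v (fun x ↦ coordField S γ e x a) x₀) := by
  rw [hγ.alongDeriv_sum Finset.univ (ζ := fun a x ↦ w a x • coordField S γ e x a)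
    (fun a _ ↦ (hw a).smul (hγ.contDiffOn_coordField a)) hP.mem, map_sum]
  refine Finset.sum_congr rfl fun a _ ↦ ?_
  rw [hγ.alongDeriv_smul (hw a) (hγ.contDiffOn_coordField a) hP.mem, map_add, map_smul, map_smul,
    hP.frame.normalProj_frame, smul_zero, zero_add]

omit [FiniteDimensional ℝ E] in
lemma coeff_self (a b : Fin 3) : c x₀ a b = if a = b then 1 else 0 := by
  have h := hP.inverse x₀ hP.mem a b
  simpa [hP.frame.orthonormal] using h

omit [FiniteDimensional ℝ E] in
lemma gramProj_self (X : E) : X - gramProj (g (γ x₀)) (c x₀) (coordField S γ e x₀) X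
    = normalProj (g (γ x₀)) (coordField S γ e x₀) X := by
  simp [gramProj, normalProj_apply, hP.coeff_self]

omit [FiniteDimensional ℝ E] in
lemma normalAlongDeriv_self (ξ : V → E) (i : Fin 3) : normalAlongDeriv g S γ e c ξ i x₀
    = normalProj (g (γ x₀)) (coordField S γ e x₀) (alongDeriv g S γ (e i) ξ x₀) :=
  hP.gramProj_self _

include hg hγ

/-- The inverse of the Gram matrix has, at a point where the coordinate fields are orthonormal, the
opposite derivative. -/
lemma fderivWithin_coeff (a b : Fin 3) (v : V) : fderivWithin ℝ (fun x ↦ c x a b) S x₀ v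
    = -(g (γ x₀) (alongDeriv g S γ v (fun x ↦ coordField S γ e x a) x₀) (coordField S γ e x₀ b)
      + g (γ x₀) (coordField S γ e x₀ a)
        (alongDeriv g S γ v (fun x ↦ coordField S γ e x b) x₀)) := by
  have hS := hγ.uniqueDiffOn x₀ hP.mem
  have ht := fun i ↦ hγ.contDiffOn_coordField (e := e) i
  have hh : ∀ i, ContDiffOn ℝ ∞
      (fun x ↦ g (γ x) (coordField S γ e x i) (coordField S γ e x b)) S := fun i ↦
    hg.contDiffOn_inner hγ (ht i) (ht b)
  have hcd : ∀ i, DifferentiableWithinAt ℝ (fun x ↦ c x a i) S x₀ := fun i ↦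
    (hP.contDiffOn a i).differentiableOn (by simp) x₀ hP.mem
  have hhd : ∀ i, DifferentiableWithinAt ℝ
      (fun x ↦ g (γ x) (coordField S γ e x i) (coordField S γ e x b)) S x₀ := fun i ↦
    (hh i).differentiableOn (by simp) x₀ hP.mem
  have h1 : fderivWithin ℝ (fun x ↦ ∑ i, c x a i
      * g (γ x) (coordField S γ e x i) (coordField S γ e x b)) S x₀ v = 0 := by
    have heq : Set.EqOn (fun x ↦ ∑ i, c x a i
        * g (γ x) (coordField S γ e x i) (coordField S γ e x b))
        (fun _ ↦ if a = b then 1 else 0) S := fun x hx ↦ hP.inverse x hx a b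
    rw [fderivWithin_congr heq (heq hP.mem)]
    simp
  have hm : ∀ i, DifferentiableWithinAt ℝ (fun x ↦ c x a i
      * g (γ x) (coordField S γ e x i) (coordField S γ e x b)) S x₀ := fun i ↦ (hcd i).mul (hhd i)
  rw [fderivWithin_fun_sum hS fun i _ ↦ hm i, _root_.sum_apply] at h1
  have h2 : ∀ i, fderivWithin ℝ (fun x ↦ c x a i
      * g (γ x) (coordField S γ e x i) (coordField S γ e x b)) S x₀ v
      = (if a = i then (g (γ x₀) (alongDeriv g S γ v (fun x ↦ coordField S γ e x i) x₀)
          (coordField S γ e x₀ b) + g (γ x₀) (coordField S γ e x₀ i)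
            (alongDeriv g S γ v (fun x ↦ coordField S γ e x b) x₀)) else 0)
        + (if i = b then fderivWithin ℝ (fun x ↦ c x a i) S x₀ v else 0) := by
    intro i
    rw [fderivWithin_fun_mul hS (hcd i) (hhd i)]
    simp only [_root_.add_apply, _root_.smul_apply, smul_eq_mul]
    rw [hg.fderivWithin_metric hγ (ht i) (ht b) hP.mem, hP.coeff_self, hP.frame.orthonormal]
    simp
  simp only [h2, Finset.sum_add_distrib, Finset.sum_ite_eq, Finset.sum_ite_eq',
    Finset.mem_univ, if_true] at h1
  linarith

lemma contDiffOn_gramCoeff (hξ : ContDiffOn ℝ ∞ ξ S) (a : Fin 3) :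
    ContDiffOn ℝ ∞ (fun x ↦ ∑ b, c x a b * g (γ x) (ξ x) (coordField S γ e x b)) S :=
  ContDiffOn.sum fun b _ ↦
    (hP.contDiffOn a b).mul (hg.contDiffOn_inner hγ hξ (hγ.contDiffOn_coordField b))

lemma contDiffOn_gramProj (hξ : ContDiffOn ℝ ∞ ξ S) :
    ContDiffOn ℝ ∞ (fun x ↦ gramProj (g (γ x)) (c x) (coordField S γ e x) (ξ x)) S :=
  ContDiffOn.sum fun a _ ↦
    (hP.contDiffOn_gramCoeff hg hγ hξ a).smul (hγ.contDiffOn_coordField a)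

lemma contDiffOn_normalAlongDeriv (hξ : ContDiffOn ℝ ∞ ξ S) (i : Fin 3) :
    ContDiffOn ℝ ∞ (normalAlongDeriv g S γ e c ξ i) S :=
  (hg.contDiffOn_alongDeriv hγ hξ (e i)).sub
    (hP.contDiffOn_gramProj hg hγ (hg.contDiffOn_alongDeriv hγ hξ (e i)))

include hC

lemma contDiffOn_coordDirac (hξ : ContDiffOn ℝ ∞ ξ S) :
    ContDiffOn ℝ ∞ (coordDirac g C S γ e c ξ) S :=
  ContDiffOn.sum fun i _ ↦ ContDiffOn.sum fun j _ ↦ (hP.contDiffOn i j).smul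
    (hC.contDiffOn_apply hγ (hγ.contDiffOn_coordField i)
      (hP.contDiffOn_normalAlongDeriv hg hγ hξ j))

/-- The second fundamental form `B(v, tᵢ)` is compatible with the vector product: this is the normal
part of `∇_v (tᵢ × tⱼ) = ∇_v tᵢ × tⱼ + tᵢ × ∇_v tⱼ`. -/
lemma normalProj_alongDeriv_cross (hX : ∀ z ∈ Ω, IsCrossProduct (g z) (C z)) {i j l : Fin 3}
    (hl : C (γ x₀) (coordField S γ e x₀ i) (coordField S γ e x₀ j) = coordField S γ e x₀ l)
    (v : V) :
    normalProj (g (γ x₀)) (coordField S γ e x₀)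
        (alongDeriv g S γ v (fun x ↦ coordField S γ e x l) x₀)
      = C (γ x₀) (normalProj (g (γ x₀)) (coordField S γ e x₀)
          (alongDeriv g S γ v (fun x ↦ coordField S γ e x i) x₀)) (coordField S γ e x₀ j)
        + C (γ x₀) (coordField S γ e x₀ i) (normalProj (g (γ x₀)) (coordField S γ e x₀)
          (alongDeriv g S γ v (fun x ↦ coordField S γ e x j) x₀)) := by
  have hi := hγ.contDiffOn_coordField (e := e) i
  have hj := hγ.contDiffOn_coordField (e := e) j
  have h1 := hC.alongDeriv_apply hg hγ hi hj hP.mem v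
  have h2 := alongDeriv_congr (g := g) (γ := γ)
    (fun x hx ↦ hP.stable x hx i j) hP.mem v
  have h3 := hP.normalProj_alongDeriv_sum hγ
    (fun a ↦ hP.contDiffOn_gramCoeff hg hγ (hC.contDiffOn_apply hγ hi hj) a) v
  have hx := hX _ (hγ.mapsTo hP.mem)
  simp only [gramProj] at h2
  rw [h2, h1, map_add, hP.frame.normalProj_cross hx, hP.frame.normalProj_cross_left hx] at h3
  rw [h3, hl]
  simp [hP.coeff_self, hP.frame.orthonormal]

include hX

/-- The normal derivative of the Dirac operator at a point where the coordinate fields are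
orthonormal, in terms of the invariant second derivatives of `ξ`. -/
lemma normalProj_alongDeriv_coordDirac (hE : Module.finrank ℝ E = 7) (hξ : ContDiffOn ℝ ∞ ξ S)
    (v : V) :
    normalProj (g (γ x₀)) (coordField S γ e x₀)
        (alongDeriv g S γ v (coordDirac g C S γ e c ξ) x₀)
      = ∑ i, C (γ x₀) (coordField S γ e x₀ i)
        (normalProj (g (γ x₀)) (coordField S γ e x₀)
          (alongDeriv g S γ v (normalAlongDeriv g S γ e c ξ i) x₀)
        - ∑ a, g (γ x₀) (alongDeriv g S γ v (fun x ↦ coordField S γ e x i) x₀)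
          (coordField S γ e x₀ a) • normalAlongDeriv g S γ e c ξ a x₀) := by
  have hx := hX _ (hγ.mapsTo hP.mem)
  have ht := fun i ↦ hγ.contDiffOn_coordField (e := e) i
  have hn := fun i ↦ hP.contDiffOn_normalAlongDeriv hg hγ hξ i
  have hCtn := fun i j ↦ hC.contDiffOn_apply hγ (ht i) (hn j)
  have hnn : ∀ a i, g (γ x₀) (normalAlongDeriv g S γ e c ξ a x₀) (coordField S γ e x₀ i) = 0 := by
    intro a i
    rw [hP.normalAlongDeriv_self]
    exact hP.frame.inner_normalProj _ i
  have h1 : alongDeriv g S γ v (coordDirac g C S γ e c ξ) x₀ = ∑ i, ∑ j,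
      alongDeriv g S γ v (fun x ↦ c x i j •
        C (γ x) (coordField S γ e x i) (normalAlongDeriv g S γ e c ξ j x)) x₀ := by
    refine (hγ.alongDeriv_sum Finset.univ (ζ := fun i x ↦ ∑ j, c x i j •
        C (γ x) (coordField S γ e x i) (normalAlongDeriv g S γ e c ξ j x))
      (fun i _ ↦ ContDiffOn.sum fun j _ ↦ (hP.contDiffOn i j).smul (hCtn i j)) hP.mem v).trans ?_
    refine Finset.sum_congr rfl fun i _ ↦ ?_
    exact hγ.alongDeriv_sum Finset.univ (ζ := fun j x ↦ c x i j •
        C (γ x) (coordField S γ e x i) (normalAlongDeriv g S γ e c ξ j x))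
      (fun j _ ↦ (hP.contDiffOn i j).smul (hCtn i j)) hP.mem v
  have h2 : ∀ i j, normalProj (g (γ x₀)) (coordField S γ e x₀)
      (alongDeriv g S γ v (fun x ↦ c x i j •
        C (γ x) (coordField S γ e x i) (normalAlongDeriv g S γ e c ξ j x)) x₀)
      = -(g (γ x₀) (alongDeriv g S γ v (fun x ↦ coordField S γ e x i) x₀) (coordField S γ e x₀ j)
        + g (γ x₀) (alongDeriv g S γ v (fun x ↦ coordField S γ e x j) x₀) (coordField S γ e x₀ i))
          • C (γ x₀) (coordField S γ e x₀ i) (normalAlongDeriv g S γ e c ξ j x₀)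
        + if i = j then
          (∑ a, g (γ x₀) (alongDeriv g S γ v (fun x ↦ coordField S γ e x j) x₀)
            (coordField S γ e x₀ a) • C (γ x₀) (coordField S γ e x₀ a)
              (normalAlongDeriv g S γ e c ξ j x₀))
          + C (γ x₀) (coordField S γ e x₀ i) (normalProj (g (γ x₀)) (coordField S γ e x₀)
            (alongDeriv g S γ v (normalAlongDeriv g S γ e c ξ j) x₀)) else 0 := by
    intro i j
    rw [hγ.alongDeriv_smul (hP.contDiffOn i j) (hCtn i j) hP.mem, map_add, map_smul, map_smul,
      hP.frame.normalProj_cross_normal hx (hnn j), hP.fderivWithin_coeff hg hγ, hP.coeff_self,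
      hg.symm _ (hγ.mapsTo hP.mem) (coordField S γ e x₀ i)]
    congr 1
    split_ifs with hij
    · subst hij
      rw [one_smul, hC.alongDeriv_apply hg hγ (ht i) (hn i) hP.mem, map_add,
        hP.frame.normalProj_cross hx,
        hP.frame.normalProj_cross_of_right_normal hx hE (hnn i)]
    · rw [zero_smul]
  rw [h1, map_sum]
  simp only [map_sum, h2, Finset.sum_add_distrib, Finset.sum_ite_eq, Finset.mem_univ, if_true,
    map_sub, map_smul, Finset.sum_sub_distrib, neg_add, add_smul, neg_smul,
    Finset.sum_neg_distrib]
  have h3 : ∀ F : Fin 3 → Fin 3 → E, ∑ i, ∑ j, F j i = ∑ i, ∑ j, F i j := fun F ↦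
    Finset.sum_comm
  rw [h3 fun i j ↦ g (γ x₀) (alongDeriv g S γ v (fun x ↦ coordField S γ e x i) x₀)
    (coordField S γ e x₀ j) • C (γ x₀) (coordField S γ e x₀ j)
      (normalAlongDeriv g S γ e c ξ i x₀)]
  abel

end IsAssociativePatch

end CoordinatePatch

section CoordinatePatch

variable {E : Type*} [NormedAddCommGroup E] [NormedSpace ℝ E]
  {V : Type*} [NormedAddCommGroup V] [NormedSpace ℝ V]

lemma coordCurvature_antisymm (g : E → E →L[ℝ] E →L[ℝ] ℝ) (z u v w : E) :
    coordCurvature g z u v w = -coordCurvature g z v u w := by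
  simp only [coordCurvature]
  abel

variable [FiniteDimensional ℝ E] {g : E → E →L[ℝ] E →L[ℝ] ℝ} {Ω : Set E}
  (hg : IsLocalMetric g Ω) {γ : V → E} {S : Set V} (hγ : IsLocalMap γ S Ω)
  {C : E → E →L[ℝ] E →L[ℝ] E} (hC : IsParallelProduct g C Ω)
  (hX : ∀ z ∈ Ω, IsCrossProduct (g z) (C z)) {e : Fin 3 → V} {c : V → Fin 3 → Fin 3 → ℝ} {x₀ : V}
  (hP : IsAssociativePatch g C γ S e c x₀) {ξ : V → E}

include hg hC in
/-- On an associative plane, the curvature term of the squared Dirac operator is the partial Ricci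
operator: `R` acts by derivations of the product, and satisfies the Bianchi identity. -/
lemma IsParallelProduct.sum_coordCurvature {z : E} (hz : z ∈ Ω) (hXz : IsCrossProduct (g z) (C z))
    {t : Fin 3 → E} (ht : IsAssociativeFrame (g z) (C z) t) (s : E) :
    ∑ i, coordCurvature g z (t i) s (t i)
      = -(C z (t 2) (coordCurvature g z (t 0) (t 1) s) + C z (t 0) (coordCurvature g z (t 1) (t 2) s)
        + C z (t 1) (coordCurvature g z (t 2) (t 0) s)) := by
  have e0 := hC.coordCurvature_apply hg hz (t 0) s (t 1) (t 2)
  have e1 := hC.coordCurvature_apply hg hz (t 1) s (t 2) (t 0)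
  have e2 := hC.coordCurvature_apply hg hz (t 2) s (t 0) (t 1)
  rw [ht.cross_12 hXz, hXz.antisymm _ (t 2)] at e0
  rw [ht.cross_20 hXz, hXz.antisymm _ (t 0)] at e1
  rw [ht.cross, hXz.antisymm _ (t 1)] at e2
  have hb : ∀ u v, coordCurvature g z v s u
      = coordCurvature g z u s v - coordCurvature g z u v s := by
    intro u v
    have h := hg.coordCurvature_bianchi hz u v s
    rw [coordCurvature_antisymm g z s u] at h
    linear_combination (norm := module) h
  rw [hb (t 0) (t 2)] at e2
  rw [hb (t 2) (t 1)] at e1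
  rw [hb (t 1) (t 0)] at e0
  simp only [map_sub] at e0 e1 e2
  rw [Fin.sum_univ_three]
  rw [coordCurvature_antisymm g z (t 1) (t 0)] at e0
  rw [coordCurvature_antisymm g z (t 2) (t 1)] at e1
  rw [coordCurvature_antisymm g z (t 0) (t 2)] at e2
  simp only [map_neg] at e0 e1 e2
  linear_combination (norm := module) e0 + e1 + e2

namespace IsAssociativePatch

include hP hg hγ

/-- The commutator of invariant second derivatives in terms of the curvature of the ambient space
and the second fundamental form. -/
lemma normal_commutator (hξ : ContDiffOn ℝ ∞ ξ S) (k i : Fin 3) :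
    normalProj (g (γ x₀)) (coordField S γ e x₀)
        (alongDeriv g S γ (e k) (normalAlongDeriv g S γ e c ξ i) x₀)
      - normalProj (g (γ x₀)) (coordField S γ e x₀)
        (alongDeriv g S γ (e i) (normalAlongDeriv g S γ e c ξ k) x₀)
      = normalProj (g (γ x₀)) (coordField S γ e x₀) (coordCurvature g (γ x₀)
          (coordField S γ e x₀ k) (coordField S γ e x₀ i) (ξ x₀))
        - ((∑ a, g (γ x₀) (alongDeriv g S γ (e i) ξ x₀) (coordField S γ e x₀ a)
          • normalProj (g (γ x₀)) (coordField S γ e x₀)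
            (alongDeriv g S γ (e k) (fun x ↦ coordField S γ e x a) x₀))
        - ∑ a, g (γ x₀) (alongDeriv g S γ (e k) ξ x₀) (coordField S γ e x₀ a)
          • normalProj (g (γ x₀)) (coordField S γ e x₀)
            (alongDeriv g S γ (e i) (fun x ↦ coordField S γ e x a) x₀)) := by
  have h1 : ∀ k i, normalProj (g (γ x₀)) (coordField S γ e x₀)
        (alongDeriv g S γ (e k) (normalAlongDeriv g S γ e c ξ i) x₀)
      = normalProj (g (γ x₀)) (coordField S γ e x₀)
          (alongDeriv g S γ (e k) (alongDeriv g S γ (e i) ξ) x₀)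
        - ∑ a, g (γ x₀) (alongDeriv g S γ (e i) ξ x₀) (coordField S γ e x₀ a)
          • normalProj (g (γ x₀)) (coordField S γ e x₀)
            (alongDeriv g S γ (e k) (fun x ↦ coordField S γ e x a) x₀) := by
    intro k i
    have hd := hg.contDiffOn_alongDeriv hγ hξ (e i)
    have h2 := hP.normalProj_alongDeriv_sum hγ
      (fun a ↦ hP.contDiffOn_gramCoeff hg hγ hd a) (e k)
    have h3 := hγ.alongDeriv_sub (g := g) hd (hP.contDiffOn_gramProj hg hγ hd) hP.mem (e k)
    simp only [gramProj] at h3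
    have h4 : (normalAlongDeriv g S γ e c ξ i) = fun x ↦ alongDeriv g S γ (e i) ξ x
        - ∑ a, (∑ b, c x a b * g (γ x) (alongDeriv g S γ (e i) ξ x) (coordField S γ e x b))
          • coordField S γ e x a := rfl
    rw [h4, h3, map_sub, h2]
    simp [hP.coeff_self]
  have h5 := congrArg (normalProj (g (γ x₀)) (coordField S γ e x₀))
    (hg.alongDeriv_alongDeriv_sub hγ hξ hP.mem (e k) (e i))
  rw [map_sub] at h5
  rw [h1, h1]
  simp only [coordField] at h5 ⊢
  linear_combination (norm := module) h5

include hX hC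

/-- The Weitzenböck formula in coordinates. -/
theorem sum_cross_normalProj_alongDeriv_coordDirac (hE : Module.finrank ℝ E = 7)
    (hξ : ContDiffOn ℝ ∞ ξ S) :
    ∑ k, C (γ x₀) (coordField S γ e x₀ k) (normalProj (g (γ x₀)) (coordField S γ e x₀)
        (alongDeriv g S γ (e k) (coordDirac g C S γ e c ξ) x₀))
      = -∑ k, (normalProj (g (γ x₀)) (coordField S γ e x₀)
          (alongDeriv g S γ (e k) (normalAlongDeriv g S γ e c ξ k) x₀)
          - ∑ a, g (γ x₀) (alongDeriv g S γ (e k) (fun x ↦ coordField S γ e x k) x₀)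
            (coordField S γ e x₀ a) • normalAlongDeriv g S γ e c ξ a x₀)
        + normalProj (g (γ x₀)) (coordField S γ e x₀) (∑ i, coordCurvature g (γ x₀)
          (coordField S γ e x₀ i) (ξ x₀) (coordField S γ e x₀ i))
        + ∑ i, ∑ a, g (γ x₀) (alongDeriv g S γ (e i) ξ x₀) (coordField S γ e x₀ a)
          • normalProj (g (γ x₀)) (coordField S γ e x₀)
            (alongDeriv g S γ (e i) (fun x ↦ coordField S γ e x a) x₀) := by
  have hx := hX _ (hγ.mapsTo hP.mem)
  have hcomm : ∀ k i, alongDeriv g S γ (e k) (fun x ↦ coordField S γ e x i) x₀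
      = alongDeriv g S γ (e i) (fun x ↦ coordField S γ e x k) x₀ := fun k i ↦
    hg.alongDeriv_fderivWithin_comm hγ hP.mem (e k) (e i)
  have hB := fun {i j l : Fin 3} hl v ↦ hP.normalProj_alongDeriv_cross hg hγ hC hX
    (i := i) (j := j) (l := l) hl v
  have hB2 := hB hP.frame.cross
  have hB0 := hB (hP.frame.cross_12 hx)
  have hB1 := hB (hP.frame.cross_20 hx)
  have hnc := hP.normal_commutator hg hγ hξ
  simp only [hP.normalProj_alongDeriv_coordDirac hg hγ hC hX hE hξ]
  rw [hP.frame.sum_cross_cross hx]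
  swap
  · intro k i j
    simp only [map_sub, map_sum, map_smul, _root_.sub_apply, _root_.sum_apply,
      _root_.smul_apply, smul_eq_mul, hP.normalAlongDeriv_self, hP.frame.inner_normalProj]
    simp
  rw [hC.sum_coordCurvature hg (hγ.mapsTo hP.mem) hx hP.frame]
  have hq : ∀ k i, (normalProj (g (γ x₀)) (coordField S γ e x₀)
          (alongDeriv g S γ (e k) (normalAlongDeriv g S γ e c ξ i) x₀)
        - ∑ a, g (γ x₀) (alongDeriv g S γ (e k) (fun x ↦ coordField S γ e x i) x₀)
          (coordField S γ e x₀ a) • normalAlongDeriv g S γ e c ξ a x₀)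
      - (normalProj (g (γ x₀)) (coordField S γ e x₀)
          (alongDeriv g S γ (e i) (normalAlongDeriv g S γ e c ξ k) x₀)
        - ∑ a, g (γ x₀) (alongDeriv g S γ (e i) (fun x ↦ coordField S γ e x k) x₀)
          (coordField S γ e x₀ a) • normalAlongDeriv g S γ e c ξ a x₀)
      = normalProj (g (γ x₀)) (coordField S γ e x₀) (coordCurvature g (γ x₀)
          (coordField S γ e x₀ k) (coordField S γ e x₀ i) (ξ x₀))
        - ((∑ a, g (γ x₀) (alongDeriv g S γ (e i) ξ x₀) (coordField S γ e x₀ a)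
          • normalProj (g (γ x₀)) (coordField S γ e x₀)
            (alongDeriv g S γ (e k) (fun x ↦ coordField S γ e x a) x₀))
        - ∑ a, g (γ x₀) (alongDeriv g S γ (e k) ξ x₀) (coordField S γ e x₀ a)
          • normalProj (g (γ x₀)) (coordField S γ e x₀)
            (alongDeriv g S γ (e i) (fun x ↦ coordField S γ e x a) x₀)) := by
    intro k i
    rw [← hnc, hcomm k i]
    abel
  rw [hq, hq, hq]
  -- `A i a` and `B i a` are the components of the shape operator and the second fundamental form
  obtain ⟨A, hA⟩ : ∃ A : Fin 3 → Fin 3 → ℝ, ∀ i a,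
      g (γ x₀) (alongDeriv g S γ (e i) ξ x₀) (coordField S γ e x₀ a) = A i a :=
    ⟨_, fun _ _ ↦ rfl⟩
  obtain ⟨B, hBd⟩ : ∃ B : Fin 3 → Fin 3 → E, ∀ i a, normalProj (g (γ x₀)) (coordField S γ e x₀)
      (alongDeriv g S γ (e i) (fun x ↦ coordField S γ e x a) x₀) = B i a := ⟨_, fun _ _ ↦ rfl⟩
  have hBs : ∀ i a, B i a = B a i := fun i a ↦ by rw [← hBd, ← hBd, hcomm]
  -- The compatibility of `B` with the product and the symmetry of `B` make the quadratic terms in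
  -- `A` and `B` collapse to `∑ A i a • B i a`.
  have hB2' := fun k ↦ hB2 (e k)
  have hB1' := fun k ↦ hB1 (e k)
  have hB0' := fun k ↦ hB0 (e k)
  simp only [hBd, hx.antisymm (B _ _)] at hB2' hB1' hB0'
  simp only [hA, hBd, Fin.sum_univ_three, map_sub, map_add, map_neg, map_smul,
    hP.frame.normalProj_cross hx]
  have r0 : ∀ a, B 0 a = -C (γ x₀) (coordField S γ e x₀ 2) (B 1 a)
      + C (γ x₀) (coordField S γ e x₀ 1) (B 2 a) := fun a ↦ by
    rw [hBs 0, hBs 1, hBs 2, hB0']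
  have r1 : ∀ a, B 1 a = -C (γ x₀) (coordField S γ e x₀ 0) (B 2 a)
      + C (γ x₀) (coordField S γ e x₀ 2) (B 0 a) := fun a ↦ by
    rw [hBs 0, hBs 1, hBs 2, hB1']
  have r2 : ∀ a, B 2 a = -C (γ x₀) (coordField S γ e x₀ 1) (B 0 a)
      + C (γ x₀) (coordField S γ e x₀ 0) (B 1 a) := fun a ↦ by
    rw [hBs 0, hBs 1, hBs 2, hB2']
  linear_combination (norm := module) -(A 0 0 • r0 0 + A 0 1 • r0 1 + A 0 2 • r0 2
    + A 1 0 • r1 0 + A 1 1 • r1 1 + A 1 2 • r1 2 + A 2 0 • r2 0 + A 2 1 • r2 1 + A 2 2 • r2 2)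

end IsAssociativePatch

end CoordinatePatch

/-! ### Submanifolds in coordinates -/

section SubmanifoldCoordinates

variable {M : Type*} [TopologicalSpace M] [ChartedSpace E7 M] [IsManifold (𝓡 7) ∞ M]
  {H : Type*} [TopologicalSpace H] (I : ModelWithCorners ℝ E3 H)
  {Y : Type*} [TopologicalSpace Y] [ChartedSpace H Y] [IsManifold I ∞ Y]
  (f : Y → M) (y₀ : Y)

/-- The domain in `Y` of the preferred charts at `y₀` and at `f y₀`. -/
def coordSource : Set Y :=
  (extChartAt I y₀).source ∩ f ⁻¹' (extChartAt (𝓡 7) (f y₀)).source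

/-- The domain in `ℝ³` of the local expression of `f` at `y₀`. -/
def coordDomain : Set E3 := (extChartAt I y₀).target ∩
  (extChartAt I y₀).symm ⁻¹' (f ⁻¹' (extChartAt (𝓡 7) (f y₀)).source)

/-- The local expression of `f` in the preferred charts at `y₀` and `f y₀`. -/
def coordMap : E3 → E7 := extChartAt (𝓡 7) (f y₀) ∘ f ∘ (extChartAt I y₀).symm

/-- The local expression in the preferred charts at `y₀` and `f y₀` of a vector field along `f`. -/
def coordVec (s : (y : Y) → TangentSpace (𝓡 7) (f y)) (x : E3) : E7 :=
  toChart (f y₀) (f ((extChartAt I y₀).symm x)) (s ((extChartAt I y₀).symm x))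

/-- The expression in the preferred chart at `y₀` of vectors tangent to `Y`. -/
def subChart (y : Y) : TangentSpace I y →L[ℝ] E3 :=
  (trivializationAt E3 (TangentSpace I : Y → Type _) y₀).continuousLinearMapAt ℝ y

variable {I f y₀} {y : Y} {x : E3}

omit [IsManifold (𝓡 7) ∞ M] [IsManifold I ∞ Y] in
lemma mem_coordSource_self : y₀ ∈ coordSource I f y₀ :=
  ⟨mem_extChartAt_source y₀, mem_extChartAt_source (f y₀)⟩

omit [IsManifold (𝓡 7) ∞ M] [IsManifold I ∞ Y] in
lemma extChartAt_mem_coordDomain (hy : y ∈ coordSource I f y₀) :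
    extChartAt I y₀ y ∈ coordDomain I f y₀ := by
  refine ⟨(extChartAt I y₀).map_source hy.1, ?_⟩
  rw [Set.mem_preimage, (extChartAt I y₀).left_inv hy.1]
  exact hy.2

omit [IsManifold (𝓡 7) ∞ M] [IsManifold I ∞ Y] in
lemma exists_of_mem_coordDomain (hx : x ∈ coordDomain I f y₀) :
    ∃ y ∈ coordSource I f y₀, extChartAt I y₀ y = x :=
  ⟨(extChartAt I y₀).symm x, ⟨(extChartAt I y₀).map_target hx.1, hx.2⟩,
    (extChartAt I y₀).right_inv hx.1⟩

omit [IsManifold (𝓡 7) ∞ M] [IsManifold I ∞ Y] in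
lemma isOpen_coordSource (hf : Continuous f) : IsOpen (coordSource I f y₀) :=
  (isOpen_extChartAt_source y₀).inter ((isOpen_extChartAt_source (I := 𝓡 7) (f y₀)).preimage hf)

omit [IsManifold (𝓡 7) ∞ M] [IsManifold I ∞ Y] in
lemma coordMap_extChartAt (hy : y ∈ coordSource I f y₀) :
    coordMap I f y₀ (extChartAt I y₀ y) = extChartAt (𝓡 7) (f y₀) (f y) := by
  simp only [coordMap, Function.comp_apply]
  rw [(extChartAt I y₀).left_inv hy.1]

omit [IsManifold I ∞ Y] in
lemma coordVec_extChartAt (hy : y ∈ coordSource I f y₀)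
    (s : (y : Y) → TangentSpace (𝓡 7) (f y)) :
    coordVec I f y₀ s (extChartAt I y₀ y) = toChart (f y₀) (f y) (s y) := by
  rw [coordVec, (extChartAt I y₀).left_inv hy.1]

lemma subChart_eq_mfderiv (hy : y ∈ (extChartAt I y₀).source) :
    subChart I y₀ y = mfderiv I 𝓘(ℝ, E3) (extChartAt I y₀) y := by
  rw [extChartAt_source] at hy
  exact TangentBundle.continuousLinearMapAt_trivializationAt hy

lemma subChart_self (v : TangentSpace I y₀) : subChart I y₀ y₀ v = v := by
  rw [subChart_eq_mfderiv (mem_extChartAt_source y₀), mfderiv_extChartAt_self]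
  rfl

/-- The extension of a tangent vector at `y₀` is constant in the chart at `y₀`. -/
lemma subChart_extend (hy : y ∈ (extChartAt I y₀).source) (w : TangentSpace I y₀) :
    subChart I y₀ y (FiberBundle.extend E3 w y) = w := by
  rw [extChartAt_source] at hy
  let t := trivializationAt E3 (TangentSpace I : Y → Type _) y₀
  have h0 : y₀ ∈ t.baseSet := FiberBundle.mem_baseSet_trivializationAt' y₀
  have h1 : FiberBundle.extend E3 w y = t.symmL ℝ y (t ⟨y₀, w⟩).2 :=
    (t.symmL_apply (R := ℝ) hy _).symm
  have h2 : (t ⟨y₀, w⟩).2 = w := by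
    have h3 := subChart_self w
    rw [subChart, t.continuousLinearMapAt_apply_of_mem ℝ h0] at h3
    exact h3
  rw [h1, h2]
  exact t.continuousLinearMapAt_symmL (R := ℝ) hy w

lemma isLocalMap_coordMap (hf : ContMDiff I (𝓡 7) ∞ f) :
    IsLocalMap (coordMap I f y₀) (coordDomain I f y₀) (extChartAt (𝓡 7) (f y₀)).target := by
  obtain ⟨O, hO, hO'⟩ := (continuousOn_iff'.1 (continuousOn_extChartAt_symm (I := I) y₀))
    (f ⁻¹' (extChartAt (𝓡 7) (f y₀)).source)
    ((isOpen_extChartAt_source (I := 𝓡 7) (f y₀)).preimage hf.continuous)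
  have hS : coordDomain I f y₀ = (extChartAt I y₀).target ∩ O := by
    rw [coordDomain, Set.inter_comm, hO', Set.inter_comm]
  refine ⟨?_, ?_, ?_, ?_⟩
  · rw [hS]
    exact (uniqueDiffOn_extChartAt_target y₀).inter hO
  · rw [hS]
    rintro x ⟨h1, h2⟩
    rw [interior_inter, hO.interior_eq, mem_closure_iff]
    intro U hU hxU
    obtain ⟨z, hz⟩ := mem_closure_iff.1 (extChartAt_target_subset_closure_interior h1) (U ∩ O)
      (hU.inter hO) ⟨hxU, h2⟩
    exact ⟨z, hz.1.1, hz.2, hz.1.2⟩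
  · exact (contMDiff_iff.1 hf).2 y₀ (f y₀)
  · intro x hx
    exact (extChartAt (𝓡 7) (f y₀)).map_source hx.2

/-- Derivatives along `Y` are derivatives within the domain of the chart, which need not be open
if `Y` has a boundary. -/
lemma mvfderiv_eq_fderivWithin {F : Type*} [NormedAddCommGroup F] [NormedSpace ℝ F] {h : Y → F}
    {h' : E3 → F} (hf : Continuous f) (hy : y ∈ coordSource I f y₀)
    (hh' : DifferentiableWithinAt ℝ h' (coordDomain I f y₀) (extChartAt I y₀ y))
    (hh : h =ᶠ[nhds y] h' ∘ extChartAt I y₀) (v : TangentSpace I y) :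
    mvfderiv I h y v = fderivWithin ℝ h' (coordDomain I f y₀) (extChartAt I y₀ y)
      (subChart I y₀ y v) := by
  have hy' := hy.1
  rw [extChartAt_source] at hy'
  have h1 := hh'.hasFDerivWithinAt.hasMFDerivWithinAt
  have h2 : HasMFDerivAt I 𝓘(ℝ, E3) (extChartAt I y₀) y
      (mfderiv I 𝓘(ℝ, E3) (extChartAt I y₀) y) :=
    (mdifferentiableAt_extChartAt hy').hasMFDerivAt
  have h3 := (h1.comp y (h2.hasMFDerivWithinAt (s := coordSource I f y₀))
    (fun _ hz ↦ extChartAt_mem_coordDomain hz)).hasMFDerivAt ((isOpen_coordSource hf).mem_nhds hy)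
  have h4 := (h3.congr_of_eventuallyEq hh).mfderiv
  rw [mvfderiv, h4, subChart_eq_mfderiv hy.1]
  rfl

lemma toChart_mfderiv (hf : ContMDiff I (𝓡 7) ∞ f) (hy : y ∈ coordSource I f y₀)
    (v : TangentSpace I y) : toChart (f y₀) (f y) (mfderiv I (𝓡 7) f y v)
      = fderivWithin ℝ (coordMap I f y₀) (coordDomain I f y₀) (extChartAt I y₀ y)
        (subChart I y₀ y v) := by
  have hm := isLocalMap_coordMap (y₀ := y₀) hf
  have h1 := mvfderiv_eq_fderivWithin (h := fun y ↦ extChartAt (𝓡 7) (f y₀) (f y)) hf.continuous hy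
    (hm.contDiffOn.differentiableOn (by simp) _ (extChartAt_mem_coordDomain hy))
    (by filter_upwards [(isOpen_coordSource hf.continuous).mem_nhds hy] with z hz
        exact (coordMap_extChartAt hz).symm) v
  have hfy := hy.2
  rw [Set.mem_preimage, extChartAt_source] at hfy
  rw [← h1, toChart_eq_mfderiv hy.2]
  have h2 := ((mdifferentiableAt_extChartAt (I := 𝓡 7) hfy).hasMFDerivAt.comp y
    ((hf.mdifferentiable (by simp) y).hasMFDerivAt)).mfderiv
  rw [mvfderiv]
  exact (congrArg (fun L ↦ L v) h2).symm

end SubmanifoldCoordinates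

section SubmanifoldGeometry

variable {M : Type*} [TopologicalSpace M] [ChartedSpace E7 M] [IsManifold (𝓡 7) ∞ M]
  [RiemannianBundle (fun x : M ↦ TangentSpace (𝓡 7) x)]
  [IsContMDiffRiemannianBundle (𝓡 7) ∞ E7 (fun x : M ↦ TangentSpace (𝓡 7) x)]
  {H : Type*} [TopologicalSpace H] {I : ModelWithCorners ℝ E3 H}
  {Y : Type*} [TopologicalSpace Y] [ChartedSpace H Y] [IsManifold I ∞ Y]
  {f : Y → M} {y₀ y : Y} {x : E3}

/-- Covariant derivatives along `f` can be computed in any chart: `covDeriv` at `y` is defined in the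
chart at `f y`, and the Christoffel symbols transform accordingly. -/
lemma toChart_covDeriv (hf : ContMDiff I (𝓡 7) ∞ f) (hy : y ∈ coordSource I f y₀)
    {s : (y : Y) → TangentSpace (𝓡 7) (f y)}
    (hs : ContDiffOn ℝ ∞ (coordVec I f y₀ s) (coordDomain I f y₀)) (v : TangentSpace I y) :
    toChart (f y₀) (f y) (covDeriv I f s y v)
      = alongDeriv (metricInChart (f y₀)) (coordDomain I f y₀) (coordMap I f y₀)
        (subChart I y₀ y v) (coordVec I f y₀ s) (extChartAt I y₀ y) := by
  have hq := mem_extChartAt_source (I := 𝓡 7) (f y)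
  have hx := extChartAt_mem_coordDomain hy
  have hm := isLocalMap_coordMap (y₀ := y₀) hf
  have hτ := isCoordChange_transition (f y) (f y₀)
  have hz := extChartAt_mem_transitionDomain hq hy.2
  have hzx : coordMap I f y₀ (extChartAt I y₀ y) ∈ transitionDomain (f y) (f y₀) := by
    rw [coordMap_extChartAt hy]
    exact hz
  have hγd := hm.contDiffOn.differentiableOn (by simp) _ hx
  have hsd := hs.differentiableOn (by simp) _ hx
  have hDd := (hτ.differentiableAt_fderiv hzx).hasFDerivAt.comp_hasFDerivWithinAt
    (extChartAt I y₀ y) hγd.hasFDerivWithinAt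
  have hD := hDd.clm_apply hsd.hasFDerivWithinAt
  have h1 := mvfderiv_eq_fderivWithin (h := fun y' ↦ toChart (f y) (f y') (s y')) hf.continuous hy
    hD.differentiableWithinAt (by
      filter_upwards [(isOpen_coordSource hf.continuous).mem_nhds hy,
        (hf.continuous.continuousAt (x := y)).preimage_mem_nhds
          ((isOpen_extChartAt_source (I := 𝓡 7) (f y)).mem_nhds hq)] with y' h2 h3
      simp only [Function.comp_apply]
      rw [toChart_eq_fderiv_transition h3 h2.2, coordMap_extChartAt h2, coordVec_extChartAt h2]) v
  rw [hD.fderivWithin (hm.uniqueDiffOn _ hx)] at h1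
  have h4 := hτ.christoffelL (isLocalMetric_metricInChart (f y))
    (isLocalMetric_metricInChart (f y₀)) hz
    (toChart (f y₀) (f y) (mfderiv I (𝓡 7) f y v)) (toChart (f y₀) (f y) (s y))
  rw [covDeriv, h1, toChart_eq_fderiv_transition hq hy.2 (mfderiv I (𝓡 7) f y v),
    toChart_eq_fderiv_transition hq hy.2 (s y), ← christoffelL_apply,
    ← transition_extChartAt hy.2]
  simp only [_root_.add_apply, ContinuousLinearMap.comp_apply, ContinuousLinearMap.flip_apply,
    coordMap_extChartAt hy, coordVec_extChartAt hy, Function.comp_apply,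
    ← toChart_mfderiv hf hy v]
  have h5 : ∀ a : E7, ofChart (f y) (f y) (fderiv ℝ (transition (f y) (f y₀))
      (extChartAt (𝓡 7) (f y₀) (f y)) a) = ofChart (f y₀) (f y) a := by
    intro a
    rw [← toChart_ofChart_eq hq hy.2, ofChart_toChart hq]
  rw [alongDeriv, ← toChart_mfderiv hf hy v, coordMap_extChartAt hy, coordVec_extChartAt hy]
  refine Eq.trans ?_ (toChart_ofChart hy.2 _)
  congr 1
  rw [← h5]
  congr 1
  rw [map_add, ← h4]
  abel

/-- Smooth vector fields along `f` have smooth local expressions. -/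
lemma contDiffOn_coordVec {s : (y : Y) → TangentSpace (𝓡 7) (f y)}
    (hs : ContMDiff I (𝓡 7).tangent ∞ (fun y ↦ (⟨f y, s y⟩ : TangentBundle (𝓡 7) M))) :
    ContDiffOn ℝ ∞ (coordVec I f y₀ s) (coordDomain I f y₀) := by
  let t := trivializationAt E7 (TangentSpace (𝓡 7) : M → Type _) (f y₀)
  have hb : ∀ x ∈ coordDomain I f y₀, f ((extChartAt I y₀).symm x) ∈ t.baseSet := by
    intro x hx
    have h := hx.2
    rw [Set.mem_preimage, Set.mem_preimage, extChartAt_source] at h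
    exact h
  have h1 : ContMDiffOn 𝓘(ℝ, E3) (𝓡 7).tangent ∞
      (fun x ↦ (⟨f ((extChartAt I y₀).symm x), s ((extChartAt I y₀).symm x)⟩ :
        TangentBundle (𝓡 7) M)) (coordDomain I f y₀) :=
    hs.comp_contMDiffOn ((contMDiffOn_extChartAt_symm y₀).mono fun x hx ↦ hx.1)
  have h2 := (t.contMDiffOn (IB := 𝓡 7) (n := ∞)).comp h1
    (fun x hx ↦ t.mem_source.2 (hb x hx))
  have h3 : ContMDiffOn 𝓘(ℝ, E3) 𝓘(ℝ, E7) ∞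
      (fun x ↦ (t ⟨f ((extChartAt I y₀).symm x), s ((extChartAt I y₀).symm x)⟩).2)
      (coordDomain I f y₀) := contMDiff_snd.comp_contMDiffOn h2
  refine (contMDiffOn_iff_contDiffOn.1 h3).congr fun x hx ↦ ?_
  exact t.continuousLinearMapAt_apply_of_mem ℝ (hb x hx) _

/-- Vector fields along `f` with smooth local expressions are smooth. -/
lemma contMDiff_of_coordVec (hf : ContMDiff I (𝓡 7) ∞ f) {s : (y : Y) → TangentSpace (𝓡 7) (f y)}
    (hs : ∀ y₀, ContDiffOn ℝ ∞ (coordVec I f y₀ s) (coordDomain I f y₀)) :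
    ContMDiff I (𝓡 7).tangent ∞ (fun y ↦ (⟨f y, s y⟩ : TangentBundle (𝓡 7) M)) := by
  intro y₀
  rw [contMDiffAt_totalSpace]
  refine ⟨hf y₀, ?_⟩
  have h1 : ContMDiffOn I 𝓘(ℝ, E7) ∞ (coordVec I f y₀ s ∘ extChartAt I y₀) (coordSource I f y₀) :=
    (contMDiffOn_iff_contDiffOn.2 (hs y₀)).comp
      ((contMDiffOn_extChartAt (x := y₀)).mono fun y hy ↦ by
        have := hy.1; rwa [extChartAt_source] at this)
      fun y hy ↦ extChartAt_mem_coordDomain hy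
  have hn := (isOpen_coordSource (I := I) (y₀ := y₀) hf.continuous).mem_nhds mem_coordSource_self
  refine (h1.contMDiffAt hn).congr_of_eventuallyEq ?_
  filter_upwards [hn] with y hy
  rw [Function.comp_apply, coordVec_extChartAt hy]
  have hb := hy.2
  rw [Set.mem_preimage, extChartAt_source] at hb
  exact ((trivializationAt E7 (TangentSpace (𝓡 7) : M → Type _)
    (f y₀)).continuousLinearMapAt_apply_of_mem ℝ hb _).symm

end SubmanifoldGeometry

/-! ### The inverse of the Gram matrix -/

section Gram

variable {E V : Type*} [NormedAddCommGroup E] [NormedSpace ℝ E] [NormedAddCommGroup V]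
  [NormedSpace ℝ V]

/-- The Gram matrix of the coordinate vector fields. -/
def gramMatrix (g : E → E →L[ℝ] E →L[ℝ] ℝ) (S : Set V) (γ : V → E) (e : Fin 3 → V) (x : V) :
    Matrix (Fin 3) (Fin 3) ℝ :=
  Matrix.of fun i j ↦ g (γ x) (coordField S γ e x i) (coordField S γ e x j)

lemma contDiffOn_det {ι : Type*} [Fintype ι] [DecidableEq ι] {S : Set V} {A : V → Matrix ι ι ℝ}
    (hA : ∀ i j, ContDiffOn ℝ ∞ (fun x ↦ A x i j) S) : ContDiffOn ℝ ∞ (fun x ↦ (A x).det) S := by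
  simp only [Matrix.det_apply']
  exact ContDiffOn.sum fun σ _ ↦ contDiffOn_const.mul (contDiffOn_prod fun i _ ↦ hA _ _)

lemma contDiffOn_matrix_inv {ι : Type*} [Fintype ι] [DecidableEq ι] {S : Set V}
    {A : V → Matrix ι ι ℝ} (hA : ∀ i j, ContDiffOn ℝ ∞ (fun x ↦ A x i j) S)
    (hdet : ∀ x ∈ S, (A x).det ≠ 0) (i j : ι) : ContDiffOn ℝ ∞ (fun x ↦ (A x)⁻¹ i j) S := by
  simp only [Matrix.inv_def, Matrix.smul_apply, Ring.inverse_eq_inv', smul_eq_mul,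
    Matrix.adjugate_apply]
  refine ((contDiffOn_det hA).inv hdet).mul (contDiffOn_det fun k l ↦ ?_)
  simp only [Matrix.updateRow_apply]
  split_ifs
  · exact contDiffOn_const
  · exact hA k l

variable {g : E → E →L[ℝ] E →L[ℝ] ℝ} {Ω : Set E} (hg : IsLocalMetric g Ω) {γ : V → E} {S : Set V}
  (hγ : IsLocalMap γ S Ω) {e : Fin 3 → V} {x : V}
include hg hγ

lemma gramMatrix_isSymm (hx : x ∈ S) : (gramMatrix g S γ e x).IsSymm := by
  ext i j
  exact hg.symm _ (hγ.mapsTo hx) _ _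

lemma det_gramMatrix_ne_zero (hx : x ∈ S) (hinj : Function.Injective (fderivWithin ℝ γ S x))
    (he : LinearIndependent ℝ e) : (gramMatrix g S γ e x).det ≠ 0 := by
  intro h
  obtain ⟨v, hv, hv0⟩ := Matrix.exists_mulVec_eq_zero_iff.2 h
  apply hv
  have h1 : ∑ j, v j • coordField S γ e x j = 0 := by
    by_contra hne
    have hpos := hg.pos _ (hγ.mapsTo hx) _ hne
    have h2 : g (γ x) (∑ j, v j • coordField S γ e x j) (∑ j, v j • coordField S γ e x j)
        = ∑ i, v i * (gramMatrix g S γ e x).mulVec v i := by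
      simp only [map_sum, map_smul, _root_.sum_apply, _root_.smul_apply, smul_eq_mul,
        Matrix.mulVec, dotProduct, gramMatrix, Matrix.of_apply, Finset.mul_sum]
      rw [Finset.sum_comm]
      exact Finset.sum_congr rfl fun i _ ↦ Finset.sum_congr rfl fun j _ ↦ by ring
    rw [h2, hv0] at hpos
    simp at hpos
  have h3 : ∑ j, v j • e j = 0 := hinj (by simpa [coordField] using h1)
  exact funext (Fintype.linearIndependent_iff.1 he v h3)

lemma contDiffOn_gramMatrix_inv (hinj : ∀ x ∈ S, Function.Injective (fderivWithin ℝ γ S x))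
    (he : LinearIndependent ℝ e) (i j : Fin 3) :
    ContDiffOn ℝ ∞ (fun x ↦ (gramMatrix g S γ e x)⁻¹ i j) S :=
  contDiffOn_matrix_inv (fun i j ↦ hg.contDiffOn_inner hγ (hγ.contDiffOn_coordField i)
    (hγ.contDiffOn_coordField j)) (fun x hx ↦ det_gramMatrix_ne_zero hg hγ hx (hinj x hx) he) i j

/-- The defining property of the projection `gramProj`. -/
lemma inner_sub_gramProj (hx : x ∈ S) (hdet : (gramMatrix g S γ e x).det ≠ 0) (X : E) (d : Fin 3) :
    g (γ x) (X - gramProj (g (γ x)) (fun i j ↦ (gramMatrix g S γ e x)⁻¹ i j)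
      (coordField S γ e x) X) (coordField S γ e x d) = 0 := by
  have hinv : (gramMatrix g S γ e x)⁻¹ * gramMatrix g S γ e x = 1 :=
    Matrix.nonsing_inv_mul _ (Ne.isUnit hdet)
  have hsymm : ((gramMatrix g S γ e x)⁻¹).IsSymm := by
    rw [Matrix.IsSymm, Matrix.transpose_nonsing_inv, gramMatrix_isSymm hg hγ hx]
  have hb : ∀ b, ∑ a, (gramMatrix g S γ e x)⁻¹ a b
      * g (γ x) (coordField S γ e x a) (coordField S γ e x d) = if b = d then 1 else 0 := by
    intro b
    have := congrFun (congrFun hinv b) d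
    rw [Matrix.mul_apply, Matrix.one_apply] at this
    rw [← this]
    exact Finset.sum_congr rfl fun a _ ↦ by rw [← hsymm.apply a b]; rfl
  simp only [gramProj, map_sub, map_sum, map_smul, _root_.sub_apply, _root_.sum_apply,
    _root_.smul_apply, smul_eq_mul, Finset.sum_mul]
  rw [Finset.sum_comm, sub_eq_zero]
  have h2 : ∀ b, ∑ a, (gramMatrix g S γ e x)⁻¹ a b * g (γ x) X (coordField S γ e x b)
      * g (γ x) (coordField S γ e x a) (coordField S γ e x d)
      = if b = d then g (γ x) X (coordField S γ e x b) else 0 := by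
    intro b
    rw [← mul_one (g (γ x) X (coordField S γ e x b)), ← mul_ite_zero, ← hb b, Finset.mul_sum]
    exact Finset.sum_congr rfl fun a _ ↦ by ring
  simp only [h2]
  simp

lemma sum_gramMatrix_inv_mul (hdet : (gramMatrix g S γ e x).det ≠ 0) (a d : Fin 3) :
    ∑ b, (gramMatrix g S γ e x)⁻¹ a b
      * g (γ x) (coordField S γ e x b) (coordField S γ e x d) = if a = d then 1 else 0 := by
  have hinv : (gramMatrix g S γ e x)⁻¹ * gramMatrix g S γ e x = 1 :=
    Matrix.nonsing_inv_mul _ (Ne.isUnit hdet)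
  have := congrFun (congrFun hinv a) d
  rwa [Matrix.mul_apply, Matrix.one_apply] at this

end Gram

lemma alongDeriv_sum_direction {E V ι : Type*} [NormedAddCommGroup E] [NormedSpace ℝ E]
    [NormedAddCommGroup V] [NormedSpace ℝ V] (g : E → E →L[ℝ] E →L[ℝ] ℝ) (S : Set V) (γ : V → E)
    (ξ : V → E) (x : V) (u : Finset ι) (a : ι → ℝ) (e : ι → V) :
    alongDeriv g S γ (∑ i ∈ u, a i • e i) ξ x = ∑ i ∈ u, a i • alongDeriv g S γ (e i) ξ x := by
  simp [alongDeriv, Finset.sum_add_distrib]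

lemma gramProj_sum {E ι : Type*} [NormedAddCommGroup E] [NormedSpace ℝ E]
    (g : E →L[ℝ] E →L[ℝ] ℝ) (c : Fin 3 → Fin 3 → ℝ) (t : Fin 3 → E) (u : Finset ι) (a : ι → ℝ)
    (X : ι → E) : gramProj g c t (∑ i ∈ u, a i • X i) = ∑ i ∈ u, a i • gramProj g c t (X i) := by
  simp only [gramProj, map_sum, map_smul, _root_.sum_apply, _root_.smul_apply, smul_eq_mul,
    Finset.smul_sum]
  rw [Finset.sum_comm]
  refine Finset.sum_congr rfl fun k _ ↦ ?_
  simp only [smul_smul, ← Finset.sum_smul, Finset.mul_sum]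
  rw [Finset.sum_comm]
  congr 1
  exact Finset.sum_congr rfl fun i _ ↦ Finset.sum_congr rfl fun b _ ↦ by ring

/-! ### Adapted frames in coordinates -/

section

variable {M : Type*} [TopologicalSpace M] [ChartedSpace E7 M] [IsManifold (𝓡 7) ∞ M]
  [RiemannianBundle (fun x : M ↦ TangentSpace (𝓡 7) x)]
  [IsContMDiffRiemannianBundle (𝓡 7) ∞ E7 (fun x : M ↦ TangentSpace (𝓡 7) x)]
  {G : G2Structure M} {H : Type*} [TopologicalSpace H] {I : ModelWithCorners ℝ E3 H}
  {Y : Type*} [TopologicalSpace Y] [ChartedSpace H Y] [IsManifold I ∞ Y]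
  {f : Y → M} {y₀ y : Y} {x : E3}

omit [IsContMDiffRiemannianBundle (𝓡 7) ∞ E7 (fun x : M ↦ TangentSpace (𝓡 7) x)]
  [RiemannianBundle (fun x : M ↦ TangentSpace (𝓡 7) x)] in
lemma subChart_surjective (hy : y ∈ (extChartAt I y₀).source) :
    Function.Surjective (subChart I y₀ y) := by
  rw [extChartAt_source] at hy
  exact Function.RightInverse.surjective
    ((trivializationAt E3 (TangentSpace I : Y → Type _) y₀).continuousLinearMapAt_symmL
    (R := ℝ) hy)

namespace AdaptedFrame

variable (F : AdaptedFrame I f G)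

/-- The frame at `y₀`, as a family of vectors in `ℝ³`. -/
def coordFrame (y₀ : Y) (i : Fin 3) : E3 := F.e y₀ i

/-- The inverse of the Gram matrix of the coordinate vector fields of the frame at `y₀`. -/
def coeff (y₀ : Y) (x : E3) (i j : Fin 3) : ℝ :=
  (gramMatrix (metricInChart (f y₀)) (coordDomain I f y₀) (coordMap I f y₀) (F.coordFrame y₀) x)⁻¹
    i j

/-- The coordinate vector fields of the frame at `y₀`. -/
def field (y₀ : Y) (x : E3) : Fin 3 → E7 :=
  coordField (coordDomain I f y₀) (coordMap I f y₀) (F.coordFrame y₀) x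

omit [IsContMDiffRiemannianBundle (𝓡 7) ∞ E7 (fun x : M ↦ TangentSpace (𝓡 7) x)] in
lemma linearIndependent_coordFrame (y₀ : Y) : LinearIndependent ℝ (F.coordFrame y₀) :=
  LinearIndependent.of_comp (mfderiv I (𝓡 7) f y₀).toLinearMap (F.orthonormal_e y₀).linearIndependent

omit [IsContMDiffRiemannianBundle (𝓡 7) ∞ E7 (fun x : M ↦ TangentSpace (𝓡 7) x)] in
lemma exists_coordFrame_eq (y₀ : Y) (v : E3) : ∃ a : Fin 3 → ℝ, v = ∑ i, a i • F.coordFrame y₀ i := by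
  let b := basisOfLinearIndependentOfCardEqFinrank (F.linearIndependent_coordFrame y₀) (by simp)
  refine ⟨fun i ↦ b.repr v i, ?_⟩
  conv_lhs => rw [← b.sum_repr v]
  simp [b]

variable (hf : ContMDiff I (𝓡 7) ∞ f)
include hf

omit [IsContMDiffRiemannianBundle (𝓡 7) ∞ E7 (fun x : M ↦ TangentSpace (𝓡 7) x)] in
lemma toChart_mfderiv_sum (hy : y ∈ coordSource I f y₀) {v : TangentSpace I y} {a : Fin 3 → ℝ}
    (hv : subChart I y₀ y v = ∑ i, a i • F.coordFrame y₀ i) :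
    toChart (f y₀) (f y) (mfderiv I (𝓡 7) f y v) = ∑ i, a i • F.field y₀ (extChartAt I y₀ y) i := by
  rw [toChart_mfderiv hf hy, hv]
  simp [field, coordField]

omit [IsContMDiffRiemannianBundle (𝓡 7) ∞ E7 (fun x : M ↦ TangentSpace (𝓡 7) x)] in
lemma exists_toChart_mfderiv (hy : y ∈ coordSource I f y₀) (i : Fin 3) :
    ∃ v, toChart (f y₀) (f y) (mfderiv I (𝓡 7) f y v) = F.field y₀ (extChartAt I y₀ y) i := by
  obtain ⟨v, hv⟩ := subChart_surjective hy.1 (F.coordFrame y₀ i)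
  exact ⟨v, by rw [toChart_mfderiv hf hy, hv]; rfl⟩

variable (himm : ∀ y, Function.Injective (mfderiv I (𝓡 7) f y))
include himm

omit [RiemannianBundle (fun x : M ↦ TangentSpace (𝓡 7) x)]
  [IsContMDiffRiemannianBundle (𝓡 7) ∞ E7 (fun x : M ↦ TangentSpace (𝓡 7) x)] in
lemma injective_fderivWithin (hx : x ∈ coordDomain I f y₀) :
    Function.Injective (fderivWithin ℝ (coordMap I f y₀) (coordDomain I f y₀) x) := by
  obtain ⟨y, hy, rfl⟩ := exists_of_mem_coordDomain hx
  intro u v huv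
  obtain ⟨u, rfl⟩ := subChart_surjective hy.1 u
  obtain ⟨v, rfl⟩ := subChart_surjective hy.1 v
  rw [← toChart_mfderiv hf hy, ← toChart_mfderiv hf hy] at huv
  rw [himm y (toChart_injective hy.2 huv)]

lemma det_gramMatrix (hx : x ∈ coordDomain I f y₀) :
    (gramMatrix (metricInChart (f y₀)) (coordDomain I f y₀) (coordMap I f y₀)
      (F.coordFrame y₀) x).det ≠ 0 :=
  det_gramMatrix_ne_zero (isLocalMetric_metricInChart _) (isLocalMap_coordMap hf) hx
    (injective_fderivWithin hf himm hx) (F.linearIndependent_coordFrame y₀)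

/-- The tangential projection in coordinates. -/
lemma toChart_tangentProj (hy : y ∈ coordSource I f y₀) (X : TangentSpace (𝓡 7) (f y)) :
    toChart (f y₀) (f y) ((tangentPlane I f y).starProjection X)
      = gramProj (metricInChart (f y₀) (coordMap I f y₀ (extChartAt I y₀ y)))
        (F.coeff y₀ (extChartAt I y₀ y)) (F.field y₀ (extChartAt I y₀ y))
        (toChart (f y₀) (f y) X) := by
  have hx := extChartAt_mem_coordDomain hy
  rw [toChart_eq_iff hy.2]
  refine Submodule.eq_starProjection_of_mem_of_inner_eq_zero ?_ ?_
  · rw [gramProj, map_sum]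
    refine Submodule.sum_mem _ fun i _ ↦ ?_
    rw [map_smul]
    refine Submodule.smul_mem _ _ ?_
    obtain ⟨v, hv⟩ := F.exists_toChart_mfderiv hf hy i
    rw [← hv, ofChart_toChart hy.2]
    exact ⟨v, rfl⟩
  · rintro w ⟨v, rfl⟩
    obtain ⟨a, ha⟩ := F.exists_coordFrame_eq y₀ (subChart I y₀ y v)
    have h1 := inner_sub_gramProj (isLocalMetric_metricInChart (f y₀))
      (isLocalMap_coordMap (y₀ := y₀) hf) hx (F.det_gramMatrix hf himm hx)
      (toChart (f y₀) (f y) X)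
    rw [← metricInChart_toChart hy.2, map_sub, toChart_ofChart hy.2]
    have h2 := F.toChart_mfderiv_sum hf hy ha
    erw [h2]
    rw [map_sum]
    refine Finset.sum_eq_zero fun i _ ↦ ?_
    rw [map_smul, smul_eq_mul, ← coordMap_extChartAt hy]
    exact mul_eq_zero_of_right _ (h1 i)

lemma toChart_normalProj (hy : y ∈ coordSource I f y₀) (X : TangentSpace (𝓡 7) (f y)) :
    toChart (f y₀) (f y) ((normalSpace I f y).starProjection X)
      = toChart (f y₀) (f y) X
        - gramProj (metricInChart (f y₀) (coordMap I f y₀ (extChartAt I y₀ y)))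
        (F.coeff y₀ (extChartAt I y₀ y)) (F.field y₀ (extChartAt I y₀ y))
        (toChart (f y₀) (f y) X) := by
  rw [← F.toChart_tangentProj hf himm hy, ← map_sub]
  congr 1
  exact Submodule.starProjection_orthogonal_val X

/-- The normal connection in coordinates. -/
lemma toChart_normalDeriv (hy : y ∈ coordSource I f y₀)
    {s : (y : Y) → TangentSpace (𝓡 7) (f y)}
    (hs : ContDiffOn ℝ ∞ (coordVec I f y₀ s) (coordDomain I f y₀)) {v : TangentSpace I y}
    {a : Fin 3 → ℝ} (hv : subChart I y₀ y v = ∑ i, a i • F.coordFrame y₀ i) :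
    toChart (f y₀) (f y) (normalDeriv I f s y v)
      = ∑ i, a i • normalAlongDeriv (metricInChart (f y₀)) (coordDomain I f y₀) (coordMap I f y₀)
        (F.coordFrame y₀) (F.coeff y₀) (coordVec I f y₀ s) i (extChartAt I y₀ y) := by
  rw [normalDeriv, F.toChart_normalProj hf himm hy, toChart_covDeriv hf hy hs, hv,
    alongDeriv_sum_direction, gramProj_sum, ← Finset.sum_sub_distrib]
  refine Finset.sum_congr rfl fun i _ ↦ ?_
  rw [← smul_sub]
  rfl

lemma isAssociativePatch (hassoc : IsAssociative I f G) (y₀ : Y) :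
    IsAssociativePatch (metricInChart (f y₀)) (G.crossInChart (f y₀)) (coordMap I f y₀)
      (coordDomain I f y₀) (F.coordFrame y₀) (F.coeff y₀) (extChartAt I y₀ y₀) where
  mem := extChartAt_mem_coordDomain mem_coordSource_self
  contDiffOn := contDiffOn_gramMatrix_inv (isLocalMetric_metricInChart _)
    (isLocalMap_coordMap hf) (fun _ hx ↦ injective_fderivWithin hf himm hx)
    (F.linearIndependent_coordFrame y₀)
  inverse x hx := sum_gramMatrix_inv_mul (isLocalMetric_metricInChart _)
    (isLocalMap_coordMap hf) (F.det_gramMatrix hf himm hx)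
  stable x hx i j := by
    obtain ⟨y, hy, rfl⟩ := exists_of_mem_coordDomain hx
    obtain ⟨u, hu⟩ := F.exists_toChart_mfderiv hf hy i
    obtain ⟨v, hv⟩ := F.exists_toChart_mfderiv hf hy j
    have hmem : G.cross (f y) (mfderiv I (𝓡 7) f y u) (mfderiv I (𝓡 7) f y v)
        ∈ tangentPlane I f y := hassoc y _ ⟨u, rfl⟩ _ ⟨v, rfl⟩
    have h1 := F.toChart_tangentProj hf himm hy
      (G.cross (f y) (mfderiv I (𝓡 7) f y u) (mfderiv I (𝓡 7) f y v))
    rw [Submodule.starProjection_eq_self_iff.2 hmem,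
      ← G.crossInChart_toChart hy.2, hu, hv, ← coordMap_extChartAt hy] at h1
    exact h1.symm
  frame := by
    have hy := mem_coordSource_self (I := I) (f := f) (y₀ := y₀)
    have ht : ∀ i, coordField (coordDomain I f y₀) (coordMap I f y₀) (F.coordFrame y₀)
        (extChartAt I y₀ y₀) i = toChart (f y₀) (f y₀) (F.df y₀ i) := fun i ↦ by
      rw [df, toChart_mfderiv hf hy, subChart_self]
      rfl
    refine ⟨fun i j ↦ ?_, ?_⟩
    · rw [ht, ht, coordMap_extChartAt hy, metricInChart_toChart hy.2]
      exact orthonormal_iff_ite.1 (F.orthonormal_e y₀) i j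
    · rw [ht, ht, ht, coordMap_extChartAt hy, G.crossInChart_toChart hy.2]
      exact congrArg _ (F.cross_e y₀).symm

end AdaptedFrame

end

/-! ### The deformation operator in coordinates -/

section

variable {M : Type*} [TopologicalSpace M] [ChartedSpace E7 M] [IsManifold (𝓡 7) ∞ M]
  [RiemannianBundle (fun x : M ↦ TangentSpace (𝓡 7) x)]
  {G : G2Structure M} {H : Type*} [TopologicalSpace H] {I : ModelWithCorners ℝ E3 H}
  {Y : Type*} [TopologicalSpace Y] [ChartedSpace H Y] [IsManifold I ∞ Y]
  {f : Y → M} {y₀ y : Y} {x : E3}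

/-- The product of a tangent and a normal vector of an associative submanifold is normal. -/
lemma IsAssociative.cross_mem_normalSpace (hassoc : IsAssociative I f G)
    {u n : TangentSpace (𝓡 7) (f y)} (hu : u ∈ tangentPlane I f y) (hn : n ∈ normalSpace I f y) :
    G.cross (f y) u n ∈ normalSpace I f y := by
  rw [normalSpace, Submodule.mem_orthogonal']
  intro w hw
  rw [G.inner_cross, G.form_antisymm', ← G.inner_cross, neg_eq_zero]
  exact (Submodule.mem_orthogonal _ _).1 hn _ (hassoc y _ hu _ hw)

namespace AdaptedFrame

variable (F : AdaptedFrame I f G)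

/-- The projection to the normal space in terms of an orthonormal basis. -/
lemma starProjection_normalSpace (himm : ∀ y, Function.Injective (mfderiv I (𝓡 7) f y))
    (y : Y) (X : TangentSpace (𝓡 7) (f y)) :
    (normalSpace I f y).starProjection X = ∑ k, inner ℝ (F.η y k) X • F.η y k := by
  have hdim : Module.finrank ℝ (tangentPlane I f y) = 3 := by
    rw [tangentPlane, LinearMap.finrank_range_of_inj (himm y)]
    exact finrank_euclideanSpace_fin
  have h7 : Module.finrank ℝ (TangentSpace (𝓡 7) (f y)) = 7 := finrank_euclideanSpace_fin
  have hdim' : Fintype.card (Fin 4) = Module.finrank ℝ (normalSpace I f y) := by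
    have := (tangentPlane I f y).finrank_add_finrank_orthogonal
    rw [normalSpace, Fintype.card_fin]
    omega
  let η : Fin 4 → normalSpace I f y := fun k ↦ ⟨F.η y k, F.normal_η y k⟩
  have hη : Orthonormal ℝ η := by
    rw [orthonormal_iff_ite]
    exact orthonormal_iff_ite.1 (F.orthonormal_η y)
  let b := basisOfLinearIndependentOfCardEqFinrank hη.linearIndependent hdim'
  have hη' := orthonormal_iff_ite.1 (F.orthonormal_η y)
  refine Submodule.eq_starProjection_of_mem_of_inner_eq_zero
    (Submodule.sum_mem _ fun k _ ↦ Submodule.smul_mem _ _ (F.normal_η y k)) fun w hw ↦ ?_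
  have h1 : w = ∑ k, b.repr ⟨w, hw⟩ k • F.η y k := by
    have h2 := congrArg Subtype.val (b.sum_repr ⟨w, hw⟩)
    rw [Submodule.coe_sum] at h2
    simpa [b, η] using h2.symm
  rw [h1, inner_sum]
  refine Finset.sum_eq_zero fun k _ ↦ ?_
  rw [inner_smul_right, inner_sub_left, sum_inner]
  simp only [real_inner_smul_left, hη', mul_ite, mul_one, mul_zero, Finset.sum_ite_eq',
    Finset.mem_univ, if_true]
  rw [real_inner_comm, sub_self, mul_zero]

variable [IsContMDiffRiemannianBundle (𝓡 7) ∞ E7 (fun x : M ↦ TangentSpace (𝓡 7) x)]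

/-- For a torsion-free structure, `∇⋆φ = 0`, and the deformation operator is a Dirac operator. -/
lemma D_eq (hG : G.IsTorsionFree) (s : (y : Y) → TangentSpace (𝓡 7) (f y)) (y : Y) :
    F.D s y = ∑ i, G.cross (f y) (F.df y i) (normalDeriv I f s y (F.e y i)) := by
  simp [D, hG.covDerivForm_starForm]

lemma D_mem_normalSpace (hG : G.IsTorsionFree) (hassoc : IsAssociative I f G)
    (s : (y : Y) → TangentSpace (𝓡 7) (f y)) (y : Y) : F.D s y ∈ normalSpace I f y := by
  rw [F.D_eq hG]
  exact Submodule.sum_mem _ fun i _ ↦ hassoc.cross_mem_normalSpace ⟨_, rfl⟩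
    (Submodule.starProjection_apply_mem _ _)

variable (hf : ContMDiff I (𝓡 7) ∞ f) (himm : ∀ y, Function.Injective (mfderiv I (𝓡 7) f y))
  {s : (y : Y) → TangentSpace (𝓡 7) (f y)}
  (hs : ContDiffOn ℝ ∞ (coordVec I f y₀ s) (coordDomain I f y₀))
include hf himm hs

/-- The deformation operator in coordinates. The formula with the inverse of the Gram matrix
does not depend on the choice of an orthonormal frame. -/
lemma toChart_D (hG : G.IsTorsionFree) (hy : y ∈ coordSource I f y₀) :
    toChart (f y₀) (f y) (F.D s y) = coordDirac (metricInChart (f y₀)) (G.crossInChart (f y₀))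
      (coordDomain I f y₀) (coordMap I f y₀) (F.coordFrame y₀) (F.coeff y₀) (coordVec I f y₀ s)
      (extChartAt I y₀ y) := by
  have hx := extChartAt_mem_coordDomain hy
  -- the orthonormal frame at `y` is `m` times the frame at `y₀`, whose Gram matrix `h` satisfies
  -- `m h mᵀ = 1`
  choose m hm using fun i ↦ F.exists_coordFrame_eq y₀ (subChart I y₀ y (F.e y i))
  have ht := fun i ↦ F.toChart_mfderiv_sum hf hy (hm i)
  have hc : ∀ j k, F.coeff y₀ (extChartAt I y₀ y) j k = ∑ i, m i j * m i k := by
    let h := gramMatrix (metricInChart (f y₀)) (coordDomain I f y₀) (coordMap I f y₀)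
      (F.coordFrame y₀) (extChartAt I y₀ y)
    have h1 : (Matrix.of m * h) * (Matrix.of m).transpose = 1 := by
      ext i l
      have h2 := orthonormal_iff_ite.1 (F.orthonormal_e y) i l
      rw [← metricInChart_toChart hy.2] at h2
      erw [ht i, ht l] at h2
      rw [Matrix.one_apply, ← h2]
      simp only [Matrix.mul_apply, Matrix.transpose_apply, Matrix.of_apply, h, gramMatrix,
        coordMap_extChartAt hy, map_sum, map_smul, _root_.sum_apply, _root_.smul_apply,
        smul_eq_mul, Finset.sum_mul, Finset.mul_sum, field]
      exact Finset.sum_congr rfl fun j _ ↦ Finset.sum_congr rfl fun k _ ↦ by ring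
    have h3 : ((Matrix.of m).transpose * Matrix.of m) * h = 1 := by
      rw [Matrix.mul_assoc]
      exact mul_eq_one_comm.1 h1
    intro j k
    have h4 := congrFun (congrFun (Matrix.inv_eq_left_inv h3) j) k
    exact h4.trans (by simp [Matrix.mul_apply])
  rw [F.D_eq hG, map_sum, coordDirac]
  have h5 : ∀ i, toChart (f y₀) (f y) (G.cross (f y) (F.df y i) (normalDeriv I f s y (F.e y i)))
      = ∑ j, ∑ k, (m i j * m i k) • G.crossInChart (f y₀) (coordMap I f y₀ (extChartAt I y₀ y))
        (F.field y₀ (extChartAt I y₀ y) j) (normalAlongDeriv (metricInChart (f y₀))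
          (coordDomain I f y₀) (coordMap I f y₀) (F.coordFrame y₀) (F.coeff y₀)
          (coordVec I f y₀ s) k (extChartAt I y₀ y)) := by
    intro i
    rw [← G.crossInChart_toChart hy.2, F.toChart_normalDeriv hf himm hy hs (hm i), df]
    erw [ht i]
    rw [coordMap_extChartAt hy]
    simp only [map_sum, map_smul, _root_.sum_apply, _root_.smul_apply, Finset.smul_sum, smul_smul]
    rw [Finset.sum_comm]
    exact Finset.sum_congr rfl fun j _ ↦ Finset.sum_congr rfl fun k _ ↦ by rw [mul_comm]
  simp only [h5, hc, Finset.sum_smul]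
  rw [Finset.sum_comm]
  refine Finset.sum_congr rfl fun j _ ↦ ?_
  rw [Finset.sum_comm]
  rfl

lemma coordVec_D (hG : G.IsTorsionFree) : Set.EqOn (coordVec I f y₀ (F.D s))
    (coordDirac (metricInChart (f y₀)) (G.crossInChart (f y₀))
      (coordDomain I f y₀) (coordMap I f y₀) (F.coordFrame y₀) (F.coeff y₀) (coordVec I f y₀ s))
    (coordDomain I f y₀) := by
  intro x hx
  obtain ⟨y, hy, rfl⟩ := exists_of_mem_coordDomain hx
  rw [coordVec_extChartAt hy, F.toChart_D hf himm hs hG hy]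

lemma contDiffOn_coordVec_D (hG : G.IsTorsionFree) (hassoc : IsAssociative I f G) :
    ContDiffOn ℝ ∞ (coordVec I f y₀ (F.D s)) (coordDomain I f y₀) :=
  ((F.isAssociativePatch hf himm hassoc y₀).contDiffOn_coordDirac (isLocalMetric_metricInChart _)
    (isLocalMap_coordMap hf) (hG.isParallelProduct _) hs).congr (F.coordVec_D hf himm hs hG)

end AdaptedFrame

end

/-! ### The Laplacian, the partial Ricci operator and Simons' operator in coordinates -/

section

variable {M : Type*} [TopologicalSpace M] [ChartedSpace E7 M] [IsManifold (𝓡 7) ∞ M]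
  [RiemannianBundle (fun x : M ↦ TangentSpace (𝓡 7) x)]
  [IsContMDiffRiemannianBundle (𝓡 7) ∞ E7 (fun x : M ↦ TangentSpace (𝓡 7) x)]
  {G : G2Structure M} {H : Type*} [TopologicalSpace H] {I : ModelWithCorners ℝ E3 H}
  {Y : Type*} [TopologicalSpace Y] [ChartedSpace H Y] [IsManifold I ∞ Y]
  {f : Y → M} {y₀ y : Y} {x : E3}

namespace AdaptedFrame

variable (F : AdaptedFrame I f G)

/-- The covariant derivative at `y₀`, along the vector `e_i` of the frame, of a vector field in
coordinates. -/
abbrev frameDeriv (y₀ : Y) (i : Fin 3) (ξ : E3 → E7) : E7 :=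
  alongDeriv (metricInChart (f y₀)) (coordDomain I f y₀) (coordMap I f y₀) (F.coordFrame y₀ i) ξ
    (extChartAt I y₀ y₀)

/-- The metric at `f y₀` in coordinates. -/
abbrev frameMetric (_ : AdaptedFrame I f G) (y₀ : Y) : E7 →L[ℝ] E7 →L[ℝ] ℝ :=
  metricInChart (f y₀) (coordMap I f y₀ (extChartAt I y₀ y₀))

/-- The normal projection at `y₀` in coordinates. -/
abbrev frameProj (y₀ : Y) : E7 →ₗ[ℝ] E7 :=
  normalProj (F.frameMetric y₀) (F.field y₀ (extChartAt I y₀ y₀))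

/-- The normal derivative along a coordinate vector field of the frame. -/
abbrev normalField (y₀ : Y) (i : Fin 3) (ξ : E3 → E7) : E3 → E7 :=
  normalAlongDeriv (metricInChart (f y₀)) (coordDomain I f y₀) (coordMap I f y₀)
    (F.coordFrame y₀) (F.coeff y₀) ξ i

variable (hf : ContMDiff I (𝓡 7) ∞ f)

omit [IsContMDiffRiemannianBundle (𝓡 7) ∞ E7 (fun x : M ↦ TangentSpace (𝓡 7) x)] in
lemma frameMetric_toChart (y₀ : Y) (u v : TangentSpace (𝓡 7) (f y₀)) :
    F.frameMetric y₀ (toChart (f y₀) (f y₀) u) (toChart (f y₀) (f y₀) v) = inner ℝ u v := by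
  have hy := mem_coordSource_self (I := I) (f := f) (y₀ := y₀)
  rw [frameMetric, coordMap_extChartAt hy, metricInChart_toChart hy.2]

omit [IsContMDiffRiemannianBundle (𝓡 7) ∞ E7 (fun x : M ↦ TangentSpace (𝓡 7) x)] in
lemma subChart_extend_e (hy : y ∈ (extChartAt I y₀).source) (i : Fin 3) :
    subChart I y₀ y (FiberBundle.extend E3 (F.e y₀ i) y)
      = ∑ j, (Pi.single i (1 : ℝ) : Fin 3 → ℝ) j • F.coordFrame y₀ j := by
  have h : ∀ w : Fin 3 → E3, w i = ∑ j, (Pi.single i (1 : ℝ) : Fin 3 → ℝ) j • w j := fun w ↦ by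
    simp [Pi.single_apply]
  rw [subChart_extend hy]
  exact h (F.coordFrame y₀)

include hf

omit [IsContMDiffRiemannianBundle (𝓡 7) ∞ E7 (fun x : M ↦ TangentSpace (𝓡 7) x)] in
lemma field_self (i : Fin 3) :
    F.field y₀ (extChartAt I y₀ y₀) i = toChart (f y₀) (f y₀) (F.df y₀ i) := by
  rw [df, toChart_mfderiv hf mem_coordSource_self, subChart_self]
  rfl

lemma toChart_covDeriv_self {s : (y : Y) → TangentSpace (𝓡 7) (f y)}
    (hs : ContDiffOn ℝ ∞ (coordVec I f y₀ s) (coordDomain I f y₀)) (i : Fin 3) :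
    toChart (f y₀) (f y₀) (covDeriv I f s y₀ (F.e y₀ i))
      = F.frameDeriv y₀ i (coordVec I f y₀ s) := by
  rw [toChart_covDeriv hf mem_coordSource_self hs, subChart_self]
  rfl

omit [IsContMDiffRiemannianBundle (𝓡 7) ∞ E7 (fun x : M ↦ TangentSpace (𝓡 7) x)] in
lemma coordVec_extend_e (i : Fin 3) :
    Set.EqOn (coordVec I f y₀ fun y ↦ mfderiv I (𝓡 7) f y (FiberBundle.extend E3 (F.e y₀ i) y))
      (fun x ↦ coordField (coordDomain I f y₀) (coordMap I f y₀) (F.coordFrame y₀) x i)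
      (coordDomain I f y₀) := by
  intro x hx
  obtain ⟨y, hy, rfl⟩ := exists_of_mem_coordDomain hx
  rw [coordVec_extChartAt hy]
  erw [F.toChart_mfderiv_sum hf hy (F.subChart_extend_e hy.1 i)]
  simp [Pi.single_apply, field]

lemma inner_covDeriv_extend_e (i k a : Fin 3) :
    inner ℝ (covDeriv I f (fun y ↦ mfderiv I (𝓡 7) f y (FiberBundle.extend E3 (F.e y₀ i) y)) y₀
      (F.e y₀ k)) (F.df y₀ a)
      = F.frameMetric y₀ (F.frameDeriv y₀ k fun x ↦ coordField (coordDomain I f y₀)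
          (coordMap I f y₀) (F.coordFrame y₀) x i) (F.field y₀ (extChartAt I y₀ y₀) a) := by
  have h := F.coordVec_extend_e (y₀ := y₀) hf i
  have hs := ((isLocalMap_coordMap (y₀ := y₀) hf).contDiffOn_coordField
    (e := F.coordFrame y₀) i).congr h
  rw [← F.frameMetric_toChart, F.toChart_covDeriv_self hf hs, F.field_self hf, frameDeriv,
    alongDeriv_congr h (extChartAt_mem_coordDomain mem_coordSource_self)]

variable (himm : ∀ y, Function.Injective (mfderiv I (𝓡 7) f y))
include himm

lemma coordVec_normalDeriv_extend_e {s : (y : Y) → TangentSpace (𝓡 7) (f y)}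
    (hs : ContDiffOn ℝ ∞ (coordVec I f y₀ s) (coordDomain I f y₀)) (i : Fin 3) :
    Set.EqOn (coordVec I f y₀ fun y ↦ normalDeriv I f s y (FiberBundle.extend E3 (F.e y₀ i) y))
      (F.normalField y₀ i (coordVec I f y₀ s)) (coordDomain I f y₀) := by
  intro x hx
  obtain ⟨y, hy, rfl⟩ := exists_of_mem_coordDomain hx
  rw [coordVec_extChartAt hy, F.toChart_normalDeriv hf himm hy hs (F.subChart_extend_e hy.1 i)]
  simp [Pi.single_apply]

variable (hassoc : IsAssociative I f G)
include hassoc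

lemma toChart_normalProj_self (X : TangentSpace (𝓡 7) (f y₀)) :
    toChart (f y₀) (f y₀) ((normalSpace I f y₀).starProjection X)
      = F.frameProj y₀ (toChart (f y₀) (f y₀) X) := by
  rw [F.toChart_normalProj hf himm mem_coordSource_self]
  exact (F.isAssociativePatch hf himm hassoc y₀).gramProj_self _

lemma toChart_tangentProj_self (X : TangentSpace (𝓡 7) (f y₀)) :
    toChart (f y₀) (f y₀) ((tangentPlane I f y₀).starProjection X)
      = ∑ a, F.frameMetric y₀ (toChart (f y₀) (f y₀) X) (F.field y₀ (extChartAt I y₀ y₀) a)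
        • F.field y₀ (extChartAt I y₀ y₀) a := by
  have h1 : (normalSpace I f y₀).starProjection X = X - (tangentPlane I f y₀).starProjection X :=
    Submodule.starProjection_orthogonal_val X
  rw [← sub_sub_cancel X ((tangentPlane I f y₀).starProjection X), ← h1, map_sub, F.toChart_normalProj_self hf himm hassoc, frameProj, normalProj_apply,
    sub_sub_cancel]

lemma toChart_normalDeriv_self {s : (y : Y) → TangentSpace (𝓡 7) (f y)}
    (hs : ContDiffOn ℝ ∞ (coordVec I f y₀ s) (coordDomain I f y₀)) (i : Fin 3) :
    toChart (f y₀) (f y₀) (normalDeriv I f s y₀ (F.e y₀ i))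
      = F.frameProj y₀ (F.frameDeriv y₀ i (coordVec I f y₀ s)) := by
  rw [normalDeriv, F.toChart_normalProj_self hf himm hassoc, F.toChart_covDeriv_self hf hs]

lemma toChart_secondDeriv {s : (y : Y) → TangentSpace (𝓡 7) (f y)}
    (hs : ContDiffOn ℝ ∞ (coordVec I f y₀ s) (coordDomain I f y₀)) (i k : Fin 3) :
    toChart (f y₀) (f y₀) (F.secondDeriv s y₀ (F.e y₀ k) (F.e y₀ i))
      = F.frameProj y₀ (F.frameDeriv y₀ k (F.normalField y₀ i (coordVec I f y₀ s)))
        - ∑ a, F.frameMetric y₀ (F.frameDeriv y₀ k fun x ↦ coordField (coordDomain I f y₀)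
          (coordMap I f y₀) (F.coordFrame y₀) x i) (F.field y₀ (extChartAt I y₀ y₀) a)
          • F.normalField y₀ a (coordVec I f y₀ s) (extChartAt I y₀ y₀) := by
  have hP := F.isAssociativePatch hf himm hassoc y₀
  have h := F.coordVec_normalDeriv_extend_e hf himm hs i
  have h' := (hP.contDiffOn_normalAlongDeriv (isLocalMetric_metricInChart _)
    (isLocalMap_coordMap hf) hs i).congr h
  have h1 : subChart I y₀ y₀ (F.tangentDeriv (FiberBundle.extend E3 (F.e y₀ i)) y₀ (F.e y₀ k))
      = ∑ a, F.frameMetric y₀ (F.frameDeriv y₀ k fun x ↦ coordField (coordDomain I f y₀)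
          (coordMap I f y₀) (F.coordFrame y₀) x i) (F.field y₀ (extChartAt I y₀ y₀) a)
          • F.coordFrame y₀ a := by
    rw [subChart_self, tangentDeriv]
    refine Finset.sum_congr rfl fun a _ ↦ ?_
    rw [F.inner_covDeriv_extend_e hf]
    rfl
  rw [secondDeriv, map_sub, F.toChart_normalDeriv hf himm mem_coordSource_self hs h1,
    F.toChart_normalDeriv_self hf himm hassoc h']
  congr 2
  exact alongDeriv_congr h hP.mem _

lemma toChart_partialRicci (s : (y : Y) → TangentSpace (𝓡 7) (f y)) :
    toChart (f y₀) (f y₀) (F.partialRicci s y₀)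
      = F.frameProj y₀ (∑ i, coordCurvature (metricInChart (f y₀))
        (coordMap I f y₀ (extChartAt I y₀ y₀)) (F.field y₀ (extChartAt I y₀ y₀) i)
        (coordVec I f y₀ s (extChartAt I y₀ y₀)) (F.field y₀ (extChartAt I y₀ y₀) i)) := by
  rw [partialRicci, F.toChart_normalProj_self hf himm hassoc, map_sum]
  congr 1
  refine Finset.sum_congr rfl fun i _ ↦ ?_
  have hy := mem_coordSource_self (I := I) (f := f) (y₀ := y₀)
  rw [curvature, toChart_ofChart hy.2, F.field_self hf, coordMap_extChartAt hy,
    coordVec_extChartAt hy]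

lemma toChart_shape {s : (y : Y) → TangentSpace (𝓡 7) (f y)}
    (hs : ContDiffOn ℝ ∞ (coordVec I f y₀ s) (coordDomain I f y₀)) (i : Fin 3) :
    toChart (f y₀) (f y₀) (shape I f s y₀ (F.e y₀ i))
      = -∑ a, F.frameMetric y₀ (F.frameDeriv y₀ i (coordVec I f y₀ s))
        (F.field y₀ (extChartAt I y₀ y₀) a) • F.field y₀ (extChartAt I y₀ y₀) a := by
  rw [shape, map_neg, F.toChart_tangentProj_self hf himm hassoc, F.toChart_covDeriv_self hf hs]

lemma inner_shape {s t : (y : Y) → TangentSpace (𝓡 7) (f y)}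
    (hs : ContDiffOn ℝ ∞ (coordVec I f y₀ s) (coordDomain I f y₀))
    (ht : ContDiffOn ℝ ∞ (coordVec I f y₀ t) (coordDomain I f y₀)) (i : Fin 3) :
    inner ℝ (shape I f s y₀ (F.e y₀ i)) (shape I f t y₀ (F.e y₀ i))
      = ∑ a, F.frameMetric y₀ (F.frameDeriv y₀ i (coordVec I f y₀ s))
          (F.field y₀ (extChartAt I y₀ y₀) a)
        * F.frameMetric y₀ (F.frameDeriv y₀ i (coordVec I f y₀ t))
          (F.field y₀ (extChartAt I y₀ y₀) a) := by
  have h : ∀ b a, F.frameMetric y₀ (F.field y₀ (extChartAt I y₀ y₀) b)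
      (F.field y₀ (extChartAt I y₀ y₀) a) = if b = a then 1 else 0 :=
    (F.isAssociativePatch hf himm hassoc y₀).frame.orthonormal
  rw [← F.frameMetric_toChart, F.toChart_shape hf himm hassoc hs, F.toChart_shape hf himm hassoc ht]
  simp only [map_neg, _root_.neg_apply, map_sum, map_smul, _root_.sum_apply,
    _root_.smul_apply, smul_eq_mul, h]
  simp [mul_comm]

omit [IsContMDiffRiemannianBundle (𝓡 7) ∞ E7 (fun x : M ↦ TangentSpace (𝓡 7) x)]
  [RiemannianBundle (fun x : M ↦ TangentSpace (𝓡 7) x)] F hf himm hassoc in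
lemma toChart_extend (hy : y ∈ coordSource I f y₀) (η : TangentSpace (𝓡 7) (f y₀)) :
    toChart (f y₀) (f y) (FiberBundle.extend E7 η (f y)) = toChart (f y₀) (f y₀) η := by
  have hb := hy.2
  rw [Set.mem_preimage, extChartAt_source] at hb
  let t := trivializationAt E7 (TangentSpace (𝓡 7) : M → Type _) (f y₀)
  have h0 : f y₀ ∈ t.baseSet := FiberBundle.mem_baseSet_trivializationAt' (f y₀)
  have h1 : FiberBundle.extend E7 η (f y) = t.symmL ℝ (f y) (t ⟨f y₀, η⟩).2 :=
    (t.symmL_apply (R := ℝ) hb _).symm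
  rw [h1]
  exact (t.continuousLinearMapAt_symmL (R := ℝ) hb _).trans
    (t.continuousLinearMapAt_apply_of_mem ℝ h0 η).symm

omit hassoc in
lemma coordVec_normalExtend (η : TangentSpace (𝓡 7) (f y₀)) :
    Set.EqOn (coordVec I f y₀ (normalExtend I f y₀ η))
      (fun x ↦ toChart (f y₀) (f y₀) η - gramProj (metricInChart (f y₀) (coordMap I f y₀ x))
        (F.coeff y₀ x) (F.field y₀ x) (toChart (f y₀) (f y₀) η)) (coordDomain I f y₀) := by
  intro x hx
  obtain ⟨y, hy, rfl⟩ := exists_of_mem_coordDomain hx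
  rw [coordVec_extChartAt hy, normalExtend, F.toChart_normalProj hf himm hy, toChart_extend hy]

include F in
lemma contDiffOn_coordVec_normalExtend (η : TangentSpace (𝓡 7) (f y₀)) :
    ContDiffOn ℝ ∞ (coordVec I f y₀ (normalExtend I f y₀ η)) (coordDomain I f y₀) :=
  (contDiffOn_const.sub ((F.isAssociativePatch hf himm hassoc y₀).contDiffOn_gramProj
    (isLocalMetric_metricInChart _) (isLocalMap_coordMap hf) contDiffOn_const)).congr
    (F.coordVec_normalExtend hf himm η)

/-- The Weingarten equation. It follows from differentiating `⟨η, tₐ⟩ = 0`, where `η` stands for the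
extension of the given normal vector to a normal field. -/
lemma frameMetric_frameDeriv_normalExtend {η : TangentSpace (𝓡 7) (f y₀)}
    (hη : η ∈ normalSpace I f y₀) (i a : Fin 3) :
    F.frameMetric y₀ (F.frameDeriv y₀ i (coordVec I f y₀ (normalExtend I f y₀ η)))
        (F.field y₀ (extChartAt I y₀ y₀) a)
      = -F.frameMetric y₀ (toChart (f y₀) (f y₀) η) (F.frameDeriv y₀ i fun x ↦
        coordField (coordDomain I f y₀) (coordMap I f y₀) (F.coordFrame y₀) x a) := by
  have hg := isLocalMetric_metricInChart (f y₀)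
  have hγ := isLocalMap_coordMap (y₀ := y₀) hf
  have hx := extChartAt_mem_coordDomain (mem_coordSource_self (I := I) (f := f) (y₀ := y₀))
  have h0 : coordVec I f y₀ (normalExtend I f y₀ η) (extChartAt I y₀ y₀)
      = toChart (f y₀) (f y₀) η := by
    rw [coordVec_extChartAt mem_coordSource_self, normalExtend,
      FiberBundle.extend_apply_self, Submodule.starProjection_eq_self_iff.2 hη]
  have h1 := hg.fderivWithin_metric hγ (F.contDiffOn_coordVec_normalExtend hf himm hassoc η)
    (hγ.contDiffOn_coordField (e := F.coordFrame y₀) a) hx (F.coordFrame y₀ i)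
  have h2 : Set.EqOn (fun x ↦ metricInChart (f y₀) (coordMap I f y₀ x)
      (coordVec I f y₀ (normalExtend I f y₀ η) x)
      (coordField (coordDomain I f y₀) (coordMap I f y₀) (F.coordFrame y₀) x a)) (fun _ ↦ 0)
      (coordDomain I f y₀) := by
    intro x hx
    simp only [F.coordVec_normalExtend hf himm η hx]
    exact inner_sub_gramProj hg hγ hx (F.det_gramMatrix hf himm hx) _ a
  rw [fderivWithin_congr h2 (h2 hx), h0] at h1
  simp only [fderivWithin_fun_const, Pi.zero_apply, _root_.zero_apply] at h1
  exact eq_neg_of_add_eq_zero_left h1.symm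

/-- Simons' operator is `∑ᵢₐ ⟨A(s) eᵢ, eₐ⟩ B(eᵢ, eₐ)`, where `B` is the second fundamental form
with values in the normal space. -/
lemma toChart_simons {s : (y : Y) → TangentSpace (𝓡 7) (f y)}
    (hs : ContDiffOn ℝ ∞ (coordVec I f y₀ s) (coordDomain I f y₀)) :
    toChart (f y₀) (f y₀) (F.simons s y₀)
      = -∑ i, ∑ a, F.frameMetric y₀ (F.frameDeriv y₀ i (coordVec I f y₀ s))
          (F.field y₀ (extChartAt I y₀ y₀) a)
        • F.frameProj y₀ (F.frameDeriv y₀ i fun x ↦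
          coordField (coordDomain I f y₀) (coordMap I f y₀) (F.coordFrame y₀) x a) := by
  have hy := mem_coordSource_self (I := I) (f := f) (y₀ := y₀)
  -- the normal projection in the orthonormal frame `ηₖ`
  have hn : ∀ X : E7, ∑ k, F.frameMetric y₀ (toChart (f y₀) (f y₀) (F.η y₀ k)) X
      • toChart (f y₀) (f y₀) (F.η y₀ k) = F.frameProj y₀ X := by
    intro X
    rw [← toChart_ofChart hy.2 X, ← F.toChart_normalProj_self hf himm hassoc,
      F.starProjection_normalSpace himm, map_sum]
    refine Finset.sum_congr rfl fun k _ ↦ ?_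
    rw [F.frameMetric_toChart, map_smul]
  have hk : ∀ k i, inner ℝ (shape I f s y₀ (F.e y₀ i))
      (shape I f (normalExtend I f y₀ (F.η y₀ k)) y₀ (F.e y₀ i))
      = -∑ a, F.frameMetric y₀ (F.frameDeriv y₀ i (coordVec I f y₀ s))
          (F.field y₀ (extChartAt I y₀ y₀) a)
        * F.frameMetric y₀ (toChart (f y₀) (f y₀) (F.η y₀ k)) (F.frameDeriv y₀ i fun x ↦
          coordField (coordDomain I f y₀) (coordMap I f y₀) (F.coordFrame y₀) x a) := by
    intro k i
    rw [F.inner_shape hf himm hassoc hs (F.contDiffOn_coordVec_normalExtend hf himm hassoc _),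
      ← Finset.sum_neg_distrib]
    refine Finset.sum_congr rfl fun a _ ↦ ?_
    rw [F.frameMetric_frameDeriv_normalExtend hf himm hassoc (F.normal_η y₀ k), mul_neg]
  simp only [simons, shapeTranspose, hk, map_neg, map_sum, map_smul, Finset.sum_neg_distrib, neg_smul,
    Finset.sum_smul, ← hn, Finset.smul_sum, smul_smul]
  rw [Finset.sum_comm, neg_inj]
  refine Finset.sum_congr rfl fun i _ ↦ ?_
  rw [Finset.sum_comm]

/-- The Weitzenböck formula for the deformation operator. -/
theorem D_D_eq (hG : G.IsTorsionFree) {s : (y : Y) → TangentSpace (𝓡 7) (f y)}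
    (hs : ContDiffOn ℝ ∞ (coordVec I f y₀ s) (coordDomain I f y₀)) :
    F.D (F.D s) y₀ = F.laplacian s y₀ + F.partialRicci s y₀ - F.simons s y₀ := by
  have hy := mem_coordSource_self (I := I) (f := f) (y₀ := y₀)
  have hP := F.isAssociativePatch hf himm hassoc y₀
  have hD := F.coordVec_D hf himm hs hG
  have h1 : ∀ i, toChart (f y₀) (f y₀) (G.cross (f y₀) (F.df y₀ i)
      (normalDeriv I f (F.D s) y₀ (F.e y₀ i)))
      = G.crossInChart (f y₀) (coordMap I f y₀ (extChartAt I y₀ y₀))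
        (F.field y₀ (extChartAt I y₀ y₀) i) (F.frameProj y₀ (F.frameDeriv y₀ i
          (coordDirac (metricInChart (f y₀)) (G.crossInChart (f y₀)) (coordDomain I f y₀)
            (coordMap I f y₀) (F.coordFrame y₀) (F.coeff y₀) (coordVec I f y₀ s)))) := by
    intro i
    rw [← G.crossInChart_toChart hy.2, ← F.field_self hf, coordMap_extChartAt hy,
      F.toChart_normalDeriv_self hf himm hassoc (F.contDiffOn_coordVec_D hf himm hs hG hassoc)]
    congr 2
    exact alongDeriv_congr hD hP.mem _
  have h2 := hP.sum_cross_normalProj_alongDeriv_coordDirac (isLocalMetric_metricInChart (f y₀))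
    (isLocalMap_coordMap hf) (hG.isParallelProduct (f y₀))
    (fun z hz ↦ G.isCrossProduct_crossInChart hz) finrank_euclideanSpace_fin hs
  apply toChart_injective hy.2
  rw [F.D_eq hG, map_sum, map_sub, map_add, laplacian, map_neg, map_sum]
  simp only [h1, F.toChart_secondDeriv hf himm hassoc hs]
  rw [F.toChart_partialRicci hf himm hassoc, F.toChart_simons hf himm hassoc hs, sub_neg_eq_add]
  exact h2

end AdaptedFrame

end

end AssocGeom

end

theorem mainTheorem4
    {M : Type*} [TopologicalSpace M] [ChartedSpace (EuclideanSpace ℝ (Fin 7)) M]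
    [IsManifold (𝓡 7) ∞ M] [RiemannianBundle (fun x : M ↦ TangentSpace (𝓡 7) x)]
    [IsContMDiffRiemannianBundle (𝓡 7) ∞ (EuclideanSpace ℝ (Fin 7))
      (fun x : M ↦ TangentSpace (𝓡 7) x)]
    (G : AssocGeom.G2Structure M) (hG : G.IsTorsionFree)
    {H : Type*} [TopologicalSpace H] (I : ModelWithCorners ℝ (EuclideanSpace ℝ (Fin 3)) H)
    {Y : Type*} [TopologicalSpace Y] [ChartedSpace H Y] [IsManifold I ∞ Y]
    (f : Y → M) (hf : ContMDiff I (𝓡 7) ∞ f)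
    (himm : ∀ y, Function.Injective (mfderiv I (𝓡 7) f y))
    (hassoc : AssocGeom.IsAssociative I f G)
    (F : AssocGeom.AdaptedFrame I f G)
    (s : (y : Y) → TangentSpace (𝓡 7) (f y)) (hs : AssocGeom.IsNormalSection I f s) :
    AssocGeom.IsNormalSection I f (F.D s) ∧
      ∀ y, F.D (F.D s) y = F.laplacian s y + F.partialRicci s y - F.simons s y := by
  have hs' := fun y₀ ↦ AssocGeom.contDiffOn_coordVec (y₀ := y₀) hs.smooth
  exact ⟨⟨AssocGeom.contMDiff_of_coordVec hf fun y₀ ↦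
    F.contDiffOn_coordVec_D hf himm (hs' y₀) hG hassoc, F.D_mem_normalSpace hG hassoc s⟩,
    fun y ↦ F.D_D_eq hf himm hassoc hG (hs' y)⟩
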